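/- **Setting.** A learner with $m$ pure actions and an optimizer with $n\ge 2$ pure actions play repeatedly; in round $t$ they choose mixed strategies $x_t\in\Delta_m$, $y_t\in\Delta_n$. The optimizer has one of $k\ge 1$ types with payoffs $u_{O,1},\dots,u_{O,k}:[m]\times[n]\to[-1,1]$, extended bilinearly to $\Delta_m\times\Delta_n$ and linearly to correlated strategy profiles (CSPs) $\varphi\in\Delta_{mn}$. A CSP assignment $\Phi=(\varphi_1,\dots,\varphi_k)\in\Delta_{mn}^k$ is *incentive-compatible* if $u_{O,i}(\varphi_i)\ge u_{O,i}(\varphi_{i'})$ for all $i,i'$. Its candidate menu is $\mathcal C(\Phi)=\{\varphi\in\Delta_{mn}: u_{O,i}(\varphi)\le u_{O,i}(\varphi_i)\ \forall i\}$. A set $S\subseteq\Delta_{mn}$ is *response-satisfiable* with respect to $u(x,y)=x\otimes y$ if for every $y\in\Delta_n$ there is $x\in\Delta_m$ with $x\otimes y\in S$. An *abortable anytime learning algorithm* $\mathcal A$ is a sequence of maps $A_t:\Delta_n^{t-1}\to\Delta_m\cup\{\textsc{Abort}\}$, $t\ge1$, with $x_t=A_t(y_1,\dots,y_{t-1})$;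 play stops at the first $\textsc{Abort}$. Let $\mathcal M(\mathcal A^T)$ be the convex hull of the CSPs $\frac1T\sum_{t\le T}x_t\otimes y_t$ of all non-aborting transcripts of length $T$. The menu $\mathcal M(\mathcal A)$ is the closed limit of the sets $\mathcal M(\mathcal A^T)$ in the Hausdorff metric as $T\to\infty$, if this limit exists. **Theorem.** There are an absolute constant $C$, a polynomial $p$ and a single program for the real random-access machine (exact unit-cost operations $+,-,\times,\div$, comparisons and rational constants on reals; index arithmetic and bounded loops) such that the following holds for all $m,k\ge1$, $n\ge 2$, all payoffs $u_{O,i}$ and every incentive-compatible $\Phi$. On input $(m,n,k,(u_{O,i})_i,\Phi)$, receiving the optimizer's move after each round and keeping its memory from round to round, the program implements an abortable anytime learning algorithm $\textsc{BlackwellAbort}(\Phi)$, taking at most $p(m,n,k,t)$ steps in round $t$, with these properties. 1. If it has not aborted in the first $\tau$ rounds, then $$\max_{i\in[k]}\ \sum_{t=1}^{\tau}\bigl(u_{O,i}(x_t,y_t)-u_{O,i}(\varphi_i)\bigr)\ \le\ C\sqrt{\tau\log\max(k,2)}.$$ Moreover the menu $\mathcal M(\textsc{BlackwellAbort}(\Phi))$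 exists and is contained in $\mathcal C(\Phi)$. 2. If it aborts against some sequence of moves of the optimizer, then $\mathcal C(\Phi)$ is not response-satisfiable with respect to $u(x,y)=x\otimes y$. 3. Each $\varphi_i$ lies in $\mathcal M(\textsc{BlackwellAbort}(\Phi))$, and there is a sequence of moves of the optimizer against which the algorithm never aborts and the CSP $\frac1T\sum_{t\le T}x_t\otimes y_t$ converges to $\varphi_i$ as $T\to\infty$. -/

import Mathlib

namespace MenuGame

noncomputable section

/-! ## Strategies, correlated strategy profiles and payoffs -/

/-- Mixed strategies over `d` pure actions: the simplex of probability vectors in `ℝ ^ d`. -/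
abbrev Mixed (d : ℕ) : Type := stdSimplex ℝ (Fin d)

/-- The `m * n`-dimensional Euclidean space in which correlated strategy profiles live. -/
abbrev CSPSpace (m n : ℕ) : Type := EuclideanSpace ℝ (Fin m × Fin n)

/-- The set of correlated strategy profiles (CSPs): probability distributions on pairs of
pure actions. -/
def cspSimplex (m n : ℕ) : Set (CSPSpace m n) :=
  {φ | (∀ p, 0 ≤ φ p) ∧ ∑ p, φ p = 1}

/-- The one-round CSP `x ⊗ y`. -/
def outer {m n : ℕ} (x : Mixed m) (y : Mixed n) : CSPSpace m n :=
  WithLp.toLp 2 fun p => x.1 p.1 * y.1 p.2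

/-- The payoff function `u` on pure action pairs, extended bilinearly to mixed strategies. -/
def mixedPayoff {m n : ℕ} (u : Fin m → Fin n → ℝ) (x : Mixed m) (y : Mixed n) : ℝ :=
  ∑ a, ∑ b, x.1 a * y.1 b * u a b

/-- The payoff function `u` on pure action pairs, extended linearly to CSPs. -/
def cspPayoff {m n : ℕ} (u : Fin m → Fin n → ℝ) (φ : CSPSpace m n) : ℝ :=
  ∑ a, ∑ b, φ (a, b) * u a b

/-- The CSP `(1 / T) ∑_{t ≤ T} x_t ⊗ y_t` of the first `T` rounds of play; `x t` and `y t` are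
the strategies played in round `t + 1`. -/
def avgCSP {m n : ℕ} (T : ℕ) (x : ℕ → Mixed m) (y : ℕ → Mixed n) : CSPSpace m n :=
  (T : ℝ)⁻¹ • ∑ t ∈ Finset.range T, outer (x t) (y t)

/-! ## CSP assignments and candidate menus -/

/-- `Φ = (φ_1, …, φ_k)` is an incentive-compatible CSP assignment for the payoffs
`U = (u_{O,1}, …, u_{O,k})`: every `φ_i` is a CSP, and type `i` weakly prefers `φ_i` to every
`φ_{i'}`. -/
def IncentiveCompatible {m n k : ℕ} (U : Fin k → Fin m → Fin n → ℝ)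
    (Φ : Fin k → CSPSpace m n) : Prop :=
  (∀ i, Φ i ∈ cspSimplex m n) ∧ ∀ i i', cspPayoff (U i) (Φ i') ≤ cspPayoff (U i) (Φ i)

/-- The candidate menu `C(Φ)`: all CSPs that no type `i` strictly prefers to `φ_i`. -/
def candidateMenu {m n k : ℕ} (U : Fin k → Fin m → Fin n → ℝ)
    (Φ : Fin k → CSPSpace m n) : Set (CSPSpace m n) :=
  {φ | φ ∈ cspSimplex m n ∧ ∀ i, cspPayoff (U i) φ ≤ cspPayoff (U i) (Φ i)}

/-- `S` is response-satisfiable with respect to the vector payoff `u`: for every mixed strategy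
`y` of the optimizer the learner has a mixed strategy `x` with `u x y ∈ S`. -/
def ResponseSatisfiable {m n : ℕ} {E : Type*} (u : Mixed m → Mixed n → E) (S : Set E) : Prop :=
  ∀ y, ∃ x, u x y ∈ S

/-! ## Abortable anytime learning algorithms and their menus -/

/-- An abortable anytime learning algorithm: for every `t`, a map from the optimizer's first `t`
moves to the learner's action in round `t + 1`, where `none` is the signal `Abort`. -/
abbrev AbortableAlg (m n : ℕ) : Type :=
  ∀ t : ℕ, (Fin t → Mixed n) → Option (Mixed m)

/-- The answer of `A` in round `t + 1` when the optimizer plays the sequence `y`. -/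
def AbortableAlg.answer {m n : ℕ} (A : AbortableAlg m n) (y : ℕ → Mixed n) (t : ℕ) :
    Option (Mixed m) :=
  A t fun s => y s

/-- The first `T` entries of `x` and `y` form a transcript of length `T` of `A` in which `A` does
not abort. -/
def AbortableAlg.IsTranscript {m n : ℕ} (A : AbortableAlg m n) (T : ℕ)
    (x : ℕ → Mixed m) (y : ℕ → Mixed n) : Prop :=
  ∀ t < T, A.answer y t = some (x t)

/-- The menu of horizon `T`: the convex hull of the CSPs of all non-aborting transcripts of
length `T` (empty if there are none). -/
def AbortableAlg.finiteMenu {m n : ℕ} (A : AbortableAlg m n) (T : ℕ) : Set (CSPSpace m n) :=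
  convexHull ℝ {φ | ∃ x y, A.IsTranscript T x y ∧ φ = avgCSP T x y}

/-- `M` is the asymptotic menu of `A`: the (unique closed) limit in the Hausdorff metric of the
menus of horizon `T`, as `T → ∞`. The distance is extended-real valued, so that the empty set is
at distance `⊤` from every non-empty set. -/
def AbortableAlg.IsMenu {m n : ℕ} (A : AbortableAlg m n) (M : Set (CSPSpace m n)) : Prop :=
  IsClosed M ∧
    Filter.Tendsto (fun T => Metric.hausdorffEDist (A.finiteMenu T) M) Filter.atTop (nhds 0)

/-- `A` can be brought to abort: after some non-aborting transcript its next answer is `Abort`. -/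
def AbortableAlg.MayAbort {m n : ℕ} (A : AbortableAlg m n) : Prop :=
  ∃ T x y, A.IsTranscript T x y ∧ A.answer y T = none

/-! ## A real random-access machine with unit-cost steps

A program works on integer index registers, on real registers, and on finitely many unbounded
real arrays (with up to three indices). A step is: an assignment, addition or truncated
subtraction of index registers; the loading of a rational constant; an exact arithmetic operation
on real registers; a load from or a store to an array at indices given by index registers; a
comparison; or the start of a pass through a loop, whose number of passes is read from an index
register on entry. There is no rounding and there are no transcendental functions. -/

/-- The state of the memory. -/
structure Mem where
  /-- Index registers. -/
  idx : ℕ → ℕ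
  /-- Real registers. -/
  num : ℕ → ℝ
  /-- Real arrays: `arr c i j l` is the entry `(i, j, l)` of array number `c`. -/
  arr : ℕ → ℕ → ℕ → ℕ → ℝ

/-- The memory after writing `v` to index register `i`. -/
def Mem.setIdx (s : Mem) (i v : ℕ) : Mem :=
  { s with idx := Function.update s.idx i v }

/-- The memory after writing `v` to real register `r`. -/
def Mem.setNum (s : Mem) (r : ℕ) (v : ℝ) : Mem :=
  { s with num := Function.update s.num r v }

/-- The memory after writing `v` to entry `(i, j, l)` of array `c`. -/
def Mem.setArr (s : Mem) (c i j l : ℕ) (v : ℝ) : Mem :=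
  { s with arr := fun c' i' j' l' =>
      if c' = c ∧ i' = i ∧ j' = j ∧ l' = l then v else s.arr c' i' j' l' }

/-- The exact arithmetic operations. -/
inductive ArithOp where
  | add
  | sub
  | mul
  | div

/-- The value of an arithmetic operation. -/
def ArithOp.eval : ArithOp → ℝ → ℝ → ℝ
  | .add, a, b => a + b
  | .sub, a, b => a - b
  | .mul, a, b => a * b
  | .div, a, b => a / b

/-- Programs. The natural-number arguments name registers and arrays, except for the constant
of `idxConst`. -/
inductive Prog where
  /-- do nothing -/
  | skip
  /-- index register `i := v` -/
  | idxConst (i v : ℕ)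
  /-- index register `i := j + l` -/
  | idxAdd (i j l : ℕ)
  /-- index register `i := j - l`, truncated at `0` -/
  | idxSub (i j l : ℕ)
  /-- real register `r := q` -/
  | numConst (r : ℕ) (q : ℚ)
  /-- real register `r := a ∘ b` for an arithmetic operation `∘` -/
  | arith (o : ArithOp) (r a b : ℕ)
  /-- real register `r := ` entry of array `c` at the indices held by `i, j, l` -/
  | load (r c i j l : ℕ)
  /-- entry of array `c` at the indices held by `i, j, l` `:=` real register `r` -/
  | store (c i j l r : ℕ)
  /-- first `p`, then `q` -/
  | seq (p q : Prog)
  /-- `p` if index register `i` is at most index register `j`, and `q` otherwise -/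
  | ifIdxLe (i j : ℕ) (p q : Prog)
  /-- `p` if real register `a` is at most real register `b`, and `q` otherwise -/
  | ifNumLe (a b : ℕ) (p q : Prog)
  /-- repeat `p` as many times as index register `i` says on entry -/
  | loop (i : ℕ) (p : Prog)

open Classical in
/-- Execution of a program on a memory paired with the number of steps taken so far. -/
def exec : Prog → Mem × ℕ → Mem × ℕ
  | .skip, s => (s.1, s.2 + 1)
  | .idxConst i v, s => (s.1.setIdx i v, s.2 + 1)
  | .idxAdd i j l, s => (s.1.setIdx i (s.1.idx j + s.1.idx l), s.2 + 1)
  | .idxSub i j l, s => (s.1.setIdx i (s.1.idx j - s.1.idx l), s.2 + 1)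
  | .numConst r q, s => (s.1.setNum r (q : ℝ), s.2 + 1)
  | .arith o r a b, s => (s.1.setNum r (o.eval (s.1.num a) (s.1.num b)), s.2 + 1)
  | .load r c i j l, s =>
      (s.1.setNum r (s.1.arr c (s.1.idx i) (s.1.idx j) (s.1.idx l)), s.2 + 1)
  | .store c i j l r, s =>
      (s.1.setArr c (s.1.idx i) (s.1.idx j) (s.1.idx l) (s.1.num r), s.2 + 1)
  | .seq p q, s => exec q (exec p s)
  | .ifIdxLe i j p q, s =>
      if s.1.idx i ≤ s.1.idx j then exec p (s.1, s.2 + 1) else exec q (s.1, s.2 + 1)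
  | .ifNumLe a b p q, s =>
      if s.1.num a ≤ s.1.num b then exec p (s.1, s.2 + 1) else exec q (s.1, s.2 + 1)
  | .loop i p, s =>
      (fun r : Mem × ℕ => exec p (r.1, r.2 + 1))^[s.1.idx i] (s.1, s.2 + 1)

/-- The memory before round `1`: index registers `0, 1, 2` hold `m, n, k`, array `0` holds the
payoffs, array `1` holds the CSP assignment, and everything else is `0`. -/
def startMem {m n k : ℕ} (U : Fin k → Fin m → Fin n → ℝ) (Φ : Fin k → CSPSpace m n) : Mem where
  idx r := if r = 0 then m else if r = 1 then n else if r = 2 then k else 0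
  num _ := 0
  arr c i a b :=
    if h : i < k ∧ a < m ∧ b < n then
      if c = 0 then U ⟨i, h.1⟩ ⟨a, h.2.1⟩ ⟨b, h.2.2⟩
      else if c = 1 then Φ ⟨i, h.1⟩ (⟨a, h.2.1⟩, ⟨b, h.2.2⟩)
      else 0
    else 0

/-- The optimizer's move `y` is written to the entries `(b, 0, 0)`, `b < n`, of array `2`. -/
def receiveMove {n : ℕ} (s : Mem) (y : Mixed n) : Mem :=
  { s with arr := fun c i j l =>
      if h : i < n then
        if c = 2 ∧ j = 0 ∧ l = 0 then y.1 ⟨i, h⟩ else s.arr c i j l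
      else s.arr c i j l }

/-- The memory before round `t + 1`, when in every round the same program `P` is run on the
memory left by the round before, into which the optimizer's last move has been written. -/
def memBefore {n : ℕ} (P : Prog) (s : Mem) (y : ℕ → Mixed n) : ℕ → Mem
  | 0 => s
  | t + 1 => receiveMove (exec P (memBefore P s y t, 0)).1 (y t)

/-- The answer read off the memory at the end of a round: `Abort` if index register `3` holds `0`,
and otherwise the vector in the entries `(a, 0, 0)`, `a < m`, of array `3`. -/
def readAnswer (m : ℕ) (s : Mem) : Option (Fin m → ℝ) :=
  if s.idx 3 = 0 then none else some fun a => s.arr 3 a 0 0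

/-- On the input `(m, n, k, U, Φ)` the program `P` implements the algorithm `A` and takes at most
`B t` steps in round `t`, in every round that is reached (including the one in which `A` aborts),
against every sequence of moves of the optimizer. -/
def Implements {m n k : ℕ} (P : Prog) (U : Fin k → Fin m → Fin n → ℝ)
    (Φ : Fin k → CSPSpace m n) (A : AbortableAlg m n) (B : ℕ → ℕ) : Prop :=
  ∀ (y : ℕ → Mixed n) (t : ℕ), (∀ s < t, A.answer y s ≠ none) →
    readAnswer m (exec P (memBefore P (startMem U Φ) y t, 0)).1
        = (A.answer y t).map Subtype.val ∧
      (exec P (memBefore P (startMem U Φ) y t, 0)).2 ≤ B (t + 1)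

end

end MenuGame

open MenuGame

/-!
The algorithm has two modes, and its menu is the whole candidate menu `C(Φ)`.

*Cooperation.* As long as all regrets `∑ t, (u_i(x_t, y_t) - u_i(φ_i))` are at most of order `√(L
T)` with `L = 1 + ⌈log₂ k⌉`, the learner plays the pure action that the optimizer requests. A
request is encoded in the smaller one of the first two probabilities of the optimizer's previous
move, which therefore has to be perturbed, but only by amounts with a finite sum over all rounds
(`signal`, `sum_playError_le`); this needs two actions of the optimizer. So a cooperating optimizer
can have any sequence of pairs of pure actions played, up to a bounded total error, provided that
the regrets along it stay small. For every `φ` in `C(Φ)` there is such a sequence with average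
profile tending to `φ` (`exists_steering`): run multiplicative weights with one expert for each
type, who gains `u_i(a, b) - u_i(φ_i)`, and two experts for each pair of actions, who gain the
deviations of its frequency from `φ`. All these gains have expectation at most `0` when the pair
`(a, b)` is drawn from `φ`, so some pair has weighted gain at most `0`, and all total gains are
`O(√T)`. The experts for the pairs together have the initial weight of a single type, so that the
constant for the regrets of the types depends neither on `m` nor on `n`, and the threshold for
cooperation can be chosen beyond it. Hence every point of `C(Φ)` is a limit of average profiles of
cooperative play, at a rate that is uniform in the point (`exists_play`).

*The Blackwell phase.* Once the threshold is exceeded, the learner runs multiplicative weights over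
the types, restarted in epochs of length `L * 4 ^ e` with step size proportional to `2⁻ᵉ`. A
response `x` whose weighted average of `u_i(x, b) - u_i(φ_i)` is at most `2⁻ᵉ` for all `b` keeps
the regrets of order `√(L T)` (`sum_gain_le`), so no exact solution of a linear program is needed.
Such a response is sought by multiplicative weights over the learner's actions. If `16 m 4 ^ e`
attempts fail, then the actions of the optimizer that refuted them form a mixed strategy against
which every action of the learner has positive weighted value (`solveProg_spec`); no `x` then
satisfies all constraints of `C(Φ)` against this strategy, and the algorithm may abort
(`not_responseSatisfiable`).

The regret bound holds in both modes (`regret_le`), so the menus of finite horizon are contained in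
small neighbourhoods of `C(Φ)`, and by `exists_play` they contain approximations of all of its
points (`isMenu_candidateMenu`). The program uses square roots and logarithms nowhere: it compares
squares, and it replaces `log k` by `L`. Its loops make at most `m`, `n`, `k` or `16 m 4 ^ e`
passes, and in epoch `e` of the Blackwell phase `4 ^ e` is at most linear in the number of the
round, so that the number of steps is polynomial (`cost_stateBefore_le`). -/

namespace MenuGame

noncomputable section

/-! ### Reasoning about programs -/

/-- The memory after running `p` on `s`. -/
def run (p : Prog) (s : Mem) : Mem := (exec p (s, 0)).1

/-- The number of steps of `p` on `s`. -/
def cost (p : Prog) (s : Mem) : ℕ := (exec p (s, 0)).2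

lemma iterate_exec_eq (p : Prog) (h : ∀ s c, exec p (s, c) = (run p s, c + cost p s)) (N : ℕ)
    (s : Mem) (c : ℕ) :
    (fun r : Mem × ℕ => exec p (r.1, r.2 + 1))^[N] (s, c) =
      ((run p)^[N] s, c + ∑ q ∈ Finset.range N, (1 + cost p ((run p)^[q] s))) := by
  induction N with
  | zero => simp
  | succ N ih =>
    rw [Function.iterate_succ_apply', ih, Function.iterate_succ_apply', Finset.sum_range_succ]
    simp only [h, Prod.mk.injEq, true_and]
    omega

/-- The steps of a program and its effect on the memory do not depend on the number of steps taken
before. -/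
lemma exec_eq (p : Prog) : ∀ s c, exec p (s, c) = (run p s, c + cost p s) := by
  induction p with
  | seq p q hp hq =>
    intro s c
    simp only [run, cost, exec]
    rw [hp s c, hp s 0, hq, hq]
    simp only [zero_add, Nat.add_assoc]
  | ifIdxLe i j p q hp hq =>
    intro s c
    by_cases h : s.idx i ≤ s.idx j
    · simp only [run, cost, exec, h, if_true]
      rw [hp s (c + 1), hp s (0 + 1)]
      simp only [zero_add, Nat.add_assoc]
    · simp only [run, cost, exec, h, if_false]
      rw [hq s (c + 1), hq s (0 + 1)]
      simp only [zero_add, Nat.add_assoc]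
  | ifNumLe i j p q hp hq =>
    intro s c
    by_cases h : s.num i ≤ s.num j
    · simp only [run, cost, exec, h, if_true]
      rw [hp s (c + 1), hp s (0 + 1)]
      simp only [zero_add, Nat.add_assoc]
    · simp only [run, cost, exec, h, if_false]
      rw [hq s (c + 1), hq s (0 + 1)]
      simp only [zero_add, Nat.add_assoc]
  | loop i p hp =>
    intro s c
    simp only [run, cost, exec]
    rw [iterate_exec_eq p hp, iterate_exec_eq p hp]
    simp only [zero_add, Nat.add_assoc]
  | _ => intro s c; simp only [run, cost, exec, zero_add]

lemma run_skip (s : Mem) : run .skip s = s := rfl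
lemma run_idxConst (i v : ℕ) (s : Mem) : run (.idxConst i v) s = s.setIdx i v := rfl
lemma run_idxAdd (i j l : ℕ) (s : Mem) :
    run (.idxAdd i j l) s = s.setIdx i (s.idx j + s.idx l) := rfl
lemma run_idxSub (i j l : ℕ) (s : Mem) :
    run (.idxSub i j l) s = s.setIdx i (s.idx j - s.idx l) := rfl
lemma run_numConst (r : ℕ) (q : ℚ) (s : Mem) : run (.numConst r q) s = s.setNum r q := rfl
lemma run_arith (o : ArithOp) (r a b : ℕ) (s : Mem) :
    run (.arith o r a b) s = s.setNum r (o.eval (s.num a) (s.num b)) := rfl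
lemma run_load (r c i j l : ℕ) (s : Mem) :
    run (.load r c i j l) s = s.setNum r (s.arr c (s.idx i) (s.idx j) (s.idx l)) := rfl
lemma run_store (c i j l r : ℕ) (s : Mem) :
    run (.store c i j l r) s = s.setArr c (s.idx i) (s.idx j) (s.idx l) (s.num r) := rfl
lemma run_seq (p q : Prog) (s : Mem) : run (.seq p q) s = run q (run p s) := by
  rw [run, exec, exec_eq p, exec_eq q]
lemma run_ifIdxLe (i j : ℕ) (p q : Prog) (s : Mem) :
    run (.ifIdxLe i j p q) s = if s.idx i ≤ s.idx j then run p s else run q s := by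
  rw [run, exec]
  split_ifs
  · rw [exec_eq]
  · rw [exec_eq]
lemma run_ifNumLe (i j : ℕ) (p q : Prog) (s : Mem) :
    run (.ifNumLe i j p q) s = if s.num i ≤ s.num j then run p s else run q s := by
  rw [run, exec]
  split_ifs
  · rw [exec_eq]
  · rw [exec_eq]
lemma run_loop (i : ℕ) (p : Prog) (s : Mem) : run (.loop i p) s = (run p)^[s.idx i] s := by
  rw [run, exec, iterate_exec_eq p (exec_eq p)]

lemma cost_seq (p q : Prog) (s : Mem) : cost (.seq p q) s = cost p s + cost q (run p s) := by
  rw [cost, exec, exec_eq p, exec_eq q, zero_add]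
lemma cost_ifIdxLe (i j : ℕ) (p q : Prog) (s : Mem) :
    cost (.ifIdxLe i j p q) s = 1 + if s.idx i ≤ s.idx j then cost p s else cost q s := by
  rw [cost, exec]
  split_ifs
  · rw [exec_eq]
  · rw [exec_eq]
lemma cost_ifNumLe (i j : ℕ) (p q : Prog) (s : Mem) :
    cost (.ifNumLe i j p q) s = 1 + if s.num i ≤ s.num j then cost p s else cost q s := by
  rw [cost, exec]
  split_ifs
  · rw [exec_eq]
  · rw [exec_eq]
lemma cost_loop (i : ℕ) (p : Prog) (s : Mem) :
    cost (.loop i p) s = 1 + ∑ q ∈ Finset.range (s.idx i), (1 + cost p ((run p)^[q] s)) := by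
  rw [cost, exec, iterate_exec_eq p (exec_eq p)]

@[simp] lemma setIdx_idx (s : Mem) (i v j : ℕ) :
    (s.setIdx i v).idx j = if j = i then v else s.idx j := by
  simp [Mem.setIdx, Function.update_apply]
@[simp] lemma setIdx_num (s : Mem) (i v : ℕ) : (s.setIdx i v).num = s.num := rfl
@[simp] lemma setIdx_arr (s : Mem) (i v : ℕ) : (s.setIdx i v).arr = s.arr := rfl
@[simp] lemma setNum_num (s : Mem) (i : ℕ) (v : ℝ) (j : ℕ) :
    (s.setNum i v).num j = if j = i then v else s.num j := by
  simp [Mem.setNum, Function.update_apply]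
@[simp] lemma setNum_idx (s : Mem) (i : ℕ) (v : ℝ) : (s.setNum i v).idx = s.idx := rfl
@[simp] lemma setNum_arr (s : Mem) (i : ℕ) (v : ℝ) : (s.setNum i v).arr = s.arr := rfl
@[simp] lemma setArr_num (s : Mem) (c i j l : ℕ) (v : ℝ) : (s.setArr c i j l v).num = s.num := rfl
@[simp] lemma setArr_idx (s : Mem) (c i j l : ℕ) (v : ℝ) : (s.setArr c i j l v).idx = s.idx := rfl
@[simp] lemma setArr_arr (s : Mem) (c i j l : ℕ) (v : ℝ) (c' i' j' l' : ℕ) :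
    (s.setArr c i j l v).arr c' i' j' l' =
      if c' = c ∧ i' = i ∧ j' = j ∧ l' = l then v else s.arr c' i' j' l' := rfl

/-! ### Registers and arrays that a program leaves alone -/

/-- Whether `p` contains an instruction that writes index register `r`. -/
def writesIdx : Prog → ℕ → Bool
  | .idxConst i _, r => r == i
  | .idxAdd i _ _, r => r == i
  | .idxSub i _ _, r => r == i
  | .seq p q, r => writesIdx p r || writesIdx q r
  | .ifIdxLe _ _ p q, r => writesIdx p r || writesIdx q r
  | .ifNumLe _ _ p q, r => writesIdx p r || writesIdx q r
  | .loop _ p, r => writesIdx p r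
  | _, _ => false

/-- Whether `p` contains an instruction that writes real register `r`. -/
def writesNum : Prog → ℕ → Bool
  | .numConst i _, r => r == i
  | .arith _ i _ _, r => r == i
  | .load i _ _ _ _, r => r == i
  | .seq p q, r => writesNum p r || writesNum q r
  | .ifIdxLe _ _ p q, r => writesNum p r || writesNum q r
  | .ifNumLe _ _ p q, r => writesNum p r || writesNum q r
  | .loop _ p, r => writesNum p r
  | _, _ => false

/-- Whether `p` contains an instruction that writes to array `c`. -/
def writesArr : Prog → ℕ → Bool
  | .store c _ _ _ _, r => r == c
  | .seq p q, r => writesArr p r || writesArr q r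
  | .ifIdxLe _ _ p q, r => writesArr p r || writesArr q r
  | .ifNumLe _ _ p q, r => writesArr p r || writesArr q r
  | .loop _ p, r => writesArr p r
  | _, _ => false

/-- The memories `s` and `s'` agree on everything that `p` does not write. -/
structure Frame (p : Prog) (s s' : Mem) : Prop where
  idx : ∀ r, writesIdx p r = false → s'.idx r = s.idx r
  num : ∀ r, writesNum p r = false → s'.num r = s.num r
  arr : ∀ c, writesArr p c = false → s'.arr c = s.arr c

lemma Frame.refl (p : Prog) (s : Mem) : Frame p s s :=
  ⟨fun _ _ => rfl, fun _ _ => rfl, fun _ _ => rfl⟩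

lemma Frame.trans {p : Prog} {s s' s'' : Mem} (h : Frame p s s') (h' : Frame p s' s'') :
    Frame p s s'' :=
  ⟨fun r hr => (h'.idx r hr).trans (h.idx r hr), fun r hr => (h'.num r hr).trans (h.num r hr),
    fun r hr => (h'.arr r hr).trans (h.arr r hr)⟩

lemma Frame.mono {p q : Prog} {s s' : Mem} (h : Frame p s s')
    (hi : ∀ r, writesIdx q r = false → writesIdx p r = false)
    (hn : ∀ r, writesNum q r = false → writesNum p r = false)
    (ha : ∀ r, writesArr q r = false → writesArr p r = false) : Frame q s s' :=
  ⟨fun r hr => h.idx r (hi r hr), fun r hr => h.num r (hn r hr), fun r hr => h.arr r (ha r hr)⟩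

lemma frame_run (p : Prog) : ∀ s, Frame p s (run p s) := by
  induction p with
  | skip => intro s; exact Frame.refl _ _
  | idxConst i v =>
    intro s; rw [run_idxConst]
    exact ⟨fun r hr => by simp_all [writesIdx], fun r hr => rfl, fun r hr => rfl⟩
  | idxAdd i j l =>
    intro s; rw [run_idxAdd]
    exact ⟨fun r hr => by simp_all [writesIdx], fun r hr => rfl, fun r hr => rfl⟩
  | idxSub i j l =>
    intro s; rw [run_idxSub]
    exact ⟨fun r hr => by simp_all [writesIdx], fun r hr => rfl, fun r hr => rfl⟩
  | numConst i v =>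
    intro s; rw [run_numConst]
    exact ⟨fun r hr => rfl, fun r hr => by simp_all [writesNum], fun r hr => rfl⟩
  | arith o r a b =>
    intro s; rw [run_arith]
    exact ⟨fun r hr => rfl, fun r hr => by simp_all [writesNum], fun r hr => rfl⟩
  | load r c i j l =>
    intro s; rw [run_load]
    exact ⟨fun r hr => rfl, fun r hr => by simp_all [writesNum], fun r hr => rfl⟩
  | store c i j l r =>
    intro s; rw [run_store]
    exact ⟨fun r hr => rfl, fun r hr => rfl, fun r hr => by
      funext a b d; simp_all [writesArr]⟩
  | seq p q hp hq =>
    intro s; rw [run_seq]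
    refine Frame.trans (s' := run p s) ((hp s).mono ?_ ?_ ?_) ((hq _).mono ?_ ?_ ?_) <;>
      intro r hr <;> simp_all [writesIdx, writesNum, writesArr]
  | ifIdxLe i j p q hp hq =>
    intro s; rw [run_ifIdxLe]
    split_ifs
    · refine (hp s).mono ?_ ?_ ?_ <;> intro r hr <;> simp_all [writesIdx, writesNum, writesArr]
    · refine (hq s).mono ?_ ?_ ?_ <;> intro r hr <;> simp_all [writesIdx, writesNum, writesArr]
  | ifNumLe i j p q hp hq =>
    intro s; rw [run_ifNumLe]
    split_ifs
    · refine (hp s).mono ?_ ?_ ?_ <;> intro r hr <;> simp_all [writesIdx, writesNum, writesArr]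
    · refine (hq s).mono ?_ ?_ ?_ <;> intro r hr <;> simp_all [writesIdx, writesNum, writesArr]
  | loop i p hp =>
    intro s; rw [run_loop]
    generalize s.idx i = N
    induction N with
    | zero => exact Frame.refl _ _
    | succ N ih =>
      rw [Function.iterate_succ_apply']
      exact ih.trans ((hp _).mono (fun _ h => h) (fun _ h => h) (fun _ h => h))

/-- The invariant rule for `loop`. The step may use that everything which the body does not write
still has its value from before the loop. -/
lemma loop_induct (c : ℕ) (p : Prog) (s : Mem) (Inv : ℕ → Mem → Prop) (h0 : Inv 0 s)
    (hstep : ∀ q < s.idx c, ∀ s', Frame p s s' → Inv q s' → Inv (q + 1) (run p s')) :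
    Inv (s.idx c) (run (.loop c p) s) := by
  rw [run_loop]
  have key : ∀ q ≤ s.idx c, Frame p s ((run p)^[q] s) ∧ Inv q ((run p)^[q] s) := by
    intro q
    induction q with
    | zero => exact fun _ => ⟨Frame.refl _ _, h0⟩
    | succ q ih =>
      intro hq
      obtain ⟨h1, h2⟩ := ih (by omega)
      rw [Function.iterate_succ_apply']
      exact ⟨h1.trans (frame_run _ _), hstep q (by omega) _ h1 h2⟩
  exact (key _ le_rfl).2

/-- `for j := 0, …, (register c) - 1 do p`. Register `9` has to hold the constant `1`. -/
def forLoop (j c : ℕ) (p : Prog) : Prog :=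
  .seq (.idxConst j 0) (.loop c (.seq p (.idxAdd j j 9)))

/-- The invariant rule for `forLoop`. -/
lemma forLoop_induct {j c : ℕ} {p : Prog} {s : Mem} (Inv : ℕ → Mem → Prop)
    (hj : writesIdx p j = false) (h9 : writesIdx p 9 = false) (hj9 : j ≠ 9) (hcj : c ≠ j)
    (hone : s.idx 9 = 1) (h0 : Inv 0 (s.setIdx j 0))
    (hstep : ∀ q < s.idx c, ∀ s', Frame (forLoop j c p) s s' → s'.idx j = q → Inv q s' →
      Inv (q + 1) ((run p s').setIdx j (q + 1))) :
    Inv (s.idx c) (run (forLoop j c p) s) := by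
  have hc : (s.setIdx j 0).idx c = s.idx c := by simp [hcj]
  have hF : Frame (forLoop j c p) s (s.setIdx j 0) := by
    refine ⟨fun r hr => ?_, fun r hr => rfl, fun r hr => rfl⟩
    have : r ≠ j := by rintro rfl; simp [forLoop, writesIdx] at hr
    simp [this]
  have := loop_induct c (.seq p (.idxAdd j j 9)) (s.setIdx j 0)
    (fun q s' => s'.idx j = q ∧ Inv q s') ⟨by simp, h0⟩ ?_
  · rw [hc] at this
    rw [forLoop, run_seq, run_idxConst]
    exact this.2
  · rw [hc]
    rintro q hq s' hs' ⟨h1, h2⟩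
    have hF' : Frame (forLoop j c p) s s' := hF.trans (hs'.mono
      (fun r hr => by simp_all [forLoop, writesIdx])
      (fun r hr => by simp_all [forLoop, writesNum])
      (fun r hr => by simp_all [forLoop, writesArr]))
    have h9' : s'.idx 9 = 1 := by
      rw [hs'.idx 9 (by simp [writesIdx, h9, hj9.symm])]
      simp [hj9.symm, hone]
    have e : run (.seq p (.idxAdd j j 9)) s' = (run p s').setIdx j (q + 1) := by
      rw [run_seq, run_idxAdd, (frame_run p s').idx j hj, (frame_run p s').idx 9 h9, h1, h9']
    rw [e]
    exact ⟨by simp, hstep q hq s' hF' h1 h2⟩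

/-! ### Bounds on the number of steps -/

/-- The index registers that hold the numbers of passes of the loops of `p`. -/
def loopRegs : Prog → List ℕ
  | .seq p q => loopRegs p ++ loopRegs q
  | .ifIdxLe _ _ p q => loopRegs p ++ loopRegs q
  | .ifNumLe _ _ p q => loopRegs p ++ loopRegs q
  | .loop i p => i :: loopRegs p
  | _ => []

/-- The number of instructions of `p`; a loop instruction counts twice, once for its start and once
for the starts of its passes. -/
def progSize : Prog → ℕ
  | .seq p q => progSize p + progSize q
  | .ifIdxLe _ _ p q => progSize p + progSize q + 1
  | .ifNumLe _ _ p q => progSize p + progSize q + 1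
  | .loop _ p => progSize p + 2
  | _ => 1

/-- The nesting depth of the loops of `p`. -/
def loopDepth : Prog → ℕ
  | .seq p q => max (loopDepth p) (loopDepth q)
  | .ifIdxLe _ _ p q => max (loopDepth p) (loopDepth q)
  | .ifNumLe _ _ p q => max (loopDepth p) (loopDepth q)
  | .loop _ p => loopDepth p + 1
  | _ => 0

/-- The bound `cost_le`, in a form that passes to subprograms: the registers that count passes have
to be left alone by the whole program and not only by the subprogram, so a set `W` that contains
the registers written by the whole program is carried along. -/
lemma cost_le_aux (B : ℕ) (W : ℕ → Bool) (p : Prog) : ∀ s,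
    (∀ r, W r = false → writesIdx p r = false) →
    (∀ r ∈ loopRegs p, W r = false ∧ s.idx r ≤ B) →
    cost p s ≤ progSize p * (B + 1) ^ loopDepth p := by
  have hB : 1 ≤ B + 1 := by omega
  induction p with
  | seq p q hp hq =>
    intro s hW hs
    rw [cost_seq]
    have h1 := hp s (fun r hr => by have := hW r hr; simp_all [writesIdx])
      (fun r hr => hs r (by simp [loopRegs, hr]))
    have h2 := hq (run p s) (fun r hr => by have := hW r hr; simp_all [writesIdx])
      (fun r hr => by
        have h := hs r (by simp [loopRegs, hr])
        refine ⟨h.1, ?_⟩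
        rw [(frame_run p s).idx r (by have := hW r h.1; simp_all [writesIdx])]
        exact h.2)
    simp only [progSize, loopDepth, add_mul]
    refine add_le_add (h1.trans ?_) (h2.trans ?_) <;>
      exact Nat.mul_le_mul_left _ (Nat.pow_le_pow_right hB (by simp))
  | ifIdxLe i j p q hp hq =>
    intro s hW hs
    have h1 := hp s (fun r hr => by have := hW r hr; simp_all [writesIdx])
      (fun r hr => hs r (by simp [loopRegs, hr]))
    have h2 := hq s (fun r hr => by have := hW r hr; simp_all [writesIdx])
      (fun r hr => hs r (by simp [loopRegs, hr]))
    have e1 := h1.trans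
      (Nat.mul_le_mul_left _ (Nat.pow_le_pow_right hB (le_max_left _ (loopDepth q))))
    have e2 := h2.trans
      (Nat.mul_le_mul_left _ (Nat.pow_le_pow_right hB (le_max_right (loopDepth p) _)))
    have e3 : 1 ≤ (B + 1) ^ (max (loopDepth p) (loopDepth q)) := Nat.one_le_pow _ _ hB
    rw [cost_ifIdxLe]
    simp only [progSize, loopDepth, add_mul, one_mul]
    split_ifs <;> omega
  | ifNumLe i j p q hp hq =>
    intro s hW hs
    have h1 := hp s (fun r hr => by have := hW r hr; simp_all [writesIdx])
      (fun r hr => hs r (by simp [loopRegs, hr]))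
    have h2 := hq s (fun r hr => by have := hW r hr; simp_all [writesIdx])
      (fun r hr => hs r (by simp [loopRegs, hr]))
    have e1 := h1.trans
      (Nat.mul_le_mul_left _ (Nat.pow_le_pow_right hB (le_max_left _ (loopDepth q))))
    have e2 := h2.trans
      (Nat.mul_le_mul_left _ (Nat.pow_le_pow_right hB (le_max_right (loopDepth p) _)))
    have e3 : 1 ≤ (B + 1) ^ (max (loopDepth p) (loopDepth q)) := Nat.one_le_pow _ _ hB
    rw [cost_ifNumLe]
    simp only [progSize, loopDepth, add_mul, one_mul]
    split_ifs <;> omega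
  | loop i p hp =>
    intro s hW hs
    rw [cost_loop]
    have hfr : ∀ q, Frame p s ((run p)^[q] s) := by
      intro q
      induction q with
      | zero => exact Frame.refl _ _
      | succ q ih => rw [Function.iterate_succ_apply']; exact ih.trans (frame_run _ _)
    have h1 : ∀ q, cost p ((run p)^[q] s) ≤ progSize p * (B + 1) ^ loopDepth p := fun q =>
      hp _ hW (fun r hr => by
        have h := hs r (by simp [loopRegs, hr])
        refine ⟨h.1, ?_⟩
        rw [(hfr q).idx r (hW r h.1)]
        exact h.2)
    have h2 : ∑ q ∈ Finset.range (s.idx i), (1 + cost p ((run p)^[q] s))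
        ≤ s.idx i * (1 + progSize p * (B + 1) ^ loopDepth p) := by
      have := Finset.sum_le_card_nsmul (Finset.range (s.idx i))
        (fun q => 1 + cost p ((run p)^[q] s)) (1 + progSize p * (B + 1) ^ loopDepth p)
        (fun q _ => by have := h1 q; omega)
      simpa using this
    have h3 : s.idx i ≤ B := (hs i (by simp [loopRegs])).2
    have h4 := Nat.mul_le_mul_right (1 + progSize p * (B + 1) ^ loopDepth p) h3
    have e3 : 1 ≤ (B + 1) ^ (loopDepth p) := Nat.one_le_pow _ _ hB
    simp only [progSize, loopDepth, pow_succ]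
    generalize (B + 1) ^ loopDepth p = X at *
    have : 1 + B * (1 + progSize p * X) ≤ (progSize p + 2) * (X * (B + 1)) := by nlinarith
    omega
  | _ => intro s _ _; simp [cost, exec, progSize, loopDepth]

/-- A program that does not write the registers which count the passes of its loops takes
polynomially many steps in the values of these registers. -/
lemma cost_le {p : Prog} {s : Mem} {B : ℕ}
    (h : ∀ r ∈ loopRegs p, writesIdx p r = false ∧ s.idx r ≤ B) :
    cost p s ≤ progSize p * (B + 1) ^ loopDepth p :=
  cost_le_aux B (writesIdx p) p s (fun _ h => h) h

/-! ### The program -/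

/-!
Use of the memory. Index registers: `0`, `1`, `2` hold `m`, `n`, `k`; `3` the status that is read
off at the end of a round; `4` the mode (`0` for cooperation, `1` for the Blackwell phase); `5` the
number of rounds that remain in the current epoch; `6` the length of the epoch; `7` the number of
attempts at finding a response; `8` the constant `0`; `9` the constant `1`; `10` the number `L`;
`11` to `19` are auxiliary. Real registers: `0` holds the accuracy `2⁻ᵉ` of epoch `e`; `1` the
number of the round; `2` the threshold for the squares of the regrets; `3` the number `L`; `20` the
constant `1`; `21` the constant `0`; `4` to `9` are auxiliary. Arrays: `0` holds the payoffs; `1`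
the CSP assignment; `2` the last move of the optimizer; `3` the response; `4` the weights of the
types; `5` the regrets; `6` the values `u_i(φ_i)`; `7` the matrix of the game in which a response
is sought; `8` the weights of the learner's actions in this search. The constants `0` are never
written: these registers keep their initial value. -/

/-- Sequential composition of a list of programs. -/
def block : List Prog → Prog
  | [] => .skip
  | [p] => p
  | p :: q :: l => .seq p (block (q :: l))

/-- Real register `20 := 1`, index register `9 := 1`; real register `3` and index register `10`
`:= 1 + ⌈log₂ k⌉`. -/
def logProg : Prog := block [
  .idxConst 9 1, .numConst 20 1, .idxConst 10 1, .idxConst 11 1, .numConst 3 1,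
  .loop 2 (.ifIdxLe 2 11 .skip
    (block [.idxAdd 11 11 11, .idxAdd 10 10 9, .arith .add 3 3 20]))]

/-- Real register `1` counts the rounds, and real register `2` becomes the bound `784 L T` on the
square of the regret up to which the learner cooperates in round `T`. Here `784 = 28 ^ 2`: play
that is steered to a point of the candidate menu has regret at most `24 √(L T)`, the errors in
carrying it out add at most `3`, and the regret that the program computes is off by at most `1`. -/
def thresholdProg : Prog := block [
  .arith .add 1 1 20, .numConst 2 784, .arith .mul 2 2 3, .arith .mul 2 2 1]

/-- For type `i` in index register `12`: real register `4 := u_i(φ_i)` and real register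
`5 := u_i(x, y)`. -/
def payoffProg : Prog := block [
  .numConst 4 0, .numConst 5 0,
  forLoop 13 0 (forLoop 14 1 (block [
    .load 6 0 12 13 14, .load 7 1 12 13 14, .arith .mul 7 7 6, .arith .add 4 4 7,
    .load 7 3 13 8 8, .load 8 2 14 8 8, .arith .mul 7 7 8, .arith .mul 7 7 6,
    .arith .add 5 5 7]))]

/-- For the type in index register `12`: update of the regret (array `5`), the weight (array `4`)
and the value `u_i(φ_i)` (array `6`). -/
def updateProg : Prog := block [
  .store 6 12 8 8 4, .arith .sub 5 5 4,
  .load 6 5 12 8 8, .arith .add 6 6 5, .store 5 12 8 8 6,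
  .load 7 4 12 8 8, .arith .mul 8 5 0, .numConst 9 (1 / 4), .arith .mul 8 8 9,
  .arith .add 8 8 20, .arith .mul 7 7 8, .store 4 12 8 8 7]

/-- Index register `18` becomes `1` if the regret in real register `6` is positive and its square
exceeds the threshold. Squares are compared because the machine has no square roots. -/
def checkProg : Prog :=
  .ifNumLe 6 21 .skip (.seq (.arith .mul 6 6 6) (.ifNumLe 6 2 .skip (.idxConst 18 1)))

/-- Update of all regrets and weights; afterwards index register `18` is `0` if no regret is too
large. -/
def regretProg : Prog := block [
  .idxConst 18 0,
  forLoop 12 2 (block [payoffProg, updateProg, checkProg])]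

/-- Real register `5 := 4 m T² min (y_0, y_1)`, where `T` is in real register `1`. In the last move
`y` the optimizer encodes the pure action that it wants the learner to play, in such a way that the
encoding changes the move by a summable amount. -/
def requestProg : Prog := block [
  .load 5 2 8 8 8, .load 6 2 9 8 8,
  .ifNumLe 5 6 .skip (.arith .add 5 6 21),
  .numConst 6 0, .loop 0 (.arith .add 6 6 20),
  .arith .mul 5 5 6, .numConst 6 4, .arith .mul 5 5 6, .arith .mul 5 5 1, .arith .mul 5 5 1]

/-- The greatest pure action that is at most real register `5` is written to array `3`, as a mixed
strategy. -/
def pureProg : Prog := block [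
  .idxConst 19 0, .numConst 6 0,
  forLoop 13 0 (block [
    .store 3 13 8 8 21,
    .ifNumLe 6 5 (.idxAdd 19 13 8) .skip,
    .arith .add 6 6 20]),
  .store 3 19 8 8 20]

/-- Cooperation: the learner plays the pure action requested by the last move of the optimizer. -/
def cooperateProg : Prog := block [requestProg, pureProg, .idxConst 3 1]

/-- Beginning of the Blackwell phase: the parameters of epoch `0` are written to real register `0`
and index registers `6` and `7`. As no rounds remain in epoch `0`, `epochProg` then moves on to
epoch `1`. -/
def enterProg : Prog := block [
  .idxConst 4 1, .numConst 0 1, .idxAdd 6 10 8, .idxAdd 7 0 0, .idxAdd 7 7 7, .idxAdd 7 7 7,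
  .idxAdd 7 7 7]

/-- Beginning of an epoch, if the previous epoch is over: the accuracy is halved, the length of the
epoch and the number of attempts are multiplied by `4`, and the weights are reset to `1`. -/
def epochProg : Prog :=
  .ifIdxLe 5 8 (block [
    .numConst 4 (1 / 2), .arith .mul 0 0 4,
    .idxAdd 6 6 6, .idxAdd 6 6 6, .idxAdd 7 7 7, .idxAdd 7 7 7, .idxAdd 5 6 8,
    forLoop 12 2 (.store 4 12 8 8 20)]) .skip

/-- The bookkeeping at the beginning of a round. -/
def accountProg : Prog := block [logProg, thresholdProg, .idxSub 5 5 9, regretProg]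

/-- The choice between cooperation and the Blackwell phase, from which there is no way back. -/
def branchProg : Prog := block [
  .ifIdxLe 9 4 .skip (.ifIdxLe 18 8 cooperateProg enterProg),
  .ifIdxLe 9 4 epochProg .skip]

/-- The part of a round that precedes the search for a response. -/
def preProg : Prog := .seq accountProg branchProg

/-- Array `7` becomes the matrix `g(a, b) = ∑ i, w_i (u_i(a, b) - u_i(φ_i)) / ∑ i, w_i`, and
array `8` the vector of ones. -/
def gameProg : Prog := block [
  .numConst 4 0,
  forLoop 12 2 (block [.load 5 4 12 8 8, .arith .add 4 4 5]),
  forLoop 13 0 (block [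
    .store 8 13 8 8 20,
    forLoop 14 1 (block [
      .numConst 5 0,
      forLoop 12 2 (block [
        .load 6 0 12 13 14, .load 7 6 12 8 8, .arith .sub 6 6 7, .load 7 4 12 8 8,
        .arith .mul 7 7 6, .arith .add 5 5 7]),
      .arith .div 5 5 4, .store 7 13 14 8 5])])]

/-- Array `3` becomes array `8`, normalised to a probability vector. -/
def normalizeProg : Prog := block [
  .numConst 4 0,
  forLoop 13 0 (block [.load 5 8 13 8 8, .arith .add 4 4 5]),
  forLoop 13 0 (block [.load 5 8 13 8 8, .arith .div 5 5 4, .store 3 13 8 8 5])]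

/-- If the strategy in array `3` has value more than `E` against a pure action of the optimizer,
then index register `16` becomes `1`, and index register `17` such an action. -/
def violationProg : Prog := block [
  .idxConst 16 0,
  forLoop 14 1 (block [
    .numConst 5 0,
    forLoop 13 0 (block [
      .load 6 3 13 8 8, .load 7 7 13 14 8, .arith .mul 6 6 7, .arith .add 5 5 6]),
    .ifNumLe 5 0 .skip (block [.idxConst 16 1, .idxAdd 17 14 8])])]

/-- The multiplicative update of array `8` against the action in index register `17`, with step size
`E / 8` for the accuracy `E`. -/
def punishProg : Prog := block [
  .numConst 4 (1 / 8), .arith .mul 4 4 0,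
  forLoop 13 0 (block [
    .load 5 8 13 8 8, .load 6 7 13 17 8, .arith .mul 6 6 4, .arith .sub 6 20 6,
    .arith .mul 5 5 6, .store 8 13 8 8 5])]

/-- One attempt at finding a response. -/
def attemptProg : Prog := block [
  normalizeProg, violationProg, .ifIdxLe 16 8 (.idxConst 3 1) punishProg]

/-- The search for a response: index register `3` is `1` on success and `0` on failure. The `16 m 4
^ e` attempts in index register `7` are so many that failure is a proof that no response exists. -/
def solveProg : Prog := block [
  gameProg, .idxConst 3 0, .loop 7 (.ifIdxLe 3 8 attemptProg .skip)]

/-- The program that is run in every round. -/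
def blackwellAbort : Prog := .seq preProg (.ifIdxLe 9 4 solveProg .skip)

/-! ### Correctness of the parts of the program -/

/-- The program finds `⌈log₂ k⌉` as the number of doublings of `1` that reach `k`. -/
lemma logProg_spec (s : Mem) :
    (run logProg s).idx 9 = 1 ∧ (run logProg s).num 20 = 1 ∧
    (run logProg s).idx 10 = 1 + Nat.clog 2 (s.idx 2) ∧
    (run logProg s).num 3 = ((1 + Nat.clog 2 (s.idx 2) : ℕ) : ℝ) := by
  set s1 := run (block [
    .idxConst 9 1, .numConst 20 1, .idxConst 10 1, .idxConst 11 1, .numConst 3 1]) s with hs1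
  have e : run logProg s = run (.loop 2 (.ifIdxLe 2 11 .skip
    (block [.idxAdd 11 11 11, .idxAdd 10 10 9, .arith .add 3 3 20]))) s1 := by
    simp only [hs1, logProg, block, run_seq]
  have h2 : s1.idx 2 = s.idx 2 := by
    simp [hs1, block, run_seq, run_idxConst, run_numConst]
  have key := loop_induct 2 (.ifIdxLe 2 11 .skip
    (block [.idxAdd 11 11 11, .idxAdd 10 10 9, .arith .add 3 3 20])) s1
    (fun q s' => s'.idx 2 = s.idx 2 ∧ s'.idx 9 = 1 ∧ s'.num 20 = 1 ∧
      s'.idx 10 = 1 + min q (Nat.clog 2 (s.idx 2)) ∧ s'.num 3 = (s'.idx 10 : ℝ) ∧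
      s'.idx 11 = 2 ^ min q (Nat.clog 2 (s.idx 2)))
    (by simp [hs1, block, run_seq, run_idxConst, run_numConst]) ?_
  · rw [e]
    rw [h2] at key
    have : min (s.idx 2) (Nat.clog 2 (s.idx 2)) = Nat.clog 2 (s.idx 2) := by
      apply min_eq_right
      exact Nat.clog_le_of_le_pow (Nat.lt_two_pow_self).le
    rw [this] at key
    obtain ⟨_, a, b, c, d, _⟩ := key
    refine ⟨a, b, c, ?_⟩
    rw [d, c]
  · rintro q - s' - ⟨a, b, c, d, f, g⟩
    rw [run_ifIdxLe]
    have hiff : s'.idx 2 ≤ s'.idx 11 ↔ Nat.clog 2 (s.idx 2) ≤ min q (Nat.clog 2 (s.idx 2)) := by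
      rw [a, g, Nat.clog_le_iff_le_pow (by norm_num)]
    by_cases h : s'.idx 2 ≤ s'.idx 11
    · rw [if_pos h, run_skip]
      have h' := hiff.1 h
      have : min (q + 1) (Nat.clog 2 (s.idx 2)) = min q (Nat.clog 2 (s.idx 2)) := by omega
      rw [this]
      exact ⟨a, b, c, d, f, g⟩
    · rw [if_neg h]
      have h' := fun h'' => h (hiff.2 h'')
      have : min (q + 1) (Nat.clog 2 (s.idx 2)) = min q (Nat.clog 2 (s.idx 2)) + 1 := by omega
      rw [this]
      simp [block, run_seq, run_idxAdd, run_arith, a, b, c, d, f, g, ArithOp.eval, pow_succ,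
        mul_two]
      ring

/-- The value `u_i(φ_i)` of the payoffs and the CSP assignment in memory. -/
def targetValue (s : Mem) (i : ℕ) : ℝ :=
  ∑ a ∈ Finset.range (s.idx 0), ∑ b ∈ Finset.range (s.idx 1), s.arr 1 i a b * s.arr 0 i a b

/-- The value `u_i(x, y)` of the strategies in memory. -/
def roundValue (s : Mem) (i : ℕ) : ℝ :=
  ∑ a ∈ Finset.range (s.idx 0), ∑ b ∈ Finset.range (s.idx 1),
    s.arr 3 a 0 0 * s.arr 2 b 0 0 * s.arr 0 i a b

lemma payoffProg_spec (s : Mem) (h9 : s.idx 9 = 1) (h8 : s.idx 8 = 0) :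
    (run payoffProg s).num 4 = targetValue s (s.idx 12) ∧
    (run payoffProg s).num 5 = roundValue s (s.idx 12) := by
  unfold targetValue roundValue
  set s1 := run (.numConst 5 0) (run (.numConst 4 0) s) with hs1
  simp only [payoffProg, block, run_seq, ← hs1]
  have h1 : s1.num 4 = 0 ∧ s1.num 5 = 0 := by simp [hs1, run_numConst]
  rw [show s.idx = s1.idx from rfl, show s.arr = s1.arr from rfl]
  replace h9 : s1.idx 9 = 1 := h9
  replace h8 : s1.idx 8 = 0 := h8
  clear_value s1
  refine forLoop_induct (fun q s' => s'.num 4 = ∑ a ∈ Finset.range q,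
      ∑ b ∈ Finset.range (s1.idx 1), s1.arr 1 (s1.idx 12) a b * s1.arr 0 (s1.idx 12) a b ∧
    s'.num 5 = ∑ a ∈ Finset.range q, ∑ b ∈ Finset.range (s1.idx 1),
      s1.arr 3 a 0 0 * s1.arr 2 b 0 0 * s1.arr 0 (s1.idx 12) a b) rfl rfl (by norm_num)
      (by norm_num) h9 (by simp [h1]) ?_
  rintro a - s2 F hj ⟨i1, i2⟩
  have f1 := F.idx 1 rfl
  rw [setIdx_num, Finset.sum_range_succ, Finset.sum_range_succ, ← f1]
  refine forLoop_induct (fun q s' => s'.num 4 = _ + ∑ b ∈ Finset.range q,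
      s1.arr 1 (s1.idx 12) a b * s1.arr 0 (s1.idx 12) a b ∧
    s'.num 5 = _ + ∑ b ∈ Finset.range q,
      s1.arr 3 a 0 0 * s1.arr 2 b 0 0 * s1.arr 0 (s1.idx 12) a b) rfl rfl (by norm_num)
      (by norm_num) ((F.idx 9 rfl).trans h9) (by simp [f1, i1, i2]) ?_
  rintro b - s3 G hk ⟨k1, k2⟩
  have e13 := (G.idx 13 rfl).trans hj
  have e12 := (G.idx 12 rfl).trans (F.idx 12 rfl)
  have e8 := ((G.idx 8 rfl).trans (F.idx 8 rfl)).trans h8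
  have a0 := (G.arr 0 rfl).trans (F.arr 0 rfl)
  have a1 := (G.arr 1 rfl).trans (F.arr 1 rfl)
  have a2 := (G.arr 2 rfl).trans (F.arr 2 rfl)
  have a3 := (G.arr 3 rfl).trans (F.arr 3 rfl)
  rw [Finset.sum_range_succ, Finset.sum_range_succ]
  simp [run_seq, run_load, run_arith, ArithOp.eval, k1, k2, e13, e12, e8, a0, a1, a2, a3, hk,
    add_assoc]

lemma updateProg_spec (s : Mem) (h8 : s.idx 8 = 0) (h20 : s.num 20 = 1) :
    (run updateProg s).num 6 = s.arr 5 (s.idx 12) 0 0 + (s.num 5 - s.num 4) ∧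
    (∀ i, (run updateProg s).arr 6 i 0 0 = if i = s.idx 12 then s.num 4 else s.arr 6 i 0 0) ∧
    (∀ i, (run updateProg s).arr 5 i 0 0 = if i = s.idx 12 then
      s.arr 5 i 0 0 + (s.num 5 - s.num 4) else s.arr 5 i 0 0) ∧
    (∀ i, (run updateProg s).arr 4 i 0 0 = if i = s.idx 12 then
      s.arr 4 i 0 0 * (1 + s.num 0 / 4 * (s.num 5 - s.num 4)) else s.arr 4 i 0 0) := by
  simp only [updateProg, block, run_seq, run_load, run_store, run_arith, run_numConst,
    ArithOp.eval]
  simp [h8, h20]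
  constructor <;> intro i <;> split_ifs with h
  · rw [h]
  · rfl
  · rw [h]; ring
  · rfl

lemma checkProg_spec (s : Mem) (h21 : s.num 21 = 0) :
    (run checkProg s).idx 18 = 0 ↔
      s.idx 18 = 0 ∧ (s.num 6 ≤ 0 ∨ s.num 6 ^ 2 ≤ s.num 2) := by
  simp only [checkProg, run_seq, run_ifNumLe, run_arith, run_skip, run_idxConst, ArithOp.eval, h21]
  by_cases h1 : s.num 6 ≤ 0
  · simp [h1]
  · by_cases h2 : s.num 6 * s.num 6 ≤ s.num 2
    · simp [h1, h2, pow_two]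
    · simp [h1, h2, pow_two]

lemma regretProg_spec (s : Mem) (h9 : s.idx 9 = 1) (h8 : s.idx 8 = 0) (h20 : s.num 20 = 1)
    (h21 : s.num 21 = 0) :
    (∀ i < s.idx 2,
      (run regretProg s).arr 6 i 0 0 = targetValue s i ∧
      (run regretProg s).arr 5 i 0 0 = s.arr 5 i 0 0 + (roundValue s i - targetValue s i) ∧
      (run regretProg s).arr 4 i 0 0 =
        s.arr 4 i 0 0 * (1 + s.num 0 / 4 * (roundValue s i - targetValue s i))) ∧
    ((run regretProg s).idx 18 = 0 ↔ ∀ i < s.idx 2,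
      (run regretProg s).arr 5 i 0 0 ≤ 0 ∨ (run regretProg s).arr 5 i 0 0 ^ 2 ≤ s.num 2) := by
  have key := forLoop_induct (j := 12) (c := 2) (p := block [payoffProg, updateProg, checkProg])
    (s := run (.idxConst 18 0) s) (fun q s' =>
    ((∀ i < q, s'.arr 6 i 0 0 = targetValue s i ∧
      s'.arr 5 i 0 0 = s.arr 5 i 0 0 + (roundValue s i - targetValue s i) ∧
      s'.arr 4 i 0 0 = s.arr 4 i 0 0 * (1 + s.num 0 / 4 * (roundValue s i - targetValue s i))) ∧
    (s'.idx 18 = 0 ↔ ∀ i < q, s'.arr 5 i 0 0 ≤ 0 ∨ s'.arr 5 i 0 0 ^ 2 ≤ s.num 2)) ∧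
    ∀ i ≥ q, s'.arr 5 i 0 0 = s.arr 5 i 0 0 ∧ s'.arr 4 i 0 0 = s.arr 4 i 0 0)
    rfl rfl (by norm_num) (by norm_num) (by simpa [run_idxConst] using h9)
    (by simp [run_idxConst]) ?_
  · simp only [regretProg, block, run_seq] at key ⊢
    exact key.1
  simp only [block, run_seq]
  rintro q - s2 F hj ⟨⟨i1, i2⟩, i3⟩
  have e0 : s2.idx 0 = s.idx 0 := F.idx 0 rfl
  have e1 : s2.idx 1 = s.idx 1 := F.idx 1 rfl
  have e8 : s2.idx 8 = 0 := (F.idx 8 rfl).trans h8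
  have e9 : s2.idx 9 = 1 := (F.idx 9 rfl).trans h9
  have n0 : s2.num 0 = s.num 0 := F.num 0 rfl
  have n2 : s2.num 2 = s.num 2 := F.num 2 rfl
  have n20 : s2.num 20 = 1 := (F.num 20 rfl).trans h20
  have n21 : s2.num 21 = 0 := (F.num 21 rfl).trans h21
  have a0 : s2.arr 0 = s.arr 0 := F.arr 0 rfl
  have a1 : s2.arr 1 = s.arr 1 := F.arr 1 rfl
  have a2 : s2.arr 2 = s.arr 2 := F.arr 2 rfl
  have a3 : s2.arr 3 = s.arr 3 := F.arr 3 rfl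
  have hT : targetValue s2 q = targetValue s q := by simp only [targetValue, e0, e1, a0, a1]
  have hR : roundValue s2 q = roundValue s q := by simp only [roundValue, e0, e1, a0, a2, a3]
  obtain ⟨p4, p5⟩ := payoffProg_spec s2 e9 e8
  have G := frame_run payoffProg s2
  rw [hj, hT] at p4
  rw [hj, hR] at p5
  set s3 := run payoffProg s2
  have g12 : s3.idx 12 = q := (G.idx 12 rfl).trans hj
  obtain ⟨u6, ua6, ua5, ua4⟩ := updateProg_spec s3 ((G.idx 8 rfl).trans e8)
    ((G.num 20 rfl).trans n20)
  have H := frame_run updateProg s3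
  set s4 := run updateProg s3
  have c := checkProg_spec s4 (((H.num 21 rfl).trans (G.num 21 rfl)).trans n21)
  have K := frame_run checkProg s4
  set s5 := run checkProg s4
  have k18 : s4.idx 18 = s2.idx 18 := (H.idx 18 rfl).trans (G.idx 18 rfl)
  have k2 : s4.num 2 = s.num 2 := ((H.num 2 rfl).trans (G.num 2 rfl)).trans n2
  simp only [setIdx_arr]
  rw [K.arr 6 rfl, K.arr 5 rfl, K.arr 4 rfl]
  simp only [ua6, ua5, ua4, g12, p4, p5, G.arr 6 rfl, G.arr 5 rfl, G.arr 4 rfl, G.num 0 rfl, n0]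
  rw [u6, k18, k2, i2, g12, p4, p5, G.arr 5 rfl, (i3 q le_rfl).1] at c
  refine ⟨⟨fun i hi => ?_, ?_⟩, fun i hi => ?_⟩
  · rcases Nat.lt_succ_iff_lt_or_eq.1 hi with h | rfl
    · simpa [h.ne] using i1 i h
    · simp [i3]
  · rw [show (s5.setIdx 12 (q + 1)).idx 18 = s5.idx 18 by simp, c]
    constructor
    · rintro ⟨h1, h2⟩ i hi
      rcases Nat.lt_succ_iff_lt_or_eq.1 hi with h | rfl
      · simpa [h.ne] using h1 i h
      · simpa [i3] using h2
    · intro h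
      refine ⟨fun i hi => ?_, ?_⟩
      · simpa [hi.ne] using h i (by omega)
      · simpa [i3] using h q (by omega)
  · have : i ≠ q := by omega
    simpa [this] using i3 i (by omega)

lemma thresholdProg_spec (s : Mem) :
    (run thresholdProg s).num 1 = s.num 1 + s.num 20 ∧
    (run thresholdProg s).num 2 = 784 * s.num 3 * (s.num 1 + s.num 20) := by
  simp [thresholdProg, block, run_seq, run_arith, run_numConst, ArithOp.eval]

lemma requestProg_spec (s : Mem) (h8 : s.idx 8 = 0) (h9 : s.idx 9 = 1) (h20 : s.num 20 = 1)
    (h21 : s.num 21 = 0) :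
    (run requestProg s).num 5 =
      min (s.arr 2 0 0 0) (s.arr 2 1 0 0) * s.idx 0 * 4 * s.num 1 * s.num 1 := by
  set s1 := run (.numConst 6 0) (run (.ifNumLe 5 6 .skip (.arith .add 5 6 21))
    (run (.load 6 2 9 8 8) (run (.load 5 2 8 8 8) s))) with hs1
  have e : s1.num 5 = min (s.arr 2 0 0 0) (s.arr 2 1 0 0) := by
    rw [hs1, run_ifNumLe]
    by_cases h : s.arr 2 0 0 0 ≤ s.arr 2 1 0 0
    · simp [run_numConst, run_load, run_skip, h8, h9, h]
    · simp [run_numConst, run_load, run_arith, h8, h9, h, h21, ArithOp.eval, (not_le.1 h).le]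
  have e6 : s1.num 6 = 0 := by simp [hs1, run_numConst]
  have F : Frame (.seq (.load 5 2 8 8 8) (.seq (.load 6 2 9 8 8)
      (.seq (.ifNumLe 5 6 .skip (.arith .add 5 6 21)) (.numConst 6 0)))) s s1 := by
    have := frame_run (.seq (.load 5 2 8 8 8) (.seq (.load 6 2 9 8 8)
      (.seq (.ifNumLe 5 6 .skip (.arith .add 5 6 21)) (.numConst 6 0)))) s
    simpa only [run_seq] using this
  have i0 : s1.idx 0 = s.idx 0 := F.idx 0 rfl
  have n1 : s1.num 1 = s.num 1 := F.num 1 rfl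
  have n20 : s1.num 20 = 1 := (F.num 20 rfl).trans h20
  have key := loop_induct 0 (.arith .add 6 6 20) s1 (fun q s' => s'.num 6 = q)
    (by simpa using e6) (fun q _ s' F h => by
      have : s'.num 20 = 1 := (F.num 20 rfl).trans n20
      simp [run_arith, ArithOp.eval, h, this])
  have G := frame_run (.loop 0 (.arith .add 6 6 20)) s1
  simp only [requestProg, block, run_seq, ← hs1]
  set s2 := run (.loop 0 (.arith .add 6 6 20)) s1
  have g5 : s2.num 5 = _ := (G.num 5 rfl).trans e
  have g1 : s2.num 1 = _ := (G.num 1 rfl).trans n1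
  simp [run_arith, run_numConst, ArithOp.eval, key, g5, g1, i0]

/-- Whatever real number is in register `5`, some pure action is played; if the number is an action
of the learner, then it is this action. -/
lemma pureProg_spec (s : Mem) (h8 : s.idx 8 = 0) (h9 : s.idx 9 = 1) (h20 : s.num 20 = 1)
    (h21 : s.num 21 = 0) (hm : 0 < s.idx 0) :
    ∃ act < s.idx 0, (∀ a < s.idx 0, (run pureProg s).arr 3 a 0 0 = if a = act then 1 else 0) ∧
      ∀ j : ℕ, j < s.idx 0 → s.num 5 = j → act = j := by
  set s1 := run (.numConst 6 0) (run (.idxConst 19 0) s) with hs1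
  have key := forLoop_induct (j := 13) (c := 0) (p := block [
    .store 3 13 8 8 21,
    .ifNumLe 6 5 (.idxAdd 19 13 8) .skip,
    .arith .add 6 6 20]) (s := s1) (fun q s' => s'.num 6 = q ∧ (∀ a < q, s'.arr 3 a 0 0 = 0) ∧
      s'.idx 19 ≤ q - 1 ∧ (∀ j : ℕ, s.num 5 = j → 0 < q → s'.idx 19 = min j (q - 1)))
      rfl rfl (by norm_num) (by norm_num) h9 (by simp [hs1, run_numConst, run_idxConst]) ?_
  · simp only [pureProg, block, run_seq, ← hs1] at key ⊢
    have F := frame_run (forLoop 13 0 (.seq (.store 3 13 8 8 21)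
      (.seq (.ifNumLe 6 5 (.idxAdd 19 13 8) .skip) (.arith .add 6 6 20)))) s1
    set s2 := run (forLoop 13 0 (.seq (.store 3 13 8 8 21)
      (.seq (.ifNumLe 6 5 (.idxAdd 19 13 8) .skip) (.arith .add 6 6 20)))) s1
    have n20 : s2.num 20 = 1 := (F.num 20 rfl).trans h20
    have i8 : s2.idx 8 = 0 := (F.idx 8 rfl).trans h8
    obtain ⟨-, k1, k2, k3⟩ := key
    refine ⟨s2.idx 19, by have : s1.idx 0 = s.idx 0 := rfl; omega, fun a ha => ?_, fun j hj h => ?_⟩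
    · rw [run_store, setArr_arr, n20, i8]
      by_cases h : a = s2.idx 19
      · simp [h]
      · simp [h, k1 a ha]
    · have : s1.idx 0 = s.idx 0 := rfl
      rw [k3 j h hm]
      omega
  · rintro q - s2 F hj ⟨i1, i2, i3, i4⟩
    have e8 : s2.idx 8 = 0 := (F.idx 8 rfl).trans h8
    have n20 : s2.num 20 = 1 := (F.num 20 rfl).trans h20
    have n21 : s2.num 21 = 0 := (F.num 21 rfl).trans h21
    have n5 : s2.num 5 = s.num 5 := F.num 5 rfl
    simp only [block, run_seq, run_ifNumLe, run_store, run_arith, run_skip, run_idxAdd,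
      ArithOp.eval, e8, hj, n21, setArr_num, i1, n5]
    by_cases h : (q : ℝ) ≤ s.num 5
    · rw [if_pos h]
      refine ⟨by simp [n20, i1], fun a ha => ?_, by simp [hj, e8], fun j hj' _ => ?_⟩
      · rcases Nat.lt_succ_iff_lt_or_eq.1 ha with h | rfl
        · simp [i2 a h]
        · simp
      · rw [hj', Nat.cast_le] at h
        simp [hj, h, e8]
    · rw [if_neg h]
      refine ⟨by simp [n20, i1], fun a ha => ?_, ?_, fun j hj' _ => ?_⟩
      · rcases Nat.lt_succ_iff_lt_or_eq.1 ha with h | rfl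
        · simp [i2 a h]
        · simp
      · simp; omega
      · rw [hj', Nat.cast_le] at h
        have := i4 j hj' (by omega)
        simp [this]
        omega

lemma cooperateProg_spec (s : Mem) (h8 : s.idx 8 = 0) (h9 : s.idx 9 = 1) (h20 : s.num 20 = 1)
    (h21 : s.num 21 = 0) (hm : 0 < s.idx 0) :
    (run cooperateProg s).idx 3 = 1 ∧
    ∃ act < s.idx 0,
      (∀ a < s.idx 0, (run cooperateProg s).arr 3 a 0 0 = if a = act then 1 else 0) ∧
      ∀ j : ℕ, j < s.idx 0 →
        min (s.arr 2 0 0 0) (s.arr 2 1 0 0) * s.idx 0 * 4 * s.num 1 * s.num 1 = j → act = j := by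
  have F := frame_run requestProg s
  have h := pureProg_spec (run requestProg s) ((F.idx 8 rfl).trans h8) ((F.idx 9 rfl).trans h9)
    ((F.num 20 rfl).trans h20) ((F.num 21 rfl).trans h21) (by rw [F.idx 0 rfl]; exact hm)
  rw [requestProg_spec s h8 h9 h20 h21, F.idx 0 rfl] at h
  simp only [cooperateProg, block, run_seq, run_idxConst]
  exact ⟨by simp, h⟩

lemma enterProg_spec (s : Mem) (h8 : s.idx 8 = 0) :
    (run enterProg s).idx 4 = 1 ∧ (run enterProg s).num 0 = 1 ∧
    (run enterProg s).idx 6 = s.idx 10 ∧ (run enterProg s).idx 7 = 16 * s.idx 0 := by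
  simp [enterProg, block, run_seq, run_idxConst, run_numConst, run_idxAdd, h8]
  ring

lemma epochProg_spec_pos (s : Mem) (h8 : s.idx 8 = 0) (h5 : 0 < s.idx 5) :
    run epochProg s = s := by
  rw [epochProg, run_ifIdxLe, if_neg (by omega), run_skip]

lemma epochProg_spec_zero (s : Mem) (h8 : s.idx 8 = 0) (h9 : s.idx 9 = 1) (h20 : s.num 20 = 1)
    (h5 : s.idx 5 = 0) :
    (run epochProg s).num 0 = s.num 0 / 2 ∧ (run epochProg s).idx 6 = 4 * s.idx 6 ∧
    (run epochProg s).idx 7 = 4 * s.idx 7 ∧ (run epochProg s).idx 5 = 4 * s.idx 6 ∧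
    ∀ i < s.idx 2, (run epochProg s).arr 4 i 0 0 = 1 := by
  rw [epochProg, run_ifIdxLe, if_pos (by omega)]
  set s1 := run (block [.numConst 4 (1 / 2), .arith .mul 0 0 4,
    .idxAdd 6 6 6, .idxAdd 6 6 6, .idxAdd 7 7 7, .idxAdd 7 7 7, .idxAdd 5 6 8]) s with hs1
  have F := frame_run (forLoop 12 2 (.store 4 12 8 8 20)) s1
  have key := forLoop_induct (j := 12) (c := 2) (p := .store 4 12 8 8 20) (s := s1)
    (fun q s' => ∀ i < q, s'.arr 4 i 0 0 = 1) rfl rfl (by norm_num) (by norm_num)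
    (by simp [hs1, block, run_seq, run_idxAdd, run_arith, run_numConst, h9])
    (by simp) ?_
  · simp only [block, run_seq] at hs1 ⊢
    rw [← hs1, F.num 0 rfl, F.idx 5 rfl, F.idx 6 rfl, F.idx 7 rfl]
    refine ⟨?_, ?_, ?_, ?_, key⟩ <;>
      simp [hs1, run_idxAdd, run_arith, run_numConst, ArithOp.eval, h8] <;> ring
  · rintro q - s2 F hj i1 i hi
    have e8 : s2.idx 8 = 0 := (F.idx 8 rfl).trans
      (by simp [hs1, block, run_seq, run_idxAdd, run_arith, run_numConst, h8])
    have n20 : s2.num 20 = 1 := (F.num 20 rfl).trans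
      (by simp [hs1, block, run_seq, run_idxAdd, run_arith, run_numConst, h20])
    rcases Nat.lt_succ_iff_lt_or_eq.1 hi with h | rfl
    · simp [run_store, e8, hj, n20, i1 i h]
    · simp [run_store, e8, hj, n20]

/-! ### The search for a response -/

/-- The game of the search for a response: the average of `u_i(a, b) - u_i(φ_i)` with respect to
the current weights. -/
def gameValue (s : Mem) (a b : ℕ) : ℝ :=
  (∑ i ∈ Finset.range (s.idx 2), s.arr 4 i 0 0 * (s.arr 0 i a b - s.arr 6 i 0 0)) /
    ∑ i ∈ Finset.range (s.idx 2), s.arr 4 i 0 0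

lemma gameProg_spec (s : Mem) (h8 : s.idx 8 = 0) (h9 : s.idx 9 = 1) (h20 : s.num 20 = 1) :
    ∀ a < s.idx 0, (run gameProg s).arr 8 a 0 0 = 1 ∧
      ∀ b < s.idx 1, (run gameProg s).arr 7 a b 0 = gameValue s a b := by
  have key0 := forLoop_induct (j := 12) (c := 2) (p := block [.load 5 4 12 8 8, .arith .add 4 4 5])
    (s := run (.numConst 4 0) s)
    (fun q s' => s'.num 4 = ∑ i ∈ Finset.range q, s.arr 4 i 0 0) rfl rfl (by norm_num)
    (by norm_num) h9 (by simp [run_numConst]) (by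
      rintro q - s' F hj i1
      have e8 : s'.idx 8 = 0 := (F.idx 8 rfl).trans h8
      have a4 : s'.arr 4 = s.arr 4 := F.arr 4 rfl
      simp [block, run_seq, run_load, run_arith, ArithOp.eval, i1, Finset.sum_range_succ, e8, a4,
        hj])
  set p0 := forLoop 12 2 (block [.load 5 4 12 8 8, .arith .add 4 4 5]) with hp0
  have F0 : Frame (.seq (.numConst 4 0) p0) s (run p0 (run (.numConst 4 0) s)) := by
    have := frame_run (.seq (.numConst 4 0) p0) s
    rwa [run_seq] at this
  simp only [gameProg, block, run_seq] at hp0 ⊢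
  rw [← hp0]
  set s1 := run p0 (run (.numConst 4 0) s)
  have i2 : s1.idx 2 = s.idx 2 := F0.idx 2 rfl
  have i1 : s1.idx 1 = s.idx 1 := F0.idx 1 rfl
  have i0 : s1.idx 0 = s.idx 0 := F0.idx 0 rfl
  have i8 : s1.idx 8 = 0 := (F0.idx 8 rfl).trans h8
  have i9 : s1.idx 9 = 1 := (F0.idx 9 rfl).trans h9
  have n20 : s1.num 20 = 1 := (F0.num 20 rfl).trans h20
  have a0 : s1.arr 0 = s.arr 0 := F0.arr 0 rfl
  have a4 : s1.arr 4 = s.arr 4 := F0.arr 4 rfl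
  have a6 : s1.arr 6 = s.arr 6 := F0.arr 6 rfl
  rw [← i0, ← i1]
  refine forLoop_induct (fun q s' => ∀ a < q, s'.arr 8 a 0 0 = 1 ∧
    ∀ b < s1.idx 1, s'.arr 7 a b 0 = gameValue s a b) rfl rfl (by norm_num) (by norm_num) i9
    (by simp) ?_
  rintro q - s2 F hj ih a ha
  simp only [setIdx_arr, run_seq]
  set s3 := run (.store 8 13 8 8 20) s2 with hs3
  have F3 := F.trans ((frame_run (.store 8 13 8 8 20) s2).mono (q := forLoop 13 0 _)
    (by simp [writesIdx]) (by simp [writesNum]) (by simp_all [writesArr, forLoop]))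
  rw [← hs3] at F3
  have j13 : s3.idx 13 = q := by rw [hs3]; exact hj
  have j9 : s3.idx 9 = 1 := (F3.idx 9 rfl).trans i9
  have j2 : s3.idx 2 = s.idx 2 := (F3.idx 2 rfl).trans i2
  have j1 : s3.idx 1 = s1.idx 1 := F3.idx 1 rfl
  have j8 : s3.idx 8 = 0 := (F3.idx 8 rfl).trans i8
  have m4 : s3.num 4 = _ := (F3.num 4 rfl).trans key0
  have b0 := (F3.arr 0 rfl).trans a0
  have b4 := (F3.arr 4 rfl).trans a4
  have b6 := (F3.arr 6 rfl).trans a6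
  have c8 : s3.arr 8 a 0 0 = 1 := by
    have : s2.idx 8 = 0 := (F.idx 8 rfl).trans i8
    rw [hs3, run_store, setArr_arr, hj, this, (F.num 20 rfl).trans n20]
    rcases Nat.lt_succ_iff_lt_or_eq.1 ha with h | rfl
    · simp [ih a h]
    · simp
  have c7 : s3.arr 7 = s2.arr 7 := (frame_run (.store 8 13 8 8 20) s2).arr 7 rfl
  rw [(frame_run _ s3).arr 8 rfl]
  refine ⟨c8, ?_⟩
  have key := forLoop_induct (j := 14) (c := 1) (s := s3) (p := block [
      .numConst 5 0,
      forLoop 12 2 (block [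
        .load 6 0 12 13 14, .load 7 6 12 8 8, .arith .sub 6 6 7, .load 7 4 12 8 8,
        .arith .mul 7 7 6, .arith .add 5 5 7]),
      .arith .div 5 5 4, .store 7 13 14 8 5])
    (fun r s' => (∀ a < q, ∀ b < s1.idx 1, s'.arr 7 a b 0 = gameValue s a b) ∧
      ∀ b < r, s'.arr 7 q b 0 = gameValue s q b) rfl rfl (by norm_num) (by norm_num) j9
      ⟨fun a ha => by rw [setIdx_arr, c7]; exact (ih a ha).2, by simp⟩ ?_
  · rw [j1] at key
    simp only [block] at key
    intro b hb
    rcases Nat.lt_succ_iff_lt_or_eq.1 ha with h | rfl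
    · exact key.1 a h b hb
    · exact key.2 b hb
  · rintro r - s4 G hr ⟨g1, g2⟩
    have k9 : s4.idx 9 = 1 := (G.idx 9 rfl).trans j9
    have k8 : s4.idx 8 = 0 := (G.idx 8 rfl).trans j8
    have k13 : s4.idx 13 = q := (G.idx 13 rfl).trans j13
    have k2 : s4.idx 2 = s.idx 2 := (G.idx 2 rfl).trans j2
    have l0 := (G.arr 0 rfl).trans b0
    have l4 := (G.arr 4 rfl).trans b4
    have l6 := (G.arr 6 rfl).trans b6
    have key := forLoop_induct (j := 12) (c := 2) (s := run (.numConst 5 0) s4) (p := block [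
        .load 6 0 12 13 14, .load 7 6 12 8 8, .arith .sub 6 6 7, .load 7 4 12 8 8,
        .arith .mul 7 7 6, .arith .add 5 5 7]) (fun x s' => s'.num 5 = ∑ i ∈ Finset.range x,
          s.arr 4 i 0 0 * (s.arr 0 i q r - s.arr 6 i 0 0)) rfl rfl (by norm_num) (by norm_num) k9
          (by simp [run_numConst]) (by
      rintro x - s5 H hx hs5
      have e8 : s5.idx 8 = 0 := (H.idx 8 rfl).trans k8
      have e13 : s5.idx 13 = q := (H.idx 13 rfl).trans k13
      have e14 : s5.idx 14 = r := (H.idx 14 rfl).trans hr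
      have o0 := (H.arr 0 rfl).trans l0
      have o4 := (H.arr 4 rfl).trans l4
      have o6 := (H.arr 6 rfl).trans l6
      simp [block, run_seq, run_load, run_arith, ArithOp.eval, hs5, Finset.sum_range_succ, e8, e13,
        e14, o0, o4, o6, hx])
    simp only [block, run_seq] at key ⊢
    set p5 := forLoop 12 2 ((Prog.load 6 0 12 13 14).seq ((Prog.load 7 6 12 8 8).seq
      ((Prog.arith .sub 6 6 7).seq ((Prog.load 7 4 12 8 8).seq
        ((Prog.arith .mul 7 7 6).seq (.arith .add 5 5 7)))))) with hp5
    have H := frame_run p5 (run (.numConst 5 0) s4)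
    set s6 := run p5 (run (.numConst 5 0) s4)
    have q2 : (run (.numConst 5 0) s4).idx 2 = s.idx 2 := k2
    rw [q2] at key
    have q8 : s6.idx 8 = 0 := (H.idx 8 rfl).trans k8
    have q13 : s6.idx 13 = q := (H.idx 13 rfl).trans k13
    have q14 : s6.idx 14 = r := (H.idx 14 rfl).trans hr
    have q4 : s6.num 4 = _ := ((H.num 4 rfl).trans (G.num 4 rfl)).trans m4
    have q7 : s6.arr 7 = s4.arr 7 := H.arr 7 rfl
    have : (run (.numConst 4 0) s).idx 2 = s.idx 2 := rfl
    simp only [run_store, run_arith, ArithOp.eval, setIdx_arr, setArr_arr, setNum_idx, setNum_num,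
      setNum_arr, q8, q13, q14, key, q4, q7, this]
    refine ⟨fun a ha b hb => ?_, fun b hb => ?_⟩
    · simp [ha.ne, g1 a ha b hb]
    · rcases Nat.lt_succ_iff_lt_or_eq.1 hb with h | rfl
      · simp [h.ne, g2 b h]
      · simp [gameValue]

/-- The exponential lower bound behind the multiplicative updates. -/
lemma exp_sub_sq_le_one_add {x : ℝ} (hx : |x| ≤ 1 / 2) : Real.exp (x - x ^ 2) ≤ 1 + x := by
  obtain ⟨h1, h2⟩ := abs_le.1 hx
  rcases le_total 0 x with h | h
  · have h3 : |x - x ^ 2| ≤ 1 := abs_le.2 ⟨by nlinarith, by nlinarith⟩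
    have h4 := (abs_le.1 (Real.abs_exp_sub_one_sub_id_le h3)).2
    nlinarith [mul_nonneg h (mul_nonneg h h), mul_nonneg h (sq_nonneg x)]
  · have hz : 0 ≤ -x + x ^ 2 := by nlinarith
    have h3 := Real.quadratic_le_exp_of_nonneg hz
    have h4 : Real.exp (x - x ^ 2) * Real.exp (-x + x ^ 2) = 1 := by
      rw [← Real.exp_add]; simp
    have h5 : 1 ≤ (1 + x) * (1 + (-x + x ^ 2) + (-x + x ^ 2) ^ 2 / 2) := by
      have : (1 + x) * (1 + (-x + x ^ 2) + (-x + x ^ 2) ^ 2 / 2) - 1 =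
        x ^ 2 / 2 * (1 + x - x ^ 2 + x ^ 3) := by ring
      have h6 : 0 ≤ 1 + x - x ^ 2 + x ^ 3 := by nlinarith [sq_nonneg x]
      nlinarith [mul_nonneg (sq_nonneg x) h6]
    have h6 : 1 ≤ (1 + x) * Real.exp (-x + x ^ 2) :=
      h5.trans (mul_le_mul_of_nonneg_left h3 (by linarith))
    have h7 := Real.exp_pos (x - x ^ 2)
    calc Real.exp (x - x ^ 2) ≤ Real.exp (x - x ^ 2) * ((1 + x) * Real.exp (-x + x ^ 2)) :=
          le_mul_of_one_le_right h7.le h6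
      _ = (1 + x) * (Real.exp (x - x ^ 2) * Real.exp (-x + x ^ 2)) := by ring
      _ = 1 + x := by rw [h4, mul_one]

lemma normalizeProg_spec (s : Mem) (h8 : s.idx 8 = 0) (h9 : s.idx 9 = 1) :
    ∀ a < s.idx 0, (run normalizeProg s).arr 3 a 0 0 =
      s.arr 8 a 0 0 / ∑ c ∈ Finset.range (s.idx 0), s.arr 8 c 0 0 := by
  have key0 := forLoop_induct (j := 13) (c := 0) (p := block [.load 5 8 13 8 8, .arith .add 4 4 5])
    (s := run (.numConst 4 0) s)
    (fun q s' => s'.num 4 = ∑ i ∈ Finset.range q, s.arr 8 i 0 0) rfl rfl (by norm_num)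
    (by norm_num) h9 (by simp [run_numConst]) (by
      rintro q - s' F hj i1
      have e8 : s'.idx 8 = 0 := (F.idx 8 rfl).trans h8
      have a8 : s'.arr 8 = s.arr 8 := F.arr 8 rfl
      simp [block, run_seq, run_load, run_arith, ArithOp.eval, i1, Finset.sum_range_succ, e8, a8,
        hj])
  have q0 : (run (.numConst 4 0) s).idx 0 = s.idx 0 := rfl
  rw [q0] at key0
  set p0 := forLoop 13 0 (block [.load 5 8 13 8 8, .arith .add 4 4 5]) with hp0
  have F0 : Frame (.seq (.numConst 4 0) p0) s (run p0 (run (.numConst 4 0) s)) := by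
    have := frame_run (.seq (.numConst 4 0) p0) s
    rwa [run_seq] at this
  simp only [normalizeProg, block, run_seq] at hp0 ⊢
  rw [← hp0]
  set s1 := run p0 (run (.numConst 4 0) s)
  have i0 : s1.idx 0 = s.idx 0 := F0.idx 0 rfl
  rw [← i0] at key0 ⊢
  refine forLoop_induct (fun q s' => ∀ a < q, s'.arr 3 a 0 0 =
    s.arr 8 a 0 0 / ∑ c ∈ Finset.range (s1.idx 0), s.arr 8 c 0 0) rfl rfl (by norm_num)
    (by norm_num) ((F0.idx 9 rfl).trans h9) (by simp) ?_
  rintro q - s2 F hj ih a ha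
  have e8 : s2.idx 8 = 0 := ((F.idx 8 rfl).trans (F0.idx 8 rfl)).trans h8
  have a8 : s2.arr 8 = s.arr 8 := (F.arr 8 rfl).trans (F0.arr 8 rfl)
  have n4 : s2.num 4 = _ := (F.num 4 rfl).trans key0
  rcases Nat.lt_succ_iff_lt_or_eq.1 ha with h | rfl
  · simp [run_seq, run_load, run_arith, run_store, ArithOp.eval, e8, hj, h.ne, ih a h]
  · simp [run_seq, run_load, run_arith, run_store, ArithOp.eval, e8, hj, a8, n4]

lemma violationProg_spec (s : Mem) (h8 : s.idx 8 = 0) (h9 : s.idx 9 = 1) :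
    ((run violationProg s).idx 16 = 0 ∧ ∀ b < s.idx 1,
      ∑ a ∈ Finset.range (s.idx 0), s.arr 3 a 0 0 * s.arr 7 a b 0 ≤ s.num 0) ∨
    ((run violationProg s).idx 16 = 1 ∧ (run violationProg s).idx 17 < s.idx 1 ∧
      s.num 0 < ∑ a ∈ Finset.range (s.idx 0),
        s.arr 3 a 0 0 * s.arr 7 a ((run violationProg s).idx 17) 0) := by
  simp only [violationProg, block, run_seq]
  set s1 := run (.idxConst 16 0) s with hs1
  have i1 : s1.idx 1 = s.idx 1 := rfl
  rw [← i1]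
  have key := forLoop_induct (j := 14) (c := 1) (s := s1) (p := block [
    .numConst 5 0,
    forLoop 13 0 (block [
      .load 6 3 13 8 8, .load 7 7 13 14 8, .arith .mul 6 6 7, .arith .add 5 5 6]),
    .ifNumLe 5 0 .skip (block [.idxConst 16 1, .idxAdd 17 14 8])])
    (fun q s' => (s'.idx 16 = 0 ∧ ∀ b < q,
      ∑ a ∈ Finset.range (s.idx 0), s.arr 3 a 0 0 * s.arr 7 a b 0 ≤ s.num 0) ∨
      (s'.idx 16 = 1 ∧ s'.idx 17 < q ∧
      s.num 0 < ∑ a ∈ Finset.range (s.idx 0), s.arr 3 a 0 0 * s.arr 7 a (s'.idx 17) 0))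
    rfl rfl (by norm_num) (by norm_num) h9 (by left; simp [hs1, run_idxConst]) ?_
  · simpa only [block, run_seq] using key
  · rintro q - s2 F hj ih
    have e8 : s2.idx 8 = 0 := (F.idx 8 rfl).trans h8
    have e9 : s2.idx 9 = 1 := (F.idx 9 rfl).trans h9
    have e0 : s2.idx 0 = s.idx 0 := F.idx 0 rfl
    have a3 : s2.arr 3 = s.arr 3 := F.arr 3 rfl
    have a7 : s2.arr 7 = s.arr 7 := F.arr 7 rfl
    have n0 : s2.num 0 = s.num 0 := F.num 0 rfl
    have key := forLoop_induct (j := 13) (c := 0) (s := run (.numConst 5 0) s2) (p := block [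
      .load 6 3 13 8 8, .load 7 7 13 14 8, .arith .mul 6 6 7, .arith .add 5 5 6])
      (fun x s' => s'.num 5 = ∑ a ∈ Finset.range x, s.arr 3 a 0 0 * s.arr 7 a q 0) rfl rfl
      (by norm_num) (by norm_num) e9 (by simp [run_numConst]) (by
        rintro x - s' G hx ih'
        have f8 : s'.idx 8 = 0 := (G.idx 8 rfl).trans e8
        have f14 : s'.idx 14 = q := (G.idx 14 rfl).trans hj
        have b3 : s'.arr 3 = s.arr 3 := (G.arr 3 rfl).trans a3
        have b7 : s'.arr 7 = s.arr 7 := (G.arr 7 rfl).trans a7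
        simp [block, run_seq, run_load, run_arith, ArithOp.eval, ih', Finset.sum_range_succ, f8,
          f14, b3, b7, hx])
    have q0 : (run (.numConst 5 0) s2).idx 0 = s.idx 0 := e0
    rw [q0] at key
    simp only [block, run_seq] at key ⊢
    set p5 := forLoop 13 0 ((Prog.load 6 3 13 8 8).seq ((Prog.load 7 7 13 14 8).seq
      ((Prog.arith .mul 6 6 7).seq (.arith .add 5 5 6))))
    have G := frame_run p5 (run (.numConst 5 0) s2)
    set s3 := run p5 (run (.numConst 5 0) s2)
    have g16 : s3.idx 16 = s2.idx 16 := G.idx 16 rfl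
    have g17 : s3.idx 17 = s2.idx 17 := G.idx 17 rfl
    have g14 : s3.idx 14 = q := (G.idx 14 rfl).trans hj
    have g8 : s3.idx 8 = 0 := (G.idx 8 rfl).trans e8
    have g0 : s3.num 0 = s.num 0 := (G.num 0 rfl).trans n0
    rw [run_ifNumLe, key, g0, run_skip, run_seq, run_idxConst, run_idxAdd]
    split_ifs with h
    · rcases ih with ⟨h1, h2⟩ | ⟨h1, h2, h3⟩
      · left
        refine ⟨by simp [g16, h1], fun b hb => ?_⟩
        rcases Nat.lt_succ_iff_lt_or_eq.1 hb with h' | rfl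
        · exact h2 b h'
        · exact h
      · right
        refine ⟨by simp [g16, h1], ?_, ?_⟩
        · simp [g17]; omega
        · simpa [g17] using h3
    · right
      refine ⟨by simp, by simp [g14, g8], by simpa [g14, g8] using h⟩

lemma punishProg_spec (s : Mem) (h8 : s.idx 8 = 0) (h9 : s.idx 9 = 1) (h20 : s.num 20 = 1) :
    ∀ a < s.idx 0, (run punishProg s).arr 8 a 0 0 =
      s.arr 8 a 0 0 * (1 - s.num 0 / 8 * s.arr 7 a (s.idx 17) 0) := by
  simp only [punishProg, block, run_seq]
  set s1 := run (.arith .mul 4 4 0) (run (.numConst 4 (1 / 8)) s) with hs1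
  have n4 : s1.num 4 = s.num 0 / 8 := by
    simp [hs1, run_arith, run_numConst, ArithOp.eval]; ring
  have i0 : s1.idx 0 = s.idx 0 := rfl
  rw [← i0]
  have key := forLoop_induct (j := 13) (c := 0) (p := block [
    .load 5 8 13 8 8, .load 6 7 13 17 8, .arith .mul 6 6 4, .arith .sub 6 20 6,
    .arith .mul 5 5 6, .store 8 13 8 8 5]) (s := s1) (fun q s' =>
    (∀ a < q, s'.arr 8 a 0 0 = s.arr 8 a 0 0 * (1 - s.num 0 / 8 * s.arr 7 a (s.idx 17) 0)) ∧
    ∀ a ≥ q, s'.arr 8 a 0 0 = s.arr 8 a 0 0) rfl rfl (by norm_num)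
    (by norm_num) h9 ⟨by simp, fun a _ => rfl⟩ ?_
  · exact key.1
  simp only [block, run_seq]
  rintro q - s2 F hj ⟨i1, i2⟩
  have e8 : s2.idx 8 = 0 := (F.idx 8 rfl).trans h8
  have e17 : s2.idx 17 = s.idx 17 := F.idx 17 rfl
  have m4 : s2.num 4 = _ := (F.num 4 rfl).trans n4
  have m20 : s2.num 20 = 1 := (F.num 20 rfl).trans h20
  have a7 : s2.arr 7 = s.arr 7 := F.arr 7 rfl
  refine ⟨fun a ha => ?_, fun a ha => ?_⟩
  · rcases Nat.lt_succ_iff_lt_or_eq.1 ha with h | rfl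
    · simp [run_load, run_arith, run_store, ArithOp.eval, e8, hj, h.ne, i1 a h]
    · simp [run_load, run_arith, run_store, ArithOp.eval, e8, hj, i2, e17, m4, m20, a7]
      left; ring
  · have : a ≠ q := by omega
    simp [run_load, run_arith, run_store, ArithOp.eval, e8, hj, this, i2 a (by omega)]

/-- The state of the search for a response in the game `g` with accuracy `E` after `q`
multiplicative updates of the weights `v` of the learner's actions, with step size `E / 8` and
against actions of the optimizer each of which gets more than `E` from the current response; `Y`
counts these actions. The weight of `a` is bounded below in terms of the value of `Y` against `a`,
and every update multiplies the total weight by at most `exp (-E ^ 2 / 8)`. -/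
structure IsCertificate (m n : ℕ) (g : ℕ → ℕ → ℝ) (E : ℝ) (q : ℕ) (v Y : ℕ → ℝ) : Prop where
  nonneg : ∀ b, 0 ≤ Y b
  sum_eq : ∑ b ∈ Finset.range n, Y b = q
  pos : ∀ a < m, 0 < v a
  le : ∀ a < m,
    Real.exp (-(E / 8) * ∑ b ∈ Finset.range n, Y b * g a b - E ^ 2 / 16 * q) ≤ v a
  sum_le : ∑ a ∈ Finset.range m, v a ≤ m * Real.exp (-(E ^ 2 / 8) * q)

lemma isCertificate_zero (m n : ℕ) (g : ℕ → ℕ → ℝ) (E : ℝ) (v : ℕ → ℝ) (hv : ∀ a < m, v a = 1) :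
    IsCertificate m n g E 0 v 0 where
  nonneg _ := le_rfl
  sum_eq := by simp
  pos a ha := by simp [hv a ha]
  le a ha := by simp [hv a ha]
  sum_le := by
    rw [Finset.sum_congr rfl fun a ha => hv a (Finset.mem_range.1 ha)]
    simp

lemma IsCertificate.succ {m n : ℕ} {g : ℕ → ℕ → ℝ} {E : ℝ} {q : ℕ} {v v' Y : ℕ → ℝ}
    (h : IsCertificate m n g E q v Y) (hE0 : 0 ≤ E) (hE1 : E ≤ 1)
    (hg : ∀ a < m, ∀ b < n, |g a b| ≤ 2) {b : ℕ} (hb : b < n)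
    (hv : E * ∑ a ∈ Finset.range m, v a ≤ ∑ a ∈ Finset.range m, v a * g a b)
    (hv' : ∀ a < m, v' a = v a * (1 - E / 8 * g a b)) :
    IsCertificate m n g E (q + 1) v' (fun c => Y c + if c = b then 1 else 0) := by
  have hx : ∀ a < m, |-(E / 8 * g a b)| ≤ E / 4 := by
    intro a ha
    rw [abs_neg, abs_mul, abs_of_nonneg (by positivity)]
    nlinarith [hg a ha b hb]
  refine ⟨fun c => ?_, ?_, fun a ha => ?_, fun a ha => ?_, ?_⟩
  · have := h.nonneg c
    split_ifs <;> linarith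
  · rw [Finset.sum_add_distrib, h.sum_eq]
    simp [hb]
  · rw [hv' a ha]
    have := (abs_le.1 (hx a ha)).1
    exact mul_pos (h.pos a ha) (by linarith)
  · rw [hv' a ha]
    have h1 := hx a ha
    have h2 := exp_sub_sq_le_one_add (h1.trans (by linarith))
    have h3 : (-(E / 8 * g a b)) ^ 2 ≤ E ^ 2 / 16 := by
      rw [← sq_abs]
      have := pow_le_pow_left₀ (abs_nonneg _) h1 2
      linarith
    have h4 : ∑ c ∈ Finset.range n, (Y c + if c = b then 1 else 0) * g a c =
        ∑ c ∈ Finset.range n, Y c * g a c + g a b := by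
      simp [add_mul, Finset.sum_add_distrib, hb]
    rw [h4]
    calc _ ≤ Real.exp ((-(E / 8) * ∑ b ∈ Finset.range n, Y b * g a b - E ^ 2 / 16 * q) +
          (-(E / 8 * g a b) - (-(E / 8 * g a b)) ^ 2)) := by
          apply Real.exp_le_exp.2
          push_cast
          linarith
      _ ≤ _ := by
          rw [Real.exp_add]
          have := mul_le_mul (h.le a ha) h2 (Real.exp_pos _).le (h.pos a ha).le
          rwa [← sub_eq_add_neg] at this
  · have h1 : ∑ a ∈ Finset.range m, v' a = ∑ a ∈ Finset.range m, v a -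
        E / 8 * ∑ a ∈ Finset.range m, v a * g a b := by
      rw [Finset.mul_sum, ← Finset.sum_sub_distrib]
      refine Finset.sum_congr rfl fun a ha => ?_
      rw [hv' a (Finset.mem_range.1 ha)]
      ring
    have h0 : 0 ≤ ∑ a ∈ Finset.range m, v a :=
      Finset.sum_nonneg fun a ha => (h.pos a (Finset.mem_range.1 ha)).le
    have h2 : ∑ a ∈ Finset.range m, v' a ≤ (∑ a ∈ Finset.range m, v a) * (1 - E ^ 2 / 8) := by
      rw [h1]
      nlinarith [mul_le_mul_of_nonneg_left hv (show 0 ≤ E / 8 by positivity)]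
    have h3 : 1 - E ^ 2 / 8 ≤ Real.exp (-(E ^ 2 / 8)) := by
      have := Real.add_one_le_exp (-(E ^ 2 / 8))
      linarith
    calc _ ≤ _ := h2
      _ ≤ (∑ a ∈ Finset.range m, v a) * Real.exp (-(E ^ 2 / 8)) :=
          mul_le_mul_of_nonneg_left h3 h0
      _ ≤ (m * Real.exp (-(E ^ 2 / 8) * q)) * Real.exp (-(E ^ 2 / 8)) :=
          mul_le_mul_of_nonneg_right h.sum_le (Real.exp_pos _).le
      _ = _ := by
          rw [mul_assoc, ← Real.exp_add]
          push_cast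
          ring_nf

/-- After sufficiently many updates, the counted actions form a strategy of the optimizer with
positive value against every action of the learner: otherwise the weight of some action would be at
least `exp (-q E ^ 2 / 16)`, more than the bound `m exp (-q E ^ 2 / 8)` on the total weight. -/
lemma IsCertificate.value_pos {m n : ℕ} {g : ℕ → ℕ → ℝ} {E : ℝ} {q : ℕ} {v Y : ℕ → ℝ}
    (h : IsCertificate m n g E q v Y) (hE0 : 0 < E) (hq : 16 * (m : ℝ) ≤ q * E ^ 2) :
    ∀ a < m, 0 < ∑ b ∈ Finset.range n, Y b * g a b := by
  intro a ha
  have hm : (0 : ℝ) < m := by exact_mod_cast (show 0 < m by omega)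
  have h1 : v a ≤ ∑ c ∈ Finset.range m, v c :=
    Finset.single_le_sum (f := v) (fun c hc => (h.pos c (Finset.mem_range.1 hc)).le)
      (Finset.mem_range.2 ha)
  have h2 : Real.exp (-(E / 8) * ∑ b ∈ Finset.range n, Y b * g a b - E ^ 2 / 16 * q) ≤
      Real.exp (Real.log m + -(E ^ 2 / 8) * q) := by
    rw [Real.exp_add, Real.exp_log hm]
    exact ((h.le a ha).trans h1).trans h.sum_le
  have h3 := Real.exp_le_exp.1 h2
  have h4 := Real.log_le_sub_one_of_pos hm
  by_contra hcon
  push Not at hcon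
  nlinarith [mul_nonpos_of_nonneg_of_nonpos (show 0 ≤ E / 8 by positivity) hcon]

/-- The search for a response either finds a strategy with value at most the accuracy against every
action of the optimizer, or a strategy of the optimizer that has positive value against every action
of the learner. No linear program has to be solved, because a response need not be exact. -/
lemma solveProg_spec (s : Mem) (h8 : s.idx 8 = 0) (h9 : s.idx 9 = 1) (h20 : s.num 20 = 1)
    (hm : 0 < s.idx 0) (hE0 : 0 < s.num 0) (hE1 : s.num 0 ≤ 1)
    (hg : ∀ a < s.idx 0, ∀ b < s.idx 1, |gameValue s a b| ≤ 2)
    (hN : 16 * (s.idx 0 : ℝ) ≤ s.idx 7 * s.num 0 ^ 2) :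
    ((∀ a < s.idx 0, 0 ≤ (run solveProg s).arr 3 a 0 0) ∧
      ∑ a ∈ Finset.range (s.idx 0), (run solveProg s).arr 3 a 0 0 = 1) ∧
    (((run solveProg s).idx 3 = 1 ∧ ∀ b < s.idx 1,
      ∑ a ∈ Finset.range (s.idx 0), (run solveProg s).arr 3 a 0 0 * gameValue s a b ≤ s.num 0) ∨
    ((run solveProg s).idx 3 = 0 ∧ ∃ Y : ℕ → ℝ, (∀ b, 0 ≤ Y b) ∧
      0 < ∑ b ∈ Finset.range (s.idx 1), Y b ∧
      ∀ a < s.idx 0, 0 < ∑ b ∈ Finset.range (s.idx 1), Y b * gameValue s a b)) := by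
  have hm' : (0 : ℝ) < s.idx 0 := by exact_mod_cast hm
  have hN0 : 0 < s.idx 7 := by
    rcases Nat.eq_zero_or_pos (s.idx 7) with h | h
    · rw [h, Nat.cast_zero, zero_mul] at hN; linarith
    · exact h
  have hgame := gameProg_spec s h8 h9 h20
  have F0 := frame_run (.seq gameProg (.idxConst 3 0)) s
  rw [run_seq] at F0
  simp only [solveProg, block, run_seq]
  have h3 : (run (.idxConst 3 0) (run gameProg s)).idx 3 = 0 := by simp [run_idxConst]
  have harr : (run (.idxConst 3 0) (run gameProg s)).arr = (run gameProg s).arr := rfl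
  rw [← harr] at hgame
  set s1 := run (.idxConst 3 0) (run gameProg s)
  have i7 : s1.idx 7 = s.idx 7 := F0.idx 7 rfl
  have key := loop_induct 7 (.ifIdxLe 3 8 attemptProg .skip) s1 (fun q s' =>
    (∀ a < s.idx 0, ∀ b < s.idx 1, s'.arr 7 a b 0 = gameValue s a b) ∧
    (0 < q → (∀ a < s.idx 0, 0 ≤ s'.arr 3 a 0 0) ∧
      ∑ a ∈ Finset.range (s.idx 0), s'.arr 3 a 0 0 = 1) ∧
    ((s'.idx 3 = 1 ∧ 0 < q ∧ ∀ b < s.idx 1,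
      ∑ a ∈ Finset.range (s.idx 0), s'.arr 3 a 0 0 * gameValue s a b ≤ s.num 0) ∨
    (s'.idx 3 = 0 ∧ ∃ Y, IsCertificate (s.idx 0) (s.idx 1) (gameValue s) (s.num 0) q
      (fun a => s'.arr 8 a 0 0) Y)))
    ⟨fun a ha => (hgame a ha).2, by simp, Or.inr ⟨h3, 0, isCertificate_zero _ _ _ _ _
      fun a ha => (hgame a ha).1⟩⟩ ?_
  · rw [i7] at key
    obtain ⟨-, k1, k2⟩ := key
    refine ⟨k1 hN0, ?_⟩
    rcases k2 with ⟨k2, -, k3⟩ | ⟨k2, Y, k3⟩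
    · exact Or.inl ⟨k2, k3⟩
    · refine Or.inr ⟨k2, Y, k3.nonneg, ?_, k3.value_pos hE0 hN⟩
      rw [k3.sum_eq]
      exact_mod_cast hN0
  · rintro q - s2 F ⟨j1, j2, j3⟩
    have e0 : s2.idx 0 = s.idx 0 := (F.idx 0 rfl).trans (F0.idx 0 rfl)
    have e1 : s2.idx 1 = s.idx 1 := (F.idx 1 rfl).trans (F0.idx 1 rfl)
    have e8 : s2.idx 8 = 0 := ((F.idx 8 rfl).trans (F0.idx 8 rfl)).trans h8
    have e9 : s2.idx 9 = 1 := ((F.idx 9 rfl).trans (F0.idx 9 rfl)).trans h9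
    have n0 : s2.num 0 = s.num 0 := (F.num 0 rfl).trans (F0.num 0 rfl)
    have n20 : s2.num 20 = 1 := ((F.num 20 rfl).trans (F0.num 20 rfl)).trans h20
    rw [run_ifIdxLe, e8]
    rcases j3 with ⟨j3, j4, j5⟩ | ⟨j3, Y, j4⟩
    · rw [if_neg (by omega), run_skip]
      exact ⟨j1, fun _ => j2 j4, Or.inl ⟨j3, by omega, j5⟩⟩
    · rw [if_pos (by omega)]
      simp only [attemptProg, block, run_seq]
      have hx := normalizeProg_spec s2 e8 e9
      have G := frame_run normalizeProg s2
      set s3 := run normalizeProg s2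
      have hviol := violationProg_spec s3 ((G.idx 8 rfl).trans e8) ((G.idx 9 rfl).trans e9)
      have H := frame_run violationProg s3
      set s4 := run violationProg s3
      have f0 : s3.idx 0 = s.idx 0 := (G.idx 0 rfl).trans e0
      have f1 : s3.idx 1 = s.idx 1 := (G.idx 1 rfl).trans e1
      have fn0 : s3.num 0 = s.num 0 := (G.num 0 rfl).trans n0
      have a7 : s3.arr 7 = s2.arr 7 := G.arr 7 rfl
      have b7 : s4.arr 7 = s2.arr 7 := (H.arr 7 rfl).trans a7
      have b8 : s4.arr 8 = s2.arr 8 := (H.arr 8 rfl).trans (G.arr 8 rfl)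
      have b3 : s4.arr 3 = s3.arr 3 := H.arr 3 rfl
      have c3 : s4.idx 3 = 0 := ((H.idx 3 rfl).trans (G.idx 3 rfl)).trans j3
      have c8 : s4.idx 8 = 0 := ((H.idx 8 rfl).trans (G.idx 8 rfl)).trans e8
      have c9 : s4.idx 9 = 1 := ((H.idx 9 rfl).trans (G.idx 9 rfl)).trans e9
      have c20 : s4.num 20 = 1 := ((H.num 20 rfl).trans (G.num 20 rfl)).trans n20
      have cn0 : s4.num 0 = s.num 0 := (H.num 0 rfl).trans fn0
      have c0 : s4.idx 0 = s.idx 0 := (H.idx 0 rfl).trans f0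
      rw [e0] at hx
      rw [f0, f1, fn0, a7] at hviol
      set V := ∑ c ∈ Finset.range (s.idx 0), s2.arr 8 c 0 0 with hV
      have hVpos : 0 < V := Finset.sum_pos (fun a ha => j4.pos a (Finset.mem_range.1 ha))
        ⟨0, Finset.mem_range.2 hm⟩
      have hsimplex : (∀ a < s.idx 0, 0 ≤ s3.arr 3 a 0 0) ∧
          ∑ a ∈ Finset.range (s.idx 0), s3.arr 3 a 0 0 = 1 := by
        refine ⟨fun a ha => ?_, ?_⟩
        · rw [hx a ha]
          exact div_nonneg (j4.pos a ha).le hVpos.le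
        · rw [Finset.sum_congr rfl fun a ha => hx a (Finset.mem_range.1 ha), ← Finset.sum_div,
            ← hV, div_self hVpos.ne']
      have hval : ∀ b < s.idx 1, ∑ a ∈ Finset.range (s.idx 0), s3.arr 3 a 0 0 * s2.arr 7 a b 0 =
          ∑ a ∈ Finset.range (s.idx 0), s3.arr 3 a 0 0 * gameValue s a b := fun b hb =>
        Finset.sum_congr rfl fun a ha => by rw [j1 a (Finset.mem_range.1 ha) b hb]
      rw [run_ifIdxLe, c8]
      rcases hviol with ⟨v1, v2⟩ | ⟨v1, v2, v3⟩
      · rw [if_pos (by omega), run_idxConst]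
        simp only [setIdx_arr, b7, b3]
        exact ⟨j1, fun _ => hsimplex, Or.inl ⟨by simp, by omega, fun b hb => by
          rw [← hval b hb]; exact v2 b hb⟩⟩
      · rw [if_neg (by omega)]
        have hp := punishProg_spec s4 c8 c9 c20
        have K := frame_run punishProg s4
        rw [K.arr 7 rfl, K.arr 3 rfl, K.idx 3 rfl, b7, b3]
        refine ⟨j1, fun _ => hsimplex, Or.inr ⟨c3, _, j4.succ hE0.le hE1 hg v2 ?_ ?_⟩⟩
        · rw [hval _ v2] at v3
          have : ∑ a ∈ Finset.range (s.idx 0), s3.arr 3 a 0 0 * gameValue s a (s4.idx 17) =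
            (∑ a ∈ Finset.range (s.idx 0), s2.arr 8 a 0 0 * gameValue s a (s4.idx 17)) / V := by
            rw [Finset.sum_div]
            refine Finset.sum_congr rfl fun a ha => ?_
            rw [hx a (Finset.mem_range.1 ha)]
            ring
          rw [this, lt_div_iff₀ hVpos] at v3
          exact v3.le
        · intro a ha
          rw [hp a (by omega), b8, cn0, b7, j1 a ha _ v2]

/-! ### One round of the program -/

/-- The regret of type `i` after the last round, as the program computes it. -/
def newRegret (s : Mem) (i : ℕ) : ℝ := s.arr 5 i 0 0 + (roundValue s i - targetValue s i)

/-- The weight of type `i` after the last round, unless a new epoch begins. -/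
def newWeight (s : Mem) (i : ℕ) : ℝ :=
  s.arr 4 i 0 0 * (1 + s.num 0 / 4 * (roundValue s i - targetValue s i))

/-- No regret is too large, so that the learner goes on cooperating. -/
def RegretsSmall (s : Mem) : Prop :=
  ∀ i < s.idx 2, newRegret s i ≤ 0 ∨
    newRegret s i ^ 2 ≤ 784 * ((1 + Nat.clog 2 (s.idx 2) : ℕ) : ℝ) * (s.num 1 + 1)

lemma accountProg_spec (s : Mem) (h8 : s.idx 8 = 0) (h21 : s.num 21 = 0) :
    (∀ i < s.idx 2, (run accountProg s).arr 6 i 0 0 = targetValue s i ∧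
      (run accountProg s).arr 5 i 0 0 = newRegret s i ∧
      (run accountProg s).arr 4 i 0 0 = newWeight s i) ∧
    ((run accountProg s).idx 18 = 0 ↔ RegretsSmall s) ∧
    (run accountProg s).idx 9 = 1 ∧ (run accountProg s).num 20 = 1 ∧
    (run accountProg s).num 1 = s.num 1 + 1 ∧ (run accountProg s).idx 5 = s.idx 5 - 1 ∧
    (run accountProg s).idx 10 = 1 + Nat.clog 2 (s.idx 2) := by
  obtain ⟨l1, l2, l3, l4⟩ := logProg_spec s
  have F := frame_run logProg s
  have t := thresholdProg_spec (run logProg s)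
  have G := frame_run thresholdProg (run logProg s)
  have FG := (frame_run (.seq logProg (.seq thresholdProg (.idxSub 5 5 9))) s)
  simp only [run_seq, accountProg, block] at FG ⊢
  set s1 := run logProg s
  set s2 := run thresholdProg s1
  set s3 := run (.idxSub 5 5 9) s2 with hs3
  have n20 : s3.num 20 = 1 := (G.num 20 rfl).trans l2
  have i9 : s3.idx 9 = 1 := by
    have : s2.idx 9 = 1 := (G.idx 9 rfl).trans l1
    simp [hs3, run_idxSub, this]
  have i5 : s3.idx 5 = s.idx 5 - 1 := by
    have h1 : s2.idx 9 = 1 := (G.idx 9 rfl).trans l1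
    have h2 : s2.idx 5 = s.idx 5 := (G.idx 5 rfl).trans (F.idx 5 rfl)
    simp [hs3, run_idxSub, h1, h2]
  have n1 : s3.num 1 = s.num 1 + 1 := by
    rw [show s3.num 1 = s2.num 1 from rfl, t.1, l2, F.num 1 rfl]
  have n2 : s3.num 2 = 784 * ((1 + Nat.clog 2 (s.idx 2) : ℕ) : ℝ) * (s.num 1 + 1) := by
    rw [show s3.num 2 = s2.num 2 from rfl, t.2, l2, F.num 1 rfl, l4]
  have i10 : s3.idx 10 = 1 + Nat.clog 2 (s.idx 2) := (G.idx 10 rfl).trans l3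
  have hT : targetValue s3 = targetValue s := by
    funext i
    simp only [targetValue, FG.idx 0 rfl, FG.idx 1 rfl, FG.arr 0 rfl, FG.arr 1 rfl]
  have hR : roundValue s3 = roundValue s := by
    funext i
    simp only [roundValue, FG.idx 0 rfl, FG.idx 1 rfl, FG.arr 0 rfl, FG.arr 2 rfl, FG.arr 3 rfl]
  obtain ⟨r1, r2⟩ := regretProg_spec s3 i9 ((FG.idx 8 rfl).trans h8) n20 ((FG.num 21 rfl).trans h21)
  have H := frame_run regretProg s3
  rw [hT, hR, FG.idx 2 rfl, FG.arr 5 rfl, FG.arr 4 rfl, FG.num 0 rfl] at r1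
  rw [FG.idx 2 rfl, n2] at r2
  refine ⟨r1, ?_, (H.idx 9 rfl).trans i9, (H.num 20 rfl).trans n20, (H.num 1 rfl).trans n1,
    (H.idx 5 rfl).trans i5, (H.idx 10 rfl).trans i10⟩
  rw [r2]
  refine forall₂_congr fun i hi => ?_
  rw [(r1 i hi).2.1, newRegret]

lemma preProg_spec (s : Mem) (h8 : s.idx 8 = 0) (h21 : s.num 21 = 0) :
    (∀ i < s.idx 2, (run preProg s).arr 6 i 0 0 = targetValue s i ∧
      (run preProg s).arr 5 i 0 0 = newRegret s i) ∧
    (run preProg s).idx 9 = 1 ∧ (run preProg s).num 20 = 1 ∧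
    (run preProg s).num 1 = s.num 1 + 1 := by
  obtain ⟨h1, h2, h3, h4, h5, h6, h7⟩ := accountProg_spec s h8 h21
  rw [preProg, run_seq]
  have F := frame_run branchProg (run accountProg s)
  rw [F.arr 6 rfl, F.arr 5 rfl, F.idx 9 rfl, F.num 20 rfl, F.num 1 rfl]
  exact ⟨fun i hi => ⟨(h1 i hi).1, (h1 i hi).2.1⟩, h3, h4, h5⟩

/-- In a round of cooperation, the learner plays the action that the last move `y` of the optimizer
requests as `4 m T ^ 2 min (y_0, y_1)`, where `T` is the number of the round. -/
lemma preProg_cooperate (s : Mem) (h8 : s.idx 8 = 0) (h21 : s.num 21 = 0) (hm : 0 < s.idx 0)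
    (h4 : s.idx 4 = 0) (hs : RegretsSmall s) :
    (run preProg s).idx 4 = 0 ∧ (run preProg s).idx 5 = s.idx 5 - 1 ∧
    (run preProg s).idx 3 = 1 ∧
    ∃ act < s.idx 0, (∀ a < s.idx 0, (run preProg s).arr 3 a 0 0 = if a = act then 1 else 0) ∧
      ∀ j : ℕ, j < s.idx 0 →
        min (s.arr 2 0 0 0) (s.arr 2 1 0 0) * s.idx 0 * 4 * (s.num 1 + 1) * (s.num 1 + 1) = j →
        act = j := by
  obtain ⟨-, a2, a3, a4, a5, a6, -⟩ := accountProg_spec s h8 h21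
  have F := frame_run accountProg s
  have b4 : (run accountProg s).idx 4 = 0 := (F.idx 4 rfl).trans h4
  have b8 : (run accountProg s).idx 8 = 0 := (F.idx 8 rfl).trans h8
  have G := frame_run cooperateProg (run accountProg s)
  have e : run preProg s = run cooperateProg (run accountProg s) := by
    have e1 : run (.ifIdxLe 9 4 .skip (.ifIdxLe 18 8 cooperateProg enterProg))
        (run accountProg s) = run cooperateProg (run accountProg s) := by
      rw [run_ifIdxLe, if_neg (by omega), run_ifIdxLe, if_pos (by rw [b8, a2.2 hs])]
    rw [preProg, run_seq, branchProg, block, block, run_seq, e1, run_ifIdxLe,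
      if_neg (by rw [G.idx 4 rfl, G.idx 9 rfl, a3, b4]; omega), run_skip]
  have c := cooperateProg_spec (run accountProg s) b8 a3 a4 ((F.num 21 rfl).trans h21)
    (by rw [F.idx 0 rfl]; exact hm)
  rw [e]
  rw [F.idx 0 rfl, F.arr 2 rfl, a5] at c
  exact ⟨(G.idx 4 rfl).trans b4, (G.idx 5 rfl).trans a6, c⟩

/-- The round in which the Blackwell phase begins is the first one of epoch `1`. -/
lemma preProg_enter (s : Mem) (h8 : s.idx 8 = 0) (h21 : s.num 21 = 0)
    (h4 : s.idx 4 = 0) (h5 : s.idx 5 = 0) (hs : ¬ RegretsSmall s) :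
    (run preProg s).idx 4 = 1 ∧ (run preProg s).num 0 = 1 / 2 ∧
    (run preProg s).idx 6 = 4 * (1 + Nat.clog 2 (s.idx 2)) ∧
    (run preProg s).idx 7 = 4 * (16 * s.idx 0) ∧
    (run preProg s).idx 5 = 4 * (1 + Nat.clog 2 (s.idx 2)) ∧
    ∀ i < s.idx 2, (run preProg s).arr 4 i 0 0 = 1 := by
  obtain ⟨-, a2, a3, a4, a5, a6, a7⟩ := accountProg_spec s h8 h21
  have F := frame_run accountProg s
  have b4 : (run accountProg s).idx 4 = 0 := (F.idx 4 rfl).trans h4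
  have b8 : (run accountProg s).idx 8 = 0 := (F.idx 8 rfl).trans h8
  have b18 : (run accountProg s).idx 18 ≠ 0 := fun h => hs (a2.1 h)
  have G := frame_run enterProg (run accountProg s)
  have c := enterProg_spec (run accountProg s) b8
  have e : run preProg s = run epochProg (run enterProg (run accountProg s)) := by
    have e1 : run (.ifIdxLe 9 4 .skip (.ifIdxLe 18 8 cooperateProg enterProg))
        (run accountProg s) = run enterProg (run accountProg s) := by
      rw [run_ifIdxLe, if_neg (by omega), run_ifIdxLe, if_neg (by omega)]
    rw [preProg, run_seq, branchProg, block, block, run_seq, e1, run_ifIdxLe,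
      if_pos (by rw [c.1, G.idx 9 rfl, a3])]
  have d := epochProg_spec_zero (run enterProg (run accountProg s)) ((G.idx 8 rfl).trans b8)
    ((G.idx 9 rfl).trans a3) ((G.num 20 rfl).trans a4)
    (by rw [G.idx 5 rfl, a6, h5])
  have H := frame_run epochProg (run enterProg (run accountProg s))
  rw [e]
  rw [c.2.1, c.2.2.1, c.2.2.2, a7, F.idx 0 rfl, G.idx 2 rfl, F.idx 2 rfl] at d
  exact ⟨(H.idx 4 rfl).trans c.1, d⟩

/-- The first round of the next epoch of the Blackwell phase. -/
lemma preProg_epoch (s : Mem) (h8 : s.idx 8 = 0) (h21 : s.num 21 = 0)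
    (h4 : s.idx 4 = 1) (h5 : s.idx 5 = 1) :
    (run preProg s).idx 4 = 1 ∧ (run preProg s).num 0 = s.num 0 / 2 ∧
    (run preProg s).idx 6 = 4 * s.idx 6 ∧
    (run preProg s).idx 7 = 4 * s.idx 7 ∧
    (run preProg s).idx 5 = 4 * s.idx 6 ∧
    ∀ i < s.idx 2, (run preProg s).arr 4 i 0 0 = 1 := by
  obtain ⟨-, a2, a3, a4, a5, a6, a7⟩ := accountProg_spec s h8 h21
  have F := frame_run accountProg s
  have b4 : (run accountProg s).idx 4 = 1 := (F.idx 4 rfl).trans h4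
  have b8 : (run accountProg s).idx 8 = 0 := (F.idx 8 rfl).trans h8
  have e : run preProg s = run epochProg (run accountProg s) := by
    have e1 : run (.ifIdxLe 9 4 .skip (.ifIdxLe 18 8 cooperateProg enterProg))
        (run accountProg s) = run accountProg s := by
      rw [run_ifIdxLe, if_pos (by omega), run_skip]
    rw [preProg, run_seq, branchProg, block, block, run_seq, e1, run_ifIdxLe,
      if_pos (by rw [a3, b4])]
  have d := epochProg_spec_zero (run accountProg s) b8 a3 a4 (by rw [a6, h5])
  have H := frame_run epochProg (run accountProg s)
  rw [e]
  rw [F.num 0 rfl, F.idx 6 rfl, F.idx 7 rfl, F.idx 2 rfl] at d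
  exact ⟨(H.idx 4 rfl).trans b4, d⟩

/-- A round of the Blackwell phase in which no epoch begins. -/
lemma preProg_continue (s : Mem) (h8 : s.idx 8 = 0) (h21 : s.num 21 = 0)
    (h4 : s.idx 4 = 1) (h5 : 1 < s.idx 5) :
    (run preProg s).idx 4 = 1 ∧ (run preProg s).num 0 = s.num 0 ∧
    (run preProg s).idx 6 = s.idx 6 ∧
    (run preProg s).idx 7 = s.idx 7 ∧
    (run preProg s).idx 5 = s.idx 5 - 1 ∧
    ∀ i < s.idx 2, (run preProg s).arr 4 i 0 0 = newWeight s i := by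
  obtain ⟨a1, a2, a3, a4, a5, a6, a7⟩ := accountProg_spec s h8 h21
  have F := frame_run accountProg s
  have b4 : (run accountProg s).idx 4 = 1 := (F.idx 4 rfl).trans h4
  have b8 : (run accountProg s).idx 8 = 0 := (F.idx 8 rfl).trans h8
  have e : run preProg s = run accountProg s := by
    have e1 : run (.ifIdxLe 9 4 .skip (.ifIdxLe 18 8 cooperateProg enterProg))
        (run accountProg s) = run accountProg s := by
      rw [run_ifIdxLe, if_pos (by omega), run_skip]
    rw [preProg, run_seq, branchProg, block, block, run_seq, e1, run_ifIdxLe,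
      if_pos (by rw [a3, b4]), epochProg_spec_pos _ b8 (by omega)]
  rw [e]
  exact ⟨b4, F.num 0 rfl, F.idx 6 rfl, F.idx 7 rfl, a6, fun i hi => (a1 i hi).2.2⟩

/-! ### Multiplicative weights with restarts -/

/-- The epoch that contains round `t`, and the number of rounds of this epoch before round `t`.
Epochs are numbered from `1`, and epoch `e` consists of `L * 4 ^ e` rounds. -/
def epochPos (L : ℕ) : ℕ → ℕ × ℕ
  | 0 => (1, 0)
  | t + 1 =>
    if (epochPos L t).2 + 1 < L * 4 ^ (epochPos L t).1 then
      ((epochPos L t).1, (epochPos L t).2 + 1)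
    else ((epochPos L t).1 + 1, 0)

lemma epochPos_spec {L : ℕ} (hL : 0 < L) (t : ℕ) :
    1 ≤ (epochPos L t).1 ∧ (epochPos L t).2 < L * 4 ^ (epochPos L t).1 ∧
      3 * t + 4 * L = L * 4 ^ (epochPos L t).1 + 3 * (epochPos L t).2 := by
  induction t with
  | zero => simp [epochPos, hL]; ring
  | succ t ih =>
    obtain ⟨h1, h2, h3⟩ := ih
    rw [epochPos]
    split_ifs with h
    · exact ⟨h1, h, by simp only; omega⟩
    · refine ⟨by simp, by positivity, ?_⟩
      have : L * 4 ^ ((epochPos L t).1 + 1) = 4 * (L * 4 ^ (epochPos L t).1) := by ring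
      simp only [this]
      omega

lemma four_pow_epochPos_le {L : ℕ} (hL : 0 < L) (t : ℕ) : 4 ^ (epochPos L t).1 ≤ 3 * t + 4 := by
  have h := (epochPos_spec hL t).2.2
  have : L * 4 ^ (epochPos L t).1 ≤ L * (3 * t + 4) := by nlinarith
  exact Nat.le_of_mul_le_mul_left this hL

/-- The state of multiplicative weights with initial weights `c` and step size `E / 4`, where
`E = 2⁻ᵉ`, after `q` rounds of epoch `e`. `S j` is the total gain of expert `j`, of which at most
`(4 D + 2 L) (2 ^ e - 2)` stems from the previous epochs if expert `j` has a share of at least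
`exp (-D)` of the initial weights. -/
structure EpochInv {ι : Type*} [Fintype ι] (L : ℕ) (c : ι → ℝ) (e q : ℕ) (w S : ι → ℝ) : Prop where
  pos : ∀ j, 0 < w j
  sum_le : ∑ j, w j ≤ (∑ j, c j) * Real.exp (((1 / 2) ^ e) ^ 2 / 4 * q)
  le : ∀ j D, 0 ≤ D → ∑ j, c j ≤ c j * Real.exp D →
    c j * Real.exp ((1 / 2) ^ e / 4 * (S j - (4 * D + 2 * L) * (2 ^ e - 2)) -
      ((1 / 2) ^ e) ^ 2 / 4 * q) ≤ w j

namespace EpochInv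

variable {ι : Type*} [Fintype ι] {L : ℕ} {c : ι → ℝ} {e q : ℕ} {w S : ι → ℝ}

lemma step (h : EpochInv L c e q w S) {r : ι → ℝ} (hr : ∀ j, |r j| ≤ 2)
    (hw : ∑ j, w j * r j ≤ (1 / 2) ^ e * ∑ j, w j) :
    EpochInv L c e (q + 1) (fun j => w j * (1 + (1 / 2) ^ e / 4 * r j)) (fun j => S j + r j) := by
  have hE0 : (0 : ℝ) < (1 / 2) ^ e := by positivity
  have hE1 : ((1 : ℝ) / 2) ^ e ≤ 1 := pow_le_one₀ (by norm_num) (by norm_num)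
  set E : ℝ := (1 / 2) ^ e
  have hx : ∀ j, |E / 4 * r j| ≤ E / 2 := fun j => by
    rw [abs_mul, abs_of_pos (by positivity)]
    nlinarith [hr j]
  have hexp : ∀ j, Real.exp (E / 4 * r j - E ^ 2 / 4) ≤ 1 + E / 4 * r j := fun j => by
    refine le_trans (Real.exp_le_exp.2 ?_) (exp_sub_sq_le_one_add ((hx j).trans (by linarith)))
    have := pow_le_pow_left₀ (abs_nonneg _) (hx j) 2
    rw [sq_abs] at this
    linarith
  refine ⟨fun j => ?_, ?_, fun j D hD hcD => ?_⟩
  · have := (abs_le.1 (hx j)).1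
    exact mul_pos (h.pos j) (by linarith)
  · have h0 : 0 ≤ ∑ j, w j := Finset.sum_nonneg fun j _ => (h.pos j).le
    have h1 : ∑ j, w j * (1 + E / 4 * r j) = ∑ j, w j + E / 4 * ∑ j, w j * r j := by
      rw [Finset.mul_sum, ← Finset.sum_add_distrib]
      exact Finset.sum_congr rfl fun j _ => by ring
    have h2 : ∑ j, w j * (1 + E / 4 * r j) ≤ (∑ j, w j) * (E ^ 2 / 4 + 1) := by
      rw [h1]
      nlinarith
    calc _ ≤ _ := h2
      _ ≤ (∑ j, w j) * Real.exp (E ^ 2 / 4) :=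
          mul_le_mul_of_nonneg_left (Real.add_one_le_exp _) h0
      _ ≤ ((∑ j, c j) * Real.exp (E ^ 2 / 4 * q)) * Real.exp (E ^ 2 / 4) :=
          mul_le_mul_of_nonneg_right h.sum_le (Real.exp_pos _).le
      _ = _ := by
          rw [mul_assoc, ← Real.exp_add]
          congr 2
          push_cast
          ring
  · have h1 := mul_le_mul (h.le j D hD hcD) (hexp j) (Real.exp_pos _).le (h.pos j).le
    rw [mul_assoc, ← Real.exp_add] at h1
    refine le_trans (le_of_eq ?_) h1
    congr 2
    push_cast
    ring

/-- The weight of expert `j` is at most the total weight, so the gain of this expert in epoch `e` is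
at most `(4 D + 2 L) 2 ^ e`. -/
lemma gain_le (h : EpochInv L c e q w S) (hc : ∀ j, 0 < c j) (hq : q ≤ L * 4 ^ e) {j : ι} {D : ℝ}
    (hD : 0 ≤ D) (hcD : ∑ j, c j ≤ c j * Real.exp D) :
    S j ≤ (4 * D + 2 * L) * (2 ^ (e + 1) - 2) := by
  have h1 : w j ≤ ∑ j, w j :=
    Finset.single_le_sum (f := w) (fun i _ => (h.pos i).le) (Finset.mem_univ j)
  have h2 := ((h.le j D hD hcD).trans h1).trans h.sum_le
  have h3 := h2.trans (mul_le_mul_of_nonneg_right hcD (Real.exp_pos _).le)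
  rw [mul_assoc, mul_le_mul_iff_right₀ (hc j), ← Real.exp_add, Real.exp_le_exp] at h3
  have hE : ((1 : ℝ) / 2) ^ e * 2 ^ e = 1 := by rw [← mul_pow]; norm_num
  have hq' : (q : ℝ) ≤ L * (2 ^ e) ^ 2 := by
    rw [← pow_mul, mul_comm e 2, pow_mul]
    norm_num
    exact_mod_cast hq
  have hX : (0 : ℝ) < 2 ^ e := by positivity
  rw [pow_succ]
  generalize (2 : ℝ) ^ e = X at *
  generalize ((1 : ℝ) / 2) ^ e = E at *
  have h4 := mul_le_mul_of_nonneg_left h3 (show 0 ≤ 4 * X by positivity)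
  have e1 : 4 * X * (E / 4 * (S j - (4 * D + 2 * L) * (X - 2)) - E ^ 2 / 4 * q) =
      (E * X) * (S j - (4 * D + 2 * L) * (X - 2)) - (E * X) * (E * q) := by ring
  have e2 : 4 * X * (D + E ^ 2 / 4 * q) = 4 * D * X + (E * X) * (E * q) := by ring
  rw [e1, e2, hE, one_mul, one_mul] at h4
  have h5 : E * q ≤ L * X := by
    have hE' : 0 ≤ E := by
      by_contra hneg
      push Not at hneg
      nlinarith
    calc E * q ≤ E * (L * X ^ 2) := mul_le_mul_of_nonneg_left hq' hE'
      _ = (E * X) * (L * X) := by ring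
      _ = L * X := by rw [hE, one_mul]
  linarith

lemma restart (h : EpochInv L c e q w S) (hc : ∀ j, 0 < c j) (hq : q ≤ L * 4 ^ e) :
    EpochInv L c (e + 1) 0 c S := by
  refine ⟨hc, by simp, fun j D hD hcD => ?_⟩
  have h1 := h.gain_le hc hq hD hcD
  refine mul_le_of_le_one_right (hc j).le (Real.exp_le_one_iff.2 ?_)
  have : (0 : ℝ) < (1 / 2) ^ (e + 1) := by positivity
  simp only [Nat.cast_zero, mul_zero, sub_zero]
  exact mul_nonpos_of_nonneg_of_nonpos (by positivity) (by linarith)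

end EpochInv

lemma weight_factor_pos (e : ℕ) {x : ℝ} (hx : |x| ≤ 2) : 0 < 1 + (1 / 2) ^ e / 4 * x := by
  have h1 : ((1 : ℝ) / 2) ^ e ≤ 1 := pow_le_one₀ (by norm_num) (by norm_num)
  have h0 : (0 : ℝ) < (1 / 2) ^ e := by positivity
  have := (abs_le.1 hx).1
  nlinarith

/-- Multiplicative weights with restarts: if in every round the weighted average of the gains is
at most `2⁻ᵉ`, where `e` is the epoch, then no expert gains much more than `√(L τ)` in `τ`
rounds. -/
theorem sum_gain_le {ι : Type*} [Fintype ι] {L : ℕ} (hL : 0 < L) {c : ι → ℝ} (hc : ∀ j, 0 < c j)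
    {r w : ℕ → ι → ℝ} (hr : ∀ t j, |r t j| ≤ 2) (hw0 : ∀ j, w 0 j = c j)
    (hw : ∀ t j, w (t + 1) j = if (epochPos L (t + 1)).2 = 0 then c j
      else w t j * (1 + (1 / 2) ^ (epochPos L t).1 / 4 * r t j)) {τ : ℕ}
    (h : ∀ t < τ, ∑ j, w t j * r t j ≤ (1 / 2) ^ (epochPos L t).1 * ∑ j, w t j)
    {j : ι} {D : ℝ} (hD : 0 ≤ D) (hcD : ∑ j, c j ≤ c j * Real.exp D) :
    ∑ t ∈ Finset.range τ, r t j ≤ (16 * (D / L) + 8) * Real.sqrt (L * τ) := by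
  have hL' : (0 : ℝ) < L := by exact_mod_cast hL
  have inv : ∀ t ≤ τ, EpochInv L c (epochPos L t).1 (epochPos L t).2 (w t)
      (fun j => ∑ s ∈ Finset.range t, r s j) := by
    intro t
    induction t with
    | zero =>
      intro _
      refine ⟨fun j => by rw [hw0]; exact hc j, ?_, fun j D hD _ => ?_⟩
      · simp [epochPos, hw0]
      · simp [epochPos, hw0]
    | succ t ih =>
      intro ht
      have h1 := (ih (by omega)).step (hr t) (h t (by omega))
      simp only [Finset.sum_range_succ]
      have hq := (epochPos_spec hL t).2.1
      by_cases hp : (epochPos L t).2 + 1 < L * 4 ^ (epochPos L t).1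
      · have e1 : epochPos L (t + 1) = ((epochPos L t).1, (epochPos L t).2 + 1) := by
          rw [epochPos, if_pos hp]
        rw [e1]
        convert h1 using 1
        funext i
        rw [hw, e1]
        simp
      · have e1 : epochPos L (t + 1) = ((epochPos L t).1 + 1, 0) := by
          rw [epochPos, if_neg hp]
        rw [e1]
        convert h1.restart hc (by omega) using 1
        funext i
        rw [hw, e1]
        simp
  obtain ⟨h1, h2, h3⟩ := epochPos_spec hL τ
  have hS := (inv τ le_rfl).gain_le hc h2.le hD hcD
  set e := (epochPos L τ).1
  have hD' : 0 ≤ D / L := by positivity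
  -- in the first epoch the gain is bounded by the number of rounds; after it, the number of
  -- rounds is at least a quarter of the length of the current epoch
  rcases Nat.lt_or_ge τ (4 * L) with hτ | hτ
  · have hb : ∑ t ∈ Finset.range τ, r t j ≤ 2 * τ := by
      calc _ ≤ ∑ t ∈ Finset.range τ, (2 : ℝ) :=
            Finset.sum_le_sum fun t _ => (abs_le.1 (hr t j)).2
        _ = _ := by simp [mul_comm]
    have hτ' : (τ : ℝ) ≤ 4 * L := by exact_mod_cast hτ.le
    have hs : (τ : ℝ) ≤ 2 * Real.sqrt (L * τ) := by
      rw [show (2 : ℝ) = Real.sqrt 4 by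
        rw [show (4 : ℝ) = 2 ^ 2 by norm_num]; simp, ← Real.sqrt_mul (by norm_num)]
      apply Real.le_sqrt_of_sq_le
      nlinarith [Nat.cast_nonneg (α := ℝ) τ]
    have := Real.sqrt_nonneg (L * τ : ℝ)
    nlinarith [mul_nonneg hD' this]
  · have hX : L * (2 : ℝ) ^ e ≤ 2 * Real.sqrt (L * τ) := by
      rw [show (2 : ℝ) * Real.sqrt (L * τ) = Real.sqrt 4 * Real.sqrt (L * τ) by
        rw [show (4 : ℝ) = 2 ^ 2 by norm_num]; simp, ← Real.sqrt_mul (by norm_num)]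
      apply Real.le_sqrt_of_sq_le
      have h4 : (L : ℝ) * 4 ^ e ≤ 4 * τ := by
        have : L * 4 ^ e ≤ 4 * τ := by omega
        exact_mod_cast this
      rw [mul_pow, ← pow_mul, mul_comm e 2, pow_mul]
      norm_num
      nlinarith
    calc _ ≤ _ := hS
      _ ≤ (4 * D + 2 * L) * (2 * 2 ^ e) := by
          rw [pow_succ]
          exact mul_le_mul_of_nonneg_left (by linarith) (by positivity)
      _ = (4 * (D / L) + 2) * 2 * (L * 2 ^ e) := by field_simp
      _ ≤ (4 * (D / L) + 2) * 2 * (2 * Real.sqrt (L * τ)) :=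
          mul_le_mul_of_nonneg_left hX (by positivity)
      _ = _ := by ring

/-! ### Steering the average profile to a point of the candidate menu -/

lemma cspPayoff_eq_sum {m n : ℕ} (u : Fin m → Fin n → ℝ) (φ : CSPSpace m n) :
    cspPayoff u φ = ∑ p : Fin m × Fin n, φ p * u p.1 p.2 := by
  rw [cspPayoff, Fintype.sum_prod_type]

lemma abs_cspPayoff_le {m n : ℕ} {u : Fin m → Fin n → ℝ} (hu : ∀ a b, |u a b| ≤ 1)
    {φ : CSPSpace m n} (hφ : φ ∈ cspSimplex m n) : |cspPayoff u φ| ≤ 1 := by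
  rw [cspPayoff_eq_sum, ← hφ.2]
  refine (Finset.abs_sum_le_sum_abs _ _).trans (Finset.sum_le_sum fun p _ => ?_)
  rw [abs_mul, abs_of_nonneg (hφ.1 p)]
  exact mul_le_of_le_one_right (hφ.1 p) (hu _ _)

/-- The gains of the experts that steer play to `φ` when the pair of pure actions `g` is played:
one expert for each type, and two for each pair of actions, which watch over the frequency of this
pair. -/
def steeringGain {m n k : ℕ} (U : Fin k → Fin m → Fin n → ℝ) (Φ : Fin k → CSPSpace m n)
    (φ : CSPSpace m n) (g : Fin m × Fin n) : Fin k ⊕ (Fin m × Fin n) × Bool → ℝ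
  | .inl i => U i g.1 g.2 - cspPayoff (U i) (Φ i)
  | .inr (p, true) => (if g = p then 1 else 0) - φ p
  | .inr (p, false) => φ p - (if g = p then 1 else 0)

/-- Drawn from `φ`, a pair of actions has expected gain at most `0` for every expert, so for given
weights some pair has weighted gain at most `0`. -/
lemma exists_steeringGain_nonpos {m n k : ℕ} {U : Fin k → Fin m → Fin n → ℝ}
    {Φ : Fin k → CSPSpace m n} {φ : CSPSpace m n} (hφ : φ ∈ candidateMenu U Φ)
    (w : Fin k ⊕ (Fin m × Fin n) × Bool → ℝ) (hw : ∀ j, 0 ≤ w j) :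
    ∃ g, ∑ j, w j * steeringGain U Φ φ g j ≤ 0 := by
  by_contra hcon
  push Not at hcon
  have h1 : ∀ j, ∑ g, φ g * steeringGain U Φ φ g j ≤ 0 := by
    rintro (i | ⟨p, _ | _⟩)
    · simp only [steeringGain, mul_sub, Finset.sum_sub_distrib, ← Finset.sum_mul, hφ.1.2,
        ← cspPayoff_eq_sum]
      linarith [hφ.2 i]
    · simp [steeringGain, mul_sub, Finset.sum_sub_distrib, ← Finset.sum_mul, hφ.1.2]
    · simp [steeringGain, mul_sub, Finset.sum_sub_distrib, ← Finset.sum_mul, hφ.1.2]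
  have h2 : ∑ g, φ g * ∑ j, w j * steeringGain U Φ φ g j ≤ 0 := by
    have : ∑ g, φ g * ∑ j, w j * steeringGain U Φ φ g j =
        ∑ j, w j * ∑ g, φ g * steeringGain U Φ φ g j := by
      simp only [Finset.mul_sum]
      rw [Finset.sum_comm]
      exact Finset.sum_congr rfl fun j _ => Finset.sum_congr rfl fun g _ => by ring
    rw [this]
    exact Finset.sum_nonpos fun j _ => mul_nonpos_of_nonneg_of_nonpos (hw j) (h1 j)
  have h3 : ∃ g, 0 < φ g := by
    by_contra hall
    push Not at hall
    have := Finset.sum_nonpos fun g (_ : g ∈ Finset.univ) => hall g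
    rw [hφ.1.2] at this
    linarith
  obtain ⟨g, hg⟩ := h3
  have h4 : 0 < ∑ g, φ g * ∑ j, w j * steeringGain U Φ φ g j :=
    Finset.sum_pos' (fun g _ => mul_nonneg (hφ.1.1 g) (hcon g).le)
      ⟨g, Finset.mem_univ _, mul_pos hg (hcon g)⟩
  linarith

lemma abs_steeringGain_le {m n k : ℕ} {U : Fin k → Fin m → Fin n → ℝ}
    (hU : ∀ i a b, |U i a b| ≤ 1) {Φ : Fin k → CSPSpace m n} (hΦ : ∀ i, Φ i ∈ cspSimplex m n)
    {φ : CSPSpace m n} (hφ : φ ∈ cspSimplex m n) (g : Fin m × Fin n)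
    (j : Fin k ⊕ (Fin m × Fin n) × Bool) : |steeringGain U Φ φ g j| ≤ 2 := by
  have hle : ∀ p, φ p ≤ 1 := fun p => by
    rw [← hφ.2]
    exact Finset.single_le_sum (f := fun p => φ p) (fun q _ => hφ.1 q) (Finset.mem_univ p)
  rcases j with i | ⟨p, _ | _⟩
  · have h1 := abs_le.1 (hU i g.1 g.2)
    have h2 := abs_le.1 (abs_cspPayoff_le (hU i) (hΦ i))
    exact abs_le.2 ⟨by simp only [steeringGain]; linarith, by simp only [steeringGain]; linarith⟩
  · have h1 := hle p
    have h2 := hφ.1 p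
    refine abs_le.2 ⟨?_, ?_⟩ <;> simp only [steeringGain] <;> split_ifs <;> linarith
  · have h1 := hle p
    have h2 := hφ.1 p
    refine abs_le.2 ⟨?_, ?_⟩ <;> simp only [steeringGain] <;> split_ifs <;> linarith

/-- Every point `φ` of the candidate menu is the limit of the average profiles of a sequence of
pairs of pure actions along which the regrets of the types stay of order `√(L τ)`, with an absolute
constant. -/
theorem exists_steering {m n k : ℕ} (hk : 0 < k) {L : ℕ} (hL : 0 < L) (hkL : k + 1 ≤ 2 ^ L)
    {U : Fin k → Fin m → Fin n → ℝ} (hU : ∀ i a b, |U i a b| ≤ 1) {Φ : Fin k → CSPSpace m n}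
    (hΦ : ∀ i, Φ i ∈ cspSimplex m n) {φ : CSPSpace m n} (hφ : φ ∈ candidateMenu U Φ) :
    ∃ g : ℕ → Fin m × Fin n,
      (∀ τ i, ∑ t ∈ Finset.range τ, (U i (g t).1 (g t).2 - cspPayoff (U i) (Φ i)) ≤
        24 * Real.sqrt (L * τ)) ∧
      ∀ τ p, |∑ t ∈ Finset.range τ, ((if g t = p then 1 else 0) - φ p)| ≤
        (16 * Real.log ((k + 1) * (2 * (m * n))) + 8) * Real.sqrt (L * τ) := by
  classical
  have hL' : (1 : ℝ) ≤ L := by exact_mod_cast hL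
  have hk' : (0 : ℝ) < k := by exact_mod_cast hk
  obtain ⟨p₀, -⟩ : ∃ p : Fin m × Fin n, True := by
    by_contra hcon
    push Not at hcon
    have h1 := hφ.1.2
    rw [Finset.sum_eq_zero fun p _ => (hcon p).elim] at h1
    norm_num at h1
  have hm : (1 : ℝ) ≤ m := by exact_mod_cast (show 1 ≤ m by have := p₀.1.2; omega)
  have hn : (1 : ℝ) ≤ n := by exact_mod_cast (show 1 ≤ n by have := p₀.2.2; omega)
  have hmn : (1 : ℝ) ≤ m * n := one_le_mul_of_one_le_of_one_le hm hn
  -- the experts for the pairs of actions together have the same initial weight as a single type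
  set c : Fin k ⊕ (Fin m × Fin n) × Bool → ℝ := Sum.elim (fun _ => 1) (fun _ => 1 / (2 * (m * n)))
    with hc
  have hcpos : ∀ j, 0 < c j := by
    rintro (i | p)
    · simp [hc]
    · simp only [hc, Sum.elim_inr]; positivity
  have hcsum : ∑ j, c j = k + 1 := by
    simp only [hc, Fintype.sum_sum_type, Sum.elim_inl, Sum.elim_inr, Finset.sum_const,
      Finset.card_univ, Fintype.card_fin, Fintype.card_prod, Fintype.card_bool, nsmul_eq_mul]
    push_cast
    field_simp
  -- the weights are never negative; for other weights the choice is irrelevant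
  have hpick : ∀ w : Fin k ⊕ (Fin m × Fin n) × Bool → ℝ, ∃ g, (∀ j, 0 ≤ w j) →
      ∑ j, w j * steeringGain U Φ φ g j ≤ 0 := fun w => by
    by_cases hw : ∀ j, 0 ≤ w j
    · obtain ⟨g, hg⟩ := exists_steeringGain_nonpos hφ w hw
      exact ⟨g, fun _ => hg⟩
    · exact ⟨p₀, fun h => (hw h).elim⟩
  choose pick hpick using hpick
  set w : ℕ → Fin k ⊕ (Fin m × Fin n) × Bool → ℝ := fun t => Nat.rec c (fun t w j =>
    if (epochPos L (t + 1)).2 = 0 then c j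
    else w j * (1 + (1 / 2) ^ (epochPos L t).1 / 4 * steeringGain U Φ φ (pick w) j)) t with hwdef
  have hr : ∀ t j, |steeringGain U Φ φ (pick (w t)) j| ≤ 2 := fun t j =>
    abs_steeringGain_le hU hΦ hφ.1 _ _
  have hwS : ∀ t j, w (t + 1) j = if (epochPos L (t + 1)).2 = 0 then c j
      else w t j * (1 + (1 / 2) ^ (epochPos L t).1 / 4 * steeringGain U Φ φ (pick (w t)) j) :=
    fun _ _ => rfl
  have hw : ∀ t j, 0 ≤ w t j := by
    intro t
    induction t with
    | zero => exact fun j => (hcpos j).le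
    | succ t ih =>
      intro j
      rw [hwS]
      split_ifs with h
      · exact (hcpos j).le
      · exact mul_nonneg (ih j) (weight_factor_pos _ (hr t j)).le
  have main := fun (τ : ℕ) (j) (D : ℝ) (hD : 0 ≤ D) (hcD : ∑ j, c j ≤ c j * Real.exp D) =>
    sum_gain_le hL hcpos (r := fun t => steeringGain U Φ φ (pick (w t))) hr (fun _ => rfl) hwS
      (τ := τ) (fun t _ => (hpick (w t) (hw t)).trans
        (mul_nonneg (by positivity) (Finset.sum_nonneg fun j _ => hw t j))) hD hcD
  refine ⟨fun t => pick (w t), fun τ i => ?_, fun τ p => ?_⟩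
  · have h2 := main τ (.inl i) L (by positivity) (by
      rw [hcsum]
      simp only [hc, Sum.elim_inl, one_mul]
      have e1 : ((k : ℝ) + 1) ≤ 2 ^ L := by exact_mod_cast hkL
      refine e1.trans ?_
      rw [← Real.exp_one_pow]
      exact pow_le_pow_left₀ (by norm_num) (by linarith [Real.exp_one_gt_d9]) _)
    rw [div_self (by positivity)] at h2
    rwa [show (16 * 1 + 8 : ℝ) = 24 by norm_num] at h2
  · set D := Real.log ((k + 1) * (2 * (m * n))) with hDdef
    have hD : 0 ≤ D := Real.log_nonneg (by nlinarith)
    have hcD : ∀ s, ∑ j, c j ≤ c (.inr (p, s)) * Real.exp D := fun s => by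
      rw [hcsum, hDdef, Real.exp_log (by positivity)]
      simp only [hc, Sum.elim_inr]
      apply le_of_eq
      field_simp
    have hDL : D / L ≤ D := div_le_self hD hL'
    have hs := Real.sqrt_nonneg (L * τ : ℝ)
    have h1 := main τ (.inr (p, true)) D hD (hcD true)
    have h2 := main τ (.inr (p, false)) D hD (hcD false)
    have h3 : (16 * (D / L) + 8) * Real.sqrt (L * τ) ≤ (16 * D + 8) * Real.sqrt (L * τ) :=
      mul_le_mul_of_nonneg_right (by linarith) hs
    have e : ∑ t ∈ Finset.range τ, steeringGain U Φ φ (pick (w t)) (.inr (p, false)) =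
        -∑ t ∈ Finset.range τ, ((if pick (w t) = p then 1 else 0) - φ p) := by
      rw [← Finset.sum_neg_distrib]
      exact Finset.sum_congr rfl fun t _ => by simp only [steeringGain]; ring
    rw [e] at h2
    exact abs_le.2 ⟨by linarith, h1.trans h3⟩

/-! ### The run of the program against a sequence of moves -/

section Dynamics

variable {m n k : ℕ} (U : Fin k → Fin m → Fin n → ℝ) (Φ : Fin k → CSPSpace m n) (y : ℕ → Mixed n)

/-- The memory before round `t + 1`. -/
def stateBefore (t : ℕ) : Mem := memBefore blackwellAbort (startMem U Φ) y t

/-- The memory after round `t + 1`. -/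
def stateAfter (t : ℕ) : Mem := run blackwellAbort (stateBefore U Φ y t)

/-- The vector in the output array after round `t + 1`. -/
def response (t : ℕ) (a : Fin m) : ℝ := (stateAfter U Φ y t).arr 3 a 0 0

/-- The regret of type `i` in round `t + 1`. -/
def roundRegret (t : ℕ) (i : Fin k) : ℝ :=
  ∑ a, ∑ b, response U Φ y t a * (y t).1 b * U i a b - cspPayoff (U i) (Φ i)

/-- The factor `L = 1 + ⌈log₂ k⌉` that replaces the logarithm, which the machine cannot compute. -/
def logFactor (k : ℕ) : ℕ := 1 + Nat.clog 2 k

/-- The memory `s` holds the input of the program, and zero in the registers used as the constant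
`0`. -/
structure Ready (s : Mem) : Prop where
  idx0 : s.idx 0 = m
  idx1 : s.idx 1 = n
  idx2 : s.idx 2 = k
  idx8 : s.idx 8 = 0
  num21 : s.num 21 = 0
  arr0 : ∀ (i : Fin k) (a : Fin m) (b : Fin n), s.arr 0 i a b = U i a b
  arr1 : ∀ (i : Fin k) (a : Fin m) (b : Fin n), s.arr 1 i a b = Φ i (a, b)

lemma Ready.of_frame {U : Fin k → Fin m → Fin n → ℝ} {Φ : Fin k → CSPSpace m n} {s s' : Mem}
    (h : Ready U Φ s) {p : Prog} (F : Frame p s s') (h0 : writesIdx p 0 = false)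
    (h1 : writesIdx p 1 = false) (h2 : writesIdx p 2 = false) (h8 : writesIdx p 8 = false)
    (h21 : writesNum p 21 = false) (a0 : writesArr p 0 = false) (a1 : writesArr p 1 = false) :
    Ready U Φ s' where
  idx0 := (F.idx 0 h0).trans h.idx0
  idx1 := (F.idx 1 h1).trans h.idx1
  idx2 := (F.idx 2 h2).trans h.idx2
  idx8 := (F.idx 8 h8).trans h.idx8
  num21 := (F.num 21 h21).trans h.num21
  arr0 i a b := by rw [F.arr 0 a0, h.arr0]
  arr1 i a b := by rw [F.arr 1 a1, h.arr1]

lemma stateBefore_zero : stateBefore U Φ y 0 = startMem U Φ := rfl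

lemma stateBefore_succ (t : ℕ) :
    stateBefore U Φ y (t + 1) = receiveMove (stateAfter U Φ y t) (y t) := rfl

lemma stateBefore_succ_arr (t : ℕ) {c : ℕ} (hc : c ≠ 2) :
    (stateBefore U Φ y (t + 1)).arr c = (stateAfter U Φ y t).arr c := by
  funext i j l
  rw [stateBefore_succ]
  simp [receiveMove, hc]

lemma stateBefore_succ_idx (t : ℕ) :
    (stateBefore U Φ y (t + 1)).idx = (stateAfter U Φ y t).idx := by
  rw [stateBefore_succ, receiveMove]

lemma stateBefore_succ_num (t : ℕ) :
    (stateBefore U Φ y (t + 1)).num = (stateAfter U Φ y t).num := by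
  rw [stateBefore_succ, receiveMove]

lemma stateBefore_succ_move (t : ℕ) (b : Fin n) :
    (stateBefore U Φ y (t + 1)).arr 2 b 0 0 = (y t).1 b := by
  rw [stateBefore_succ]
  simp [receiveMove]

lemma ready_before (t : ℕ) : Ready U Φ (stateBefore U Φ y t) := by
  induction t with
  | zero =>
    rw [stateBefore_zero]
    refine ⟨rfl, rfl, rfl, rfl, rfl, fun i a b => ?_, fun i a b => ?_⟩ <;> simp [startMem]
  | succ t ih =>
    have h : Ready U Φ (stateAfter U Φ y t) :=
      ih.of_frame (frame_run blackwellAbort _) rfl rfl rfl rfl rfl rfl rfl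
    refine ⟨?_, ?_, ?_, ?_, ?_, fun i a b => ?_, fun i a b => ?_⟩
    · rw [stateBefore_succ_idx, h.idx0]
    · rw [stateBefore_succ_idx, h.idx1]
    · rw [stateBefore_succ_idx, h.idx2]
    · rw [stateBefore_succ_idx, h.idx8]
    · rw [stateBefore_succ_num, h.num21]
    · rw [stateBefore_succ_arr U Φ y t (by norm_num), h.arr0]
    · rw [stateBefore_succ_arr U Φ y t (by norm_num), h.arr1]

variable {U Φ} in
lemma Ready.targetValue_eq {s : Mem} (h : Ready U Φ s) (i : Fin k) :
    targetValue s i = cspPayoff (U i) (Φ i) := by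
  rw [targetValue, cspPayoff, h.idx0, h.idx1, Finset.sum_range]
  refine Finset.sum_congr rfl fun a _ => ?_
  rw [Finset.sum_range]
  exact Finset.sum_congr rfl fun b _ => by rw [h.arr0, h.arr1]

/-- In the first round there is no last move, and the arrays for the strategies hold zeros. -/
lemma roundValue_zero (i : ℕ) : roundValue (stateBefore U Φ y 0) i = 0 := by
  simp [roundValue, stateBefore_zero, startMem]

lemma roundValue_sub_targetValue (t : ℕ) (i : Fin k) :
    roundValue (stateBefore U Φ y (t + 1)) i - targetValue (stateBefore U Φ y (t + 1)) i =
      roundRegret U Φ y t i := by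
  have h := ready_before U Φ y (t + 1)
  rw [h.targetValue_eq, roundRegret, roundValue, h.idx0, h.idx1, Finset.sum_range]
  congr 1
  refine Finset.sum_congr rfl fun a _ => ?_
  rw [Finset.sum_range]
  refine Finset.sum_congr rfl fun b _ => ?_
  rw [stateBefore_succ_move, h.arr0, stateBefore_succ_arr U Φ y t (by norm_num), response]

lemma stateAfter_frame (t : ℕ) : Frame (.ifIdxLe 9 4 solveProg .skip)
    (run preProg (stateBefore U Φ y t)) (stateAfter U Φ y t) := by
  rw [stateAfter, blackwellAbort, run_seq]
  exact frame_run _ _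

lemma stateBefore_num_one (t : ℕ) : (stateBefore U Φ y t).num 1 = t := by
  induction t with
  | zero => simp [stateBefore_zero, startMem]
  | succ t ih =>
    have h := ready_before U Φ y t
    have : (stateAfter U Φ y t).num 1 = _ := ((stateAfter_frame U Φ y t).num 1 rfl).trans
      (preProg_spec _ h.idx8 h.num21).2.2.2
    rw [stateBefore_succ_num, this, ih]
    push_cast
    rfl

/-- The regret that the program computes differs from the actual one by `u_i(φ_i)`, because the
program also updates the regrets at the beginning of the first round, when nothing has been played
yet. -/
lemma newRegret_eq (t : ℕ) (i : Fin k) :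
    newRegret (stateBefore U Φ y t) i =
      ∑ s ∈ Finset.range t, roundRegret U Φ y s i - cspPayoff (U i) (Φ i) := by
  induction t with
  | zero =>
    rw [newRegret, roundValue_zero, (ready_before U Φ y 0).targetValue_eq]
    simp [stateBefore_zero, startMem]
  | succ t ih =>
    have h := ready_before U Φ y t
    have h5 : (stateAfter U Φ y t).arr 5 i 0 0 = newRegret (stateBefore U Φ y t) i := by
      rw [(stateAfter_frame U Φ y t).arr 5 rfl]
      exact ((preProg_spec _ h.idx8 h.num21).1 i (by rw [h.idx2]; exact i.2)).2
    rw [newRegret, roundValue_sub_targetValue, stateBefore_succ_arr U Φ y t (by norm_num), h5, ih,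
      Finset.sum_range_succ]
    ring

lemma regretsSmall_iff (t : ℕ) : RegretsSmall (stateBefore U Φ y t) ↔ ∀ i,
    ∑ s ∈ Finset.range t, roundRegret U Φ y s i - cspPayoff (U i) (Φ i) ≤ 0 ∨
    (∑ s ∈ Finset.range t, roundRegret U Φ y s i - cspPayoff (U i) (Φ i)) ^ 2 ≤
      784 * logFactor k * (t + 1) := by
  have h := ready_before U Φ y t
  rw [RegretsSmall, h.idx2, stateBefore_num_one]
  constructor
  · intro hs i
    rw [← newRegret_eq]
    exact hs i i.2
  · intro hs i hi
    have := hs ⟨i, hi⟩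
    rwa [← newRegret_eq] at this

/-- The learner still cooperates in round `t + 1`. -/
def Cooperates (t : ℕ) : Prop := ∀ s ≤ t, RegretsSmall (stateBefore U Φ y s)

variable {U Φ y}

lemma cooperates_mode {t : ℕ} (h : ∀ s < t, RegretsSmall (stateBefore U Φ y s)) (hm : 0 < m) :
    (stateBefore U Φ y t).idx 4 = 0 ∧ (stateBefore U Φ y t).idx 5 = 0 := by
  induction t with
  | zero => simp [stateBefore_zero, startMem]
  | succ t ih =>
    obtain ⟨i4, i5⟩ := ih fun s hs => h s (by omega)
    have hr := ready_before U Φ y t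
    have hp := preProg_cooperate _ hr.idx8 hr.num21 (by rw [hr.idx0]; exact hm) i4 (h t (by omega))
    have F := stateAfter_frame U Φ y t
    rw [stateBefore_succ_idx]
    exact ⟨(F.idx 4 rfl).trans hp.1, ((F.idx 5 rfl).trans hp.2.1).trans (by rw [i5])⟩

lemma Cooperates.stateAfter_eq {t : ℕ} (h : Cooperates U Φ y t) (hm : 0 < m) :
    stateAfter U Φ y t = run preProg (stateBefore U Φ y t) := by
  obtain ⟨i4, i5⟩ := cooperates_mode (fun s hs => h s hs.le) hm
  have hr := ready_before U Φ y t
  have hp := preProg_cooperate _ hr.idx8 hr.num21 (by rw [hr.idx0]; exact hm) i4 (h t le_rfl)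
  have hq := preProg_spec _ hr.idx8 hr.num21
  rw [stateAfter, blackwellAbort, run_seq, run_ifIdxLe, if_neg (by rw [hp.1, hq.2.1]; omega),
    run_skip]

lemma Cooperates.status {t : ℕ} (h : Cooperates U Φ y t) (hm : 0 < m) :
    (stateAfter U Φ y t).idx 3 = 1 := by
  obtain ⟨i4, i5⟩ := cooperates_mode (fun s hs => h s hs.le) hm
  have hr := ready_before U Φ y t
  rw [h.stateAfter_eq hm]
  exact (preProg_cooperate _ hr.idx8 hr.num21 (by rw [hr.idx0]; exact hm) i4 (h t le_rfl)).2.2.1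

/-- In cooperation the response is a pure action, namely the requested one if there is one. -/
lemma Cooperates.exists_response {t : ℕ} (h : Cooperates U Φ y t) (hm : 0 < m) :
    ∃ act : Fin m, (∀ a, response U Φ y t a = if a = act then 1 else 0) ∧
      ∀ j : Fin m, min ((stateBefore U Φ y t).arr 2 0 0 0) ((stateBefore U Φ y t).arr 2 1 0 0) * m *
        4 * (t + 1) * (t + 1) = (j : ℕ) → act = j := by
  obtain ⟨i4, i5⟩ := cooperates_mode (fun s hs => h s hs.le) hm
  have hr := ready_before U Φ y t
  obtain ⟨-, -, -, act, h1, h2, h3⟩ :=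
    preProg_cooperate _ hr.idx8 hr.num21 (by rw [hr.idx0]; exact hm) i4 (h t le_rfl)
  rw [hr.idx0] at h1 h2 h3
  rw [stateBefore_num_one] at h3
  refine ⟨⟨act, h1⟩, fun a => ?_, fun j hj => ?_⟩
  · rw [response, h.stateAfter_eq hm, h2 a a.2]
    simp [Fin.ext_iff]
  · exact Fin.ext (h3 j j.2 hj)

/-- The vector in the output array is a mixed strategy. -/
def IsMixedResponse (U : Fin k → Fin m → Fin n → ℝ) (Φ : Fin k → CSPSpace m n) (y : ℕ → Mixed n)
    (t : ℕ) : Prop :=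
  response U Φ y t ∈ stdSimplex ℝ (Fin m)

lemma Cooperates.isMixedResponse {t : ℕ} (h : Cooperates U Φ y t) (hm : 0 < m) :
    IsMixedResponse U Φ y t := by
  obtain ⟨act, h1, -⟩ := h.exists_response hm
  refine ⟨fun a => ?_, ?_⟩
  · rw [h1]; split_ifs <;> norm_num
  · simp [h1]

lemma mixedPayoff_abs_le {u : Fin m → Fin n → ℝ} (hu : ∀ a b, |u a b| ≤ 1) {x : Fin m → ℝ}
    (hx : x ∈ stdSimplex ℝ (Fin m)) (z : Mixed n) :
    |∑ a, ∑ b, x a * z.1 b * u a b| ≤ 1 := by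
  have h1 : ∀ a, |∑ b, x a * z.1 b * u a b| ≤ x a := fun a => by
    calc _ ≤ ∑ b, |x a * z.1 b * u a b| := Finset.abs_sum_le_sum_abs _ _
      _ ≤ ∑ b, x a * z.1 b := Finset.sum_le_sum fun b _ => by
          rw [abs_mul, abs_of_nonneg (mul_nonneg (hx.1 a) (z.2.1 b))]
          exact mul_le_of_le_one_right (mul_nonneg (hx.1 a) (z.2.1 b)) (hu a b)
      _ = x a := by rw [← Finset.mul_sum, z.2.2, mul_one]
  calc _ ≤ ∑ a, |∑ b, x a * z.1 b * u a b| := Finset.abs_sum_le_sum_abs _ _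
    _ ≤ ∑ a, x a := Finset.sum_le_sum fun a _ => h1 a
    _ = 1 := hx.2

lemma IsMixedResponse.abs_roundRegret_le {t : ℕ} (h : IsMixedResponse U Φ y t)
    (hU : ∀ i a b, |U i a b| ≤ 1) (hΦ : ∀ i, Φ i ∈ cspSimplex m n) (i : Fin k) :
    |roundRegret U Φ y t i| ≤ 2 := by
  have h1 := abs_le.1 (mixedPayoff_abs_le (hU i) h (y t))
  have h2 := abs_le.1 (abs_cspPayoff_le (hU i) (hΦ i))
  exact abs_le.2 ⟨by rw [roundRegret]; linarith, by rw [roundRegret]; linarith⟩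

/-! ### The Blackwell phase -/

/-- The weight of type `i` after round `t + 1`. -/
def weight (U : Fin k → Fin m → Fin n → ℝ) (Φ : Fin k → CSPSpace m n) (y : ℕ → Mixed n) (t : ℕ)
    (i : Fin k) : ℝ := (stateAfter U Φ y t).arr 4 i 0 0

/-- The state of the program after round `t + 1`, when this is round `q + 1` of epoch `e` of the
Blackwell phase. -/
structure BlackwellState (U : Fin k → Fin m → Fin n → ℝ) (Φ : Fin k → CSPSpace m n)
    (y : ℕ → Mixed n) (t e q : ℕ) : Prop where
  mode : (run preProg (stateBefore U Φ y t)).idx 4 = 1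
  accuracy : (run preProg (stateBefore U Φ y t)).num 0 = (1 / 2) ^ e
  rounds : (run preProg (stateBefore U Φ y t)).idx 6 = logFactor k * 4 ^ e
  attempts : (run preProg (stateBefore U Φ y t)).idx 7 = 16 * m * 4 ^ e
  remaining : (run preProg (stateBefore U Φ y t)).idx 5 + q = logFactor k * 4 ^ e
  weight_pos : ∀ i, 0 < weight U Φ y t i

lemma weight_eq (t : ℕ) (i : Fin k) :
    weight U Φ y t i = (run preProg (stateBefore U Φ y t)).arr 4 i 0 0 := by
  rw [weight, (stateAfter_frame U Φ y t).arr 4 rfl]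

lemma blackwellState_enter {t : ℕ} (hm : 0 < m) (h : ∀ s < t, RegretsSmall (stateBefore U Φ y s))
    (ht : ¬ RegretsSmall (stateBefore U Φ y t)) :
    BlackwellState U Φ y t 1 0 ∧ ∀ i, weight U Φ y t i = 1 := by
  obtain ⟨i4, i5⟩ := cooperates_mode h hm
  have hr := ready_before U Φ y t
  obtain ⟨h1, h2, h3, h4, h5, h6⟩ := preProg_enter _ hr.idx8 hr.num21 i4 i5 ht
  rw [hr.idx2] at h3 h5 h6
  have hw : ∀ i, weight U Φ y t i = 1 := fun i => by rw [weight_eq, h6 i i.2]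
  refine ⟨⟨h1, by rw [h2]; norm_num, by rw [h3, logFactor]; ring, by rw [h4, hr.idx0]; ring,
    by rw [h5, logFactor]; ring, fun i => by rw [hw]; norm_num⟩, hw⟩

/-- The entries of the game of the search for a response are the averages of `u_i(a, b) - u_i(φ_i)`
with respect to the weights of the types. -/
lemma gameValue_eq (t : ℕ) (a : Fin m) (b : Fin n) :
    gameValue (run preProg (stateBefore U Φ y t)) a b =
      (∑ i, weight U Φ y t i * (U i a b - cspPayoff (U i) (Φ i))) / ∑ i, weight U Φ y t i := by
  have hr := ready_before U Φ y t
  have hr' : Ready U Φ (run preProg (stateBefore U Φ y t)) :=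
    hr.of_frame (frame_run preProg _) rfl rfl rfl rfl rfl rfl rfl
  have hp := (preProg_spec _ hr.idx8 hr.num21).1
  rw [gameValue, hr'.idx2, Finset.sum_range, Finset.sum_range]
  refine congrArg₂ (· / ·) ?_ ?_
  · refine Finset.sum_congr rfl fun i _ => ?_
    rw [hr'.arr0, (hp i (by rw [hr.idx2]; exact i.2)).1, hr.targetValue_eq, weight_eq]
  · exact Finset.sum_congr rfl fun i _ => by rw [weight_eq]

/-- The response in the Blackwell phase: either it has value at most `2⁻ᵉ` against every action of
the optimizer, or the program aborts and there is a strategy of the optimizer with positive value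
against every action of the learner. -/
lemma BlackwellState.response_spec {t e q : ℕ} (h : BlackwellState U Φ y t e q) (hm : 0 < m)
    (hk : 0 < k) (hU : ∀ i a b, |U i a b| ≤ 1) (hΦ : ∀ i, Φ i ∈ cspSimplex m n) :
    IsMixedResponse U Φ y t ∧
    (((stateAfter U Φ y t).idx 3 = 1 ∧ ∀ b, ∑ a, response U Φ y t a *
      ∑ i, weight U Φ y t i * (U i a b - cspPayoff (U i) (Φ i)) ≤
        (1 / 2) ^ e * ∑ i, weight U Φ y t i) ∨
    ((stateAfter U Φ y t).idx 3 = 0 ∧ ∃ z : Mixed n, ∀ a,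
      0 < ∑ b, z.1 b * ∑ i, weight U Φ y t i * (U i a b - cspPayoff (U i) (Φ i)))) := by
  have hr := ready_before U Φ y t
  have hr' : Ready U Φ (run preProg (stateBefore U Φ y t)) :=
    hr.of_frame (frame_run preProg _) rfl rfl rfl rfl rfl rfl rfl
  have hp := preProg_spec _ hr.idx8 hr.num21
  have he : stateAfter U Φ y t = run solveProg (run preProg (stateBefore U Φ y t)) := by
    rw [stateAfter, blackwellAbort, run_seq, run_ifIdxLe, if_pos (by rw [h.mode, hp.2.1])]
  have : Nonempty (Fin k) := ⟨⟨0, hk⟩⟩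
  have hW : 0 < ∑ i, weight U Φ y t i :=
    Finset.sum_pos (fun i _ => h.weight_pos i) Finset.univ_nonempty
  have hgv := gameValue_eq (U := U) (Φ := Φ) (y := y) t
  have hbound : ∀ (a : Fin m) (b : Fin n),
      |gameValue (run preProg (stateBefore U Φ y t)) a b| ≤ 2 := fun a b => by
    rw [hgv, abs_div, abs_of_pos hW, div_le_iff₀ hW, Finset.mul_sum]
    refine (Finset.abs_sum_le_sum_abs _ _).trans (Finset.sum_le_sum fun i _ => ?_)
    rw [abs_mul, abs_of_pos (h.weight_pos i), mul_comm]
    refine mul_le_mul_of_nonneg_right ?_ (h.weight_pos i).le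
    have h1 := abs_le.1 (hU i a b)
    have h2 := abs_le.1 (abs_cspPayoff_le (hU i) (hΦ i))
    exact abs_le.2 ⟨by linarith, by linarith⟩
  have key := solveProg_spec (run preProg (stateBefore U Φ y t)) hr'.idx8 hp.2.1 hp.2.2.1
    (by rw [hr'.idx0]; exact hm) (by rw [h.accuracy]; positivity)
    (by rw [h.accuracy]; exact pow_le_one₀ (by norm_num) (by norm_num))
    (fun a ha b hb => by
      rw [hr'.idx0] at ha
      rw [hr'.idx1] at hb
      exact hbound ⟨a, ha⟩ ⟨b, hb⟩)
    (by
      rw [h.attempts, h.accuracy, hr'.idx0]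
      push_cast
      rw [← pow_mul, mul_comm e 2, pow_mul, mul_assoc, ← mul_pow]
      norm_num)
  rw [← he, hr'.idx0, hr'.idx1, h.accuracy, Finset.sum_range] at key
  obtain ⟨⟨k1, k2⟩, k3⟩ := key
  refine ⟨⟨fun a => k1 a a.2, k2⟩, ?_⟩
  rcases k3 with ⟨k3, k4⟩ | ⟨k3, Y, k4, k5, k6⟩
  · refine Or.inl ⟨k3, fun b => ?_⟩
    have := k4 b b.2
    rw [Finset.sum_range] at this
    rw [← div_le_iff₀ hW, Finset.sum_div]
    refine le_trans (le_of_eq (Finset.sum_congr rfl fun a _ => ?_)) this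
    rw [hgv, mul_div_assoc, response]
  · refine Or.inr ⟨k3, ?_⟩
    rw [Finset.sum_range] at k5
    refine ⟨⟨fun b => Y b / ∑ b : Fin n, Y b, fun b => div_nonneg (k4 b) k5.le, ?_⟩, fun a => ?_⟩
    · rw [← Finset.sum_div, div_self k5.ne']
    · have := k6 a a.2
      rw [Finset.sum_range] at this
      have e : ∑ b : Fin n, Y b / (∑ b : Fin n, Y b) *
          ∑ i, weight U Φ y t i * (U i a b - cspPayoff (U i) (Φ i)) =
          (∑ b : Fin n, Y b * gameValue (run preProg (stateBefore U Φ y t)) a b) *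
            ((∑ i, weight U Φ y t i) / ∑ b : Fin n, Y b) := by
        rw [Finset.sum_mul]
        refine Finset.sum_congr rfl fun b _ => ?_
        rw [hgv]
        field_simp
      change 0 < ∑ b : Fin n, Y b / (∑ b : Fin n, Y b) * _
      rw [e]
      exact mul_pos this (div_pos hW k5)

lemma BlackwellState.succ {t e q : ℕ} (h : BlackwellState U Φ y t e q) (hm : 0 < m)
    (hk : 0 < k) (hU : ∀ i a b, |U i a b| ≤ 1) (hΦ : ∀ i, Φ i ∈ cspSimplex m n)
    (hq : q < logFactor k * 4 ^ e) :
    (q + 1 < logFactor k * 4 ^ e → BlackwellState U Φ y (t + 1) e (q + 1) ∧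
      ∀ i, weight U Φ y (t + 1) i =
        weight U Φ y t i * (1 + (1 / 2) ^ e / 4 * roundRegret U Φ y t i)) ∧
    (¬ q + 1 < logFactor k * 4 ^ e → BlackwellState U Φ y (t + 1) (e + 1) 0 ∧
      ∀ i, weight U Φ y (t + 1) i = 1) := by
  have hr := ready_before U Φ y (t + 1)
  have F := stateAfter_frame U Φ y t
  have i4 : (stateBefore U Φ y (t + 1)).idx 4 = 1 := by
    rw [stateBefore_succ_idx, F.idx 4 rfl, h.mode]
  have i5 : (stateBefore U Φ y (t + 1)).idx 5 + q = logFactor k * 4 ^ e := by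
    rw [stateBefore_succ_idx, F.idx 5 rfl, h.remaining]
  have i6 : (stateBefore U Φ y (t + 1)).idx 6 = logFactor k * 4 ^ e := by
    rw [stateBefore_succ_idx, F.idx 6 rfl, h.rounds]
  have i7 : (stateBefore U Φ y (t + 1)).idx 7 = 16 * m * 4 ^ e := by
    rw [stateBefore_succ_idx, F.idx 7 rfl, h.attempts]
  have n0 : (stateBefore U Φ y (t + 1)).num 0 = (1 / 2) ^ e := by
    rw [stateBefore_succ_num, F.num 0 rfl, h.accuracy]
  constructor
  · intro hlt
    obtain ⟨h1, h2, h3, h4, h5, h6⟩ := preProg_continue _ hr.idx8 hr.num21 i4 (by omega)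
    have hw : ∀ i, weight U Φ y (t + 1) i =
        weight U Φ y t i * (1 + (1 / 2) ^ e / 4 * roundRegret U Φ y t i) := fun i => by
      rw [weight_eq, h6 i (by rw [hr.idx2]; exact i.2), newWeight, roundValue_sub_targetValue, n0,
        stateBefore_succ_arr U Φ y t (by norm_num), weight]
    refine ⟨⟨h1, h2.trans n0, h3.trans i6, h4.trans i7, by omega, fun i => ?_⟩, hw⟩
    rw [hw]
    exact mul_pos (h.weight_pos i) (weight_factor_pos e
      ((h.response_spec hm hk hU hΦ).1.abs_roundRegret_le hU hΦ i))
  · intro hge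
    obtain ⟨h1, h2, h3, h4, h5, h6⟩ := preProg_epoch _ hr.idx8 hr.num21 i4 (by omega)
    have hw : ∀ i, weight U Φ y (t + 1) i = 1 := fun i => by
      rw [weight_eq, h6 i (by rw [hr.idx2]; exact i.2)]
    refine ⟨⟨h1, ?_, ?_, ?_, ?_, fun i => by rw [hw]; norm_num⟩, hw⟩
    · rw [h2, n0, pow_succ]; ring
    · rw [h3, i6, pow_succ]; ring
    · rw [h4, i7, pow_succ]; ring
    · rw [h5, i6, pow_succ]; ring

/-- If the Blackwell phase begins in round `σ + 1`, then the epochs and the weights in the rounds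
from `σ + 1` on are those of multiplicative weights with restarts. -/
lemma blackwellState_of_enter {σ : ℕ} (hm : 0 < m) (hk : 0 < k) (hU : ∀ i a b, |U i a b| ≤ 1)
    (hΦ : ∀ i, Φ i ∈ cspSimplex m n)
    (h : ∀ s < σ, RegretsSmall (stateBefore U Φ y s))
    (hσ : ¬ RegretsSmall (stateBefore U Φ y σ)) (v : ℕ) :
    BlackwellState U Φ y (σ + v) (epochPos (logFactor k) v).1 (epochPos (logFactor k) v).2 ∧
    ∀ i, weight U Φ y (σ + (v + 1)) i = if (epochPos (logFactor k) (v + 1)).2 = 0 then 1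
      else weight U Φ y (σ + v) i *
        (1 + (1 / 2) ^ (epochPos (logFactor k) v).1 / 4 * roundRegret U Φ y (σ + v) i) := by
  have hL : 0 < logFactor k := by simp [logFactor]
  have hq := fun v => (epochPos_spec hL v).2.1
  have main : ∀ v, BlackwellState U Φ y (σ + v) (epochPos (logFactor k) v).1
      (epochPos (logFactor k) v).2 := by
    intro v
    induction v with
    | zero => exact (blackwellState_enter hm h hσ).1
    | succ v ih =>
      obtain ⟨h1, h2⟩ := ih.succ hm hk hU hΦ (hq v)
      rw [epochPos]
      split_ifs with hlt
      · exact (h1 hlt).1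
      · exact (h2 hlt).1
  refine ⟨main v, fun i => ?_⟩
  obtain ⟨h1, h2⟩ := (main v).succ hm hk hU hΦ (hq v)
  by_cases hlt : (epochPos (logFactor k) v).2 + 1 < logFactor k * 4 ^ (epochPos (logFactor k) v).1
  · rw [epochPos, if_pos hlt, if_neg (by simp)]
    exact (h1 hlt).2 i
  · rw [epochPos, if_neg hlt, if_pos rfl]
    exact (h2 hlt).2 i

/-- In every round the learner cooperates or is in the Blackwell phase. -/
lemma cooperates_or_blackwellState (hm : 0 < m) (hk : 0 < k) (hU : ∀ i a b, |U i a b| ≤ 1)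
    (hΦ : ∀ i, Φ i ∈ cspSimplex m n) (y : ℕ → Mixed n) (t : ℕ) :
    Cooperates U Φ y t ∨ ∃ v ≤ t,
      BlackwellState U Φ y t (epochPos (logFactor k) v).1 (epochPos (logFactor k) v).2 := by
  classical
  by_cases h : Cooperates U Φ y t
  · exact Or.inl h
  · right
    have hex : ∃ s, ¬ RegretsSmall (stateBefore U Φ y s) := by
      rw [Cooperates] at h
      push Not at h
      exact h.imp fun _ hs => hs.2
    have hle : Nat.find hex ≤ t := by
      rw [Cooperates] at h
      push Not at h
      obtain ⟨s, hs, hs'⟩ := h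
      exact (Nat.find_min' hex hs').trans hs
    have := (blackwellState_of_enter hm hk hU hΦ
      (fun s hs => not_not.1 (Nat.find_min hex hs)) (Nat.find_spec hex) (t - Nat.find hex)).1
    rw [Nat.add_sub_cancel' hle] at this
    exact ⟨_, Nat.sub_le _ _, this⟩

lemma isMixedResponse (hm : 0 < m) (hk : 0 < k) (hU : ∀ i a b, |U i a b| ≤ 1)
    (hΦ : ∀ i, Φ i ∈ cspSimplex m n) (y : ℕ → Mixed n) (t : ℕ) : IsMixedResponse U Φ y t := by
  rcases cooperates_or_blackwellState hm hk hU hΦ y t with h | ⟨v, -, h⟩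
  · exact h.isMixedResponse hm
  · exact (h.response_spec hm hk hU hΦ).1

end Dynamics

/-! ### The algorithm that the program implements -/

section Algorithm

variable {m n k : ℕ}

/-- The state of the program depends on past moves only. -/
lemma stateBefore_congr (U : Fin k → Fin m → Fin n → ℝ) (Φ : Fin k → CSPSpace m n)
    {y y' : ℕ → Mixed n} {t : ℕ} (h : ∀ s < t, y s = y' s) :
    stateBefore U Φ y t = stateBefore U Φ y' t := by
  induction t with
  | zero => rfl
  | succ t ih =>
    rw [stateBefore_succ, stateBefore_succ, stateAfter, stateAfter, ih fun s hs => h s (by omega),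
      h t (by omega)]

open Classical in
/-- The learning algorithm whose answers are those of the program. The moves of the optimizer in
future rounds, on which the answer does not depend, are taken to be `z`; and the condition that the
response is a mixed strategy always holds, see `isMixedResponse`. -/
def blackwellAlg (U : Fin k → Fin m → Fin n → ℝ) (Φ : Fin k → CSPSpace m n) (z : Mixed n) :
    AbortableAlg m n := fun t ys =>
  if h : (stateAfter U Φ (fun s => if h : s < t then ys ⟨s, h⟩ else z) t).idx 3 ≠ 0 ∧
      IsMixedResponse U Φ (fun s => if h : s < t then ys ⟨s, h⟩ else z) t then
    some ⟨response U Φ (fun s => if h : s < t then ys ⟨s, h⟩ else z) t, h.2⟩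
  else none

variable {U : Fin k → Fin m → Fin n → ℝ} {Φ : Fin k → CSPSpace m n} {z : Mixed n}

lemma blackwellAlg_answer (hm : 0 < m) (hk : 0 < k) (hU : ∀ i a b, |U i a b| ≤ 1)
    (hΦ : ∀ i, Φ i ∈ cspSimplex m n) (y : ℕ → Mixed n) (t : ℕ) :
    (blackwellAlg U Φ z).answer y t = if (stateAfter U Φ y t).idx 3 ≠ 0 then
      some ⟨response U Φ y t, isMixedResponse hm hk hU hΦ y t⟩ else none := by
  have e : stateAfter U Φ (fun s => if h : s < t then y s else z) t = stateAfter U Φ y t := by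
    have h : stateBefore U Φ (fun s => if h : s < t then y s else z) t = stateBefore U Φ y t :=
      stateBefore_congr U Φ fun s hs => dif_pos hs
    rw [stateAfter, stateAfter, h]
  have e' : response U Φ (fun s => if h : s < t then y s else z) t = response U Φ y t := by
    funext a
    rw [response, response, e]
  have hm' := isMixedResponse hm hk hU hΦ (fun s => if h : s < t then y s else z) t
  rw [AbortableAlg.answer, blackwellAlg]
  simp only [e, hm', and_true, e']
  split_ifs <;> rfl

lemma answer_eq_some_iff (hm : 0 < m) (hk : 0 < k) (hU : ∀ i a b, |U i a b| ≤ 1)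
    (hΦ : ∀ i, Φ i ∈ cspSimplex m n) {y : ℕ → Mixed n} {t : ℕ} {x : Mixed m} :
    (blackwellAlg U Φ z).answer y t = some x ↔
      (stateAfter U Φ y t).idx 3 ≠ 0 ∧ x.1 = response U Φ y t := by
  rw [blackwellAlg_answer hm hk hU hΦ]
  split_ifs with h
  · simp only [Option.some.injEq, ne_eq, h, not_false_eq_true, true_and]
    rw [Subtype.ext_iff, eq_comm]
  · simp [h]

lemma answer_eq_none_iff (hm : 0 < m) (hk : 0 < k) (hU : ∀ i a b, |U i a b| ≤ 1)
    (hΦ : ∀ i, Φ i ∈ cspSimplex m n) {y : ℕ → Mixed n} {t : ℕ} :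
    (blackwellAlg U Φ z).answer y t = none ↔ (stateAfter U Φ y t).idx 3 = 0 := by
  rw [blackwellAlg_answer hm hk hU hΦ]
  split_ifs with h
  · simpa using h
  · simpa using h

/-! ### The number of steps -/

lemma cost_blackwellAbort_le {B : ℕ} {s : Mem} (h0 : s.idx 0 ≤ B) (h1 : s.idx 1 ≤ B)
    (h2 : s.idx 2 ≤ B)
    (h7 : (run preProg s).idx 9 ≤ (run preProg s).idx 4 → (run preProg s).idx 7 ≤ B) :
    cost blackwellAbort s ≤ (progSize preProg + 1 + progSize solveProg) *
      (B + 1) ^ max (loopDepth preProg) (loopDepth solveProg) := by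
  have F := frame_run preProg s
  have c1 : cost preProg s ≤ progSize preProg * (B + 1) ^ loopDepth preProg := by
    have hr : ∀ r ∈ loopRegs preProg, r = 0 ∨ r = 1 ∨ r = 2 := by decide
    refine cost_le fun r hr' => ?_
    rcases hr r hr' with rfl | rfl | rfl
    · exact ⟨rfl, h0⟩
    · exact ⟨rfl, h1⟩
    · exact ⟨rfl, h2⟩
  have c2 : (run preProg s).idx 9 ≤ (run preProg s).idx 4 →
      cost solveProg (run preProg s) ≤ progSize solveProg * (B + 1) ^ loopDepth solveProg := by
    intro h
    have hr : ∀ r ∈ loopRegs solveProg, r = 0 ∨ r = 1 ∨ r = 2 ∨ r = 7 := by decide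
    refine cost_le fun r hr' => ?_
    rcases hr r hr' with rfl | rfl | rfl | rfl
    · exact ⟨rfl, (F.idx 0 rfl).trans_le h0⟩
    · exact ⟨rfl, (F.idx 1 rfl).trans_le h1⟩
    · exact ⟨rfl, (F.idx 2 rfl).trans_le h2⟩
    · exact ⟨rfl, h7 h⟩
  have hs : cost (.skip) (run preProg s) = 1 := rfl
  have hsz : 1 ≤ progSize solveProg := by decide
  rw [blackwellAbort, cost_seq, cost_ifIdxLe, hs]
  have hB : 1 ≤ B + 1 := by omega
  have e1 := c1.trans (Nat.mul_le_mul_left _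
    (Nat.pow_le_pow_right hB (le_max_left _ (loopDepth solveProg))))
  have e3 : 1 ≤ (B + 1) ^ max (loopDepth preProg) (loopDepth solveProg) := Nat.one_le_pow _ _ hB
  have e2 : (if (run preProg s).idx 9 ≤ (run preProg s).idx 4 then
      cost solveProg (run preProg s) else 1) ≤
      progSize solveProg * (B + 1) ^ max (loopDepth preProg) (loopDepth solveProg) := by
    split_ifs with h
    · exact (c2 h).trans (Nat.mul_le_mul_left _
        (Nat.pow_le_pow_right hB (le_max_right (loopDepth preProg) _)))
    · exact Nat.one_le_iff_ne_zero.2 (by positivity)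
  rw [add_mul, add_mul, one_mul]
  omega

/-- The degree, and at the same time the coefficient, of the polynomial that bounds the number of
steps. -/
def costDegree : ℕ :=
  progSize preProg + 1 + progSize solveProg + 9 * max (loopDepth preProg) (loopDepth solveProg)

/-- The numbers of passes of loops are at most `16 * X * (4 * X) + X`, where `X` is the argument of
the polynomial. -/
lemma loop_bound_le {X : ℕ} (h : 2 ≤ X) : 16 * X * (4 * X) + X + 1 ≤ X ^ 9 := by
  have h7 : 2 ^ 7 ≤ X ^ 7 := Nat.pow_le_pow_left h 7
  have e : X ^ 9 = X ^ 7 * (X * X) := by ring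
  rw [e]
  generalize X ^ 7 = Z at *
  nlinarith [Nat.mul_le_mul_right (X * X) h7]

lemma cost_stateBefore_le (hm : 0 < m) (hk : 0 < k) (hU : ∀ i a b, |U i a b| ≤ 1)
    (hΦ : ∀ i, Φ i ∈ cspSimplex m n) (y : ℕ → Mixed n) (t : ℕ) :
    cost blackwellAbort (stateBefore U Φ y t) ≤
      costDegree * (m + n + k + (t + 1)) ^ costDegree := by
  have hr := ready_before U Φ y t
  have hp := preProg_spec _ hr.idx8 hr.num21
  set X := m + n + k + (t + 1) with hX
  have h2 : 2 ≤ X := by omega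
  have h7 : (run preProg (stateBefore U Φ y t)).idx 9 ≤ (run preProg (stateBefore U Φ y t)).idx 4 →
      (run preProg (stateBefore U Φ y t)).idx 7 ≤ 16 * X * (4 * X) + X := by
    intro h
    rcases cooperates_or_blackwellState hm hk hU hΦ y t with hc | ⟨v, hv, hb⟩
    · obtain ⟨i4, -⟩ := cooperates_mode (fun s hs => hc s hs.le) hm
      have := (preProg_cooperate _ hr.idx8 hr.num21 (by rw [hr.idx0]; exact hm) i4
        (hc t le_rfl)).1
      rw [this, hp.2.1] at h
      omega
    · have h4 := four_pow_epochPos_le (L := logFactor k) (by simp [logFactor]) v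
      rw [hb.attempts]
      have : 16 * m * 4 ^ (epochPos (logFactor k) v).1 ≤ 16 * X * (4 * X) :=
        Nat.mul_le_mul (by omega) (by omega)
      omega
  have hc := cost_blackwellAbort_le (s := stateBefore U Φ y t) (B := 16 * X * (4 * X) + X)
    (by rw [hr.idx0]; omega) (by rw [hr.idx1]; omega) (by rw [hr.idx2]; omega) h7
  have hB := loop_bound_le h2
  refine hc.trans ?_
  have hd : costDegree = progSize preProg + 1 + progSize solveProg +
    9 * max (loopDepth preProg) (loopDepth solveProg) := rfl
  generalize progSize preProg + 1 + progSize solveProg = S at *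
  generalize max (loopDepth preProg) (loopDepth solveProg) = D at *
  refine Nat.mul_le_mul (by omega) ?_
  calc _ ≤ (X ^ 9) ^ D := Nat.pow_le_pow_left hB _
    _ = X ^ (9 * D) := by rw [← pow_mul]
    _ ≤ _ := Nat.pow_le_pow_right (by omega) (by omega)

lemma implements_blackwellAlg (hm : 0 < m) (hk : 0 < k) (hU : ∀ i a b, |U i a b| ≤ 1)
    (hΦ : ∀ i, Φ i ∈ cspSimplex m n) :
    Implements blackwellAbort U Φ (blackwellAlg U Φ z)
      (fun t => costDegree * (m + n + k + t) ^ costDegree) := by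
  intro y t _
  refine ⟨?_, cost_stateBefore_le hm hk hU hΦ y t⟩
  rw [blackwellAlg_answer hm hk hU hΦ]
  change readAnswer m (stateAfter U Φ y t) = _
  rw [readAnswer]
  by_cases h : (stateAfter U Φ y t).idx 3 = 0
  · simp [h]
  · rw [if_neg h, if_pos h]
    rfl

end Algorithm

/-! ### Regret and soundness of aborting -/

section Guarantees

variable {m n k : ℕ} {U : Fin k → Fin m → Fin n → ℝ} {Φ : Fin k → CSPSpace m n}
  {y : ℕ → Mixed n} {z : Mixed n}

/-- The weighted regret against `z` is the average under `z` of the weighted regrets against the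
actions of the optimizer. -/
lemma sum_weight_mul_regret {x : Fin m → ℝ} (hx : x ∈ stdSimplex ℝ (Fin m)) (z : Mixed n)
    (w c : Fin k → ℝ) :
    ∑ i, w i * (∑ a, ∑ b, x a * z.1 b * U i a b - c i) =
      ∑ b, z.1 b * ∑ a, x a * ∑ i, w i * (U i a b - c i) := by
  have h : ∀ i, ∑ a, ∑ b, x a * z.1 b * U i a b - c i =
      ∑ a, ∑ b, x a * z.1 b * (U i a b - c i) := fun i => by
    simp only [mul_sub, Finset.sum_sub_distrib]
    congr 1
    simp only [← Finset.sum_mul, ← Finset.mul_sum]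
    rw [z.2.2]
    simp [hx.2]
  simp only [h, Finset.mul_sum]
  rw [Finset.sum_comm, Finset.sum_comm (γ := Fin n)]
  refine Finset.sum_congr rfl fun a _ => ?_
  rw [Finset.sum_comm]
  exact Finset.sum_congr rfl fun b _ => Finset.sum_congr rfl fun i _ => by ring

lemma one_le_sqrt_logFactor (t : ℕ) : 1 ≤ Real.sqrt (logFactor k * (t + 1)) := by
  rw [Real.one_le_sqrt]
  have h1 : (1 : ℝ) ≤ logFactor k := by exact_mod_cast (show 1 ≤ logFactor k by simp [logFactor])
  have h2 : (1 : ℝ) ≤ (t : ℝ) + 1 := by linarith [Nat.cast_nonneg (α := ℝ) t]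
  nlinarith

/-- The threshold for cooperation was respected at the beginning of the last round: to the square
root of `784 L T` the last round adds at most `2`, and the shift of the computed regret at most
`1`. -/
lemma sum_roundRegret_le_of_small (hU : ∀ i a b, |U i a b| ≤ 1)
    (hΦ : ∀ i, Φ i ∈ cspSimplex m n) (hm : 0 < m) (hk : 0 < k) {t : ℕ}
    (h : ∀ s < t, RegretsSmall (stateBefore U Φ y s)) (i : Fin k) :
    ∑ s ∈ Finset.range t, roundRegret U Φ y s i ≤ 31 * Real.sqrt (logFactor k * t) := by
  cases t with
  | zero => simp
  | succ t =>
    have h1 := (regretsSmall_iff U Φ y t).1 (h t (by omega)) i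
    have h2 := (abs_le.1 ((isMixedResponse hm hk hU hΦ y t).abs_roundRegret_le hU hΦ i)).2
    have h3 := (abs_le.1 (abs_cspPayoff_le (hU i) (hΦ i))).2
    have h4 := one_le_sqrt_logFactor (k := k) t
    rw [Finset.sum_range_succ]
    push_cast
    have h5 : ∑ s ∈ Finset.range t, roundRegret U Φ y s i - cspPayoff (U i) (Φ i) ≤
        28 * Real.sqrt (logFactor k * (t + 1)) := by
      rcases h1 with h1 | h1
      · linarith
      · rw [show (28 : ℝ) = Real.sqrt 784 by
          rw [show (784 : ℝ) = 28 ^ 2 by norm_num]; simp, ← Real.sqrt_mul (by norm_num),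
          ← mul_assoc]
        exact Real.le_sqrt_of_sq_le h1
    linarith

/-- The regret before the Blackwell phase is at most `31 √(L τ)`, and in the Blackwell phase it is
at most `24 √(L τ)` by `sum_gain_le`. -/
lemma sum_roundRegret_le (hU : ∀ i a b, |U i a b| ≤ 1)
    (hΦ : ∀ i, Φ i ∈ cspSimplex m n) (hm : 0 < m) (hk : 0 < k) {τ : ℕ}
    (hτ : ∀ t < τ, (stateAfter U Φ y t).idx 3 ≠ 0) (i : Fin k) :
    ∑ t ∈ Finset.range τ, roundRegret U Φ y t i ≤ 55 * Real.sqrt (logFactor k * τ) := by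
  classical
  have hL : 0 < logFactor k := by simp [logFactor]
  have hs := Real.sqrt_nonneg (logFactor k * τ : ℝ)
  by_cases h : ∀ s < τ, RegretsSmall (stateBefore U Φ y s)
  · have := sum_roundRegret_le_of_small hU hΦ hm hk h i
    linarith
  · push Not at h
    have hex : ∃ s, ¬ RegretsSmall (stateBefore U Φ y s) := h.imp fun _ hs => hs.2
    have hle : Nat.find hex ≤ τ := by
      obtain ⟨s, hs, hs'⟩ := h
      exact (Nat.find_min' hex hs').trans hs.le
    have hlt : ∀ s < Nat.find hex, RegretsSmall (stateBefore U Φ y s) := fun s hs =>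
      not_not.1 (Nat.find_min hex hs)
    have hns := Nat.find_spec hex
    generalize Nat.find hex = σ at hle hlt hns
    obtain ⟨v, rfl⟩ := Nat.exists_eq_add_of_le hle
    have hB := blackwellState_of_enter hm hk hU hΦ hlt hns
    have h1 := sum_roundRegret_le_of_small hU hΦ hm hk hlt i
    have h2 := sum_gain_le hL (c := fun _ : Fin k => 1) (fun _ => one_pos)
      (r := fun v => roundRegret U Φ y (σ + v)) (w := fun v => weight U Φ y (σ + v))
      (fun v i => (isMixedResponse hm hk hU hΦ y _).abs_roundRegret_le hU hΦ i)
      (blackwellState_enter hm hlt hns).2 (fun v i => (hB v).2 i) (τ := v) (fun u hu => by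
        obtain ⟨hx, hv | hv⟩ := (hB u).1.response_spec hm hk hU hΦ
        · simp only [roundRegret]
          rw [sum_weight_mul_regret hx]
          calc _ ≤ ∑ b, (y (σ + u)).1 b * ((1 / 2) ^ (epochPos (logFactor k) u).1 *
                ∑ i, weight U Φ y (σ + u) i) :=
                Finset.sum_le_sum fun b _ => mul_le_mul_of_nonneg_left (hv.2 b) ((y _).2.1 b)
            _ = _ := by rw [← Finset.sum_mul, (y (σ + u)).2.2, one_mul]
        · exact (hτ _ (by omega) hv.1).elim) (j := i) (D := logFactor k) (by positivity) (by
        simp only [Finset.sum_const, Finset.card_univ, Fintype.card_fin, nsmul_eq_mul, mul_one,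
          one_mul]
        have e1 : (k : ℝ) ≤ 2 ^ logFactor k := by
          have : k ≤ 2 ^ logFactor k := (Nat.le_pow_clog (by norm_num) k).trans
            (Nat.pow_le_pow_right (by norm_num) (by simp [logFactor]))
          exact_mod_cast this
        refine e1.trans ?_
        rw [← Real.exp_one_pow]
        exact pow_le_pow_left₀ (by norm_num) (by linarith [Real.exp_one_gt_d9]) _)
    rw [div_self (by exact_mod_cast hL.ne'), show (16 * 1 + 8 : ℝ) = 24 by norm_num] at h2
    have m1 : Real.sqrt (logFactor k * σ) ≤ Real.sqrt (logFactor k * (σ + v : ℕ)) := by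
      apply Real.sqrt_le_sqrt
      gcongr
    have m2 : Real.sqrt (logFactor k * v) ≤ Real.sqrt (logFactor k * (σ + v : ℕ)) := by
      apply Real.sqrt_le_sqrt
      gcongr
      omega
    rw [Finset.sum_range_add]
    linarith

lemma logFactor_le_log (hk : 0 < k) : (logFactor k : ℝ) ≤ 5 * Real.log (max k 2) := by
  have h2 : (1 / 2 : ℝ) ≤ Real.log 2 := by linarith [Real.log_two_gt_d9]
  rcases Nat.lt_or_ge k 2 with h | h
  · obtain rfl : k = 1 := by omega
    have : logFactor 1 = 1 := by simp [logFactor]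
    rw [this]
    norm_num
    linarith
  · have hk2 : (2 : ℝ) ≤ k := by exact_mod_cast h
    rw [max_eq_left hk2]
    have h3 : 2 ^ (Nat.clog 2 k - 1) < k := Nat.pow_pred_clog_lt_self (by norm_num) h
    have h4 : ((2 : ℝ) ^ (Nat.clog 2 k - 1)) ≤ k := by exact_mod_cast h3.le
    have h5 := Real.log_le_log (by positivity) h4
    rw [Real.log_pow] at h5
    have h6 : Real.log 2 ≤ Real.log k := Real.log_le_log (by norm_num) hk2
    have h7 : (Nat.clog 2 k : ℝ) ≤ (Nat.clog 2 k - 1 : ℕ) + 1 := by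
      exact_mod_cast (show Nat.clog 2 k ≤ (Nat.clog 2 k - 1) + 1 by omega)
    have h8 : (0.69 : ℝ) ≤ Real.log 2 := by linarith [Real.log_two_gt_d9]
    rw [logFactor]
    push_cast
    have h9 := mul_le_mul_of_nonneg_left h8 (Nat.cast_nonneg (α := ℝ) (Nat.clog 2 k - 1))
    linarith

lemma mixedPayoff_sub_eq_roundRegret (hU : ∀ i a b, |U i a b| ≤ 1)
    (hΦ : ∀ i, Φ i ∈ cspSimplex m n) (hm : 0 < m) (hk : 0 < k) {τ : ℕ} {x : ℕ → Mixed m}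
    (h : (blackwellAlg U Φ z).IsTranscript τ x y) {t : ℕ} (ht : t < τ) (i : Fin k) :
    mixedPayoff (U i) (x t) (y t) - cspPayoff (U i) (Φ i) = roundRegret U Φ y t i := by
  rw [mixedPayoff, ((answer_eq_some_iff hm hk hU hΦ).1 (h t ht)).2, roundRegret]

/-- The regret bound of the algorithm. -/
lemma regret_le (hU : ∀ i a b, |U i a b| ≤ 1)
    (hΦ : ∀ i, Φ i ∈ cspSimplex m n) (hm : 0 < m) (hk : 0 < k) {τ : ℕ} {x : ℕ → Mixed m}
    (h : (blackwellAlg U Φ z).IsTranscript τ x y) (i : Fin k) :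
    ∑ t ∈ Finset.range τ, (mixedPayoff (U i) (x t) (y t) - cspPayoff (U i) (Φ i)) ≤
      55 * Real.sqrt (logFactor k * τ) := by
  rw [Finset.sum_congr rfl fun t ht =>
    mixedPayoff_sub_eq_roundRegret hU hΦ hm hk h (Finset.mem_range.1 ht) i]
  exact sum_roundRegret_le hU hΦ hm hk
    (fun t ht => ((answer_eq_some_iff hm hk hU hΦ).1 (h t ht)).1) i

lemma cspPayoff_outer (u : Fin m → Fin n → ℝ) (x : Mixed m) (z : Mixed n) :
    cspPayoff u (outer x z) = ∑ a, ∑ b, x.1 a * z.1 b * u a b := rfl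

/-- When the algorithm aborts, the strategy found by the search gives the optimizer a positive
weighted regret against every response, so that no response can keep the regrets of all types
nonpositive. -/
lemma not_responseSatisfiable (hU : ∀ i a b, |U i a b| ≤ 1)
    (hΦ : ∀ i, Φ i ∈ cspSimplex m n) (hm : 0 < m) (hk : 0 < k)
    (h : (blackwellAlg U Φ z).MayAbort) :
    ¬ ResponseSatisfiable outer (candidateMenu U Φ) := by
  obtain ⟨T, x, y, -, h⟩ := h
  rw [answer_eq_none_iff hm hk hU hΦ] at h
  rcases cooperates_or_blackwellState hm hk hU hΦ y T with hc | ⟨v, -, hb⟩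
  · rw [hc.status hm] at h
    omega
  · obtain ⟨-, ⟨h1, -⟩ | ⟨-, q, hq⟩⟩ := hb.response_spec hm hk hU hΦ
    · omega
    · intro hsat
      obtain ⟨x, hx⟩ := hsat q
      have h1 : ∑ i, weight U Φ y T i * (∑ a, ∑ b, x.1 a * q.1 b * U i a b -
          cspPayoff (U i) (Φ i)) ≤ 0 := by
        refine Finset.sum_nonpos fun i _ => mul_nonpos_of_nonneg_of_nonpos (hb.weight_pos i).le ?_
        rw [← cspPayoff_outer]
        linarith [hx.2 i]
      rw [sum_weight_mul_regret x.2] at h1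
      have h2 : ∑ b, q.1 b * ∑ a, x.1 a * ∑ i, weight U Φ y T i * (U i a b - cspPayoff (U i) (Φ i))
          = ∑ a, x.1 a * ∑ b, q.1 b *
            ∑ i, weight U Φ y T i * (U i a b - cspPayoff (U i) (Φ i)) := by
        simp only [Finset.mul_sum]
        rw [Finset.sum_comm]
        exact Finset.sum_congr rfl fun a _ => Finset.sum_congr rfl fun b _ =>
          Finset.sum_congr rfl fun i _ => by ring
      rw [h2] at h1
      have h3 : ∃ a, 0 < x.1 a := by
        by_contra hall
        push Not at hall
        have := Finset.sum_nonpos fun a (_ : a ∈ Finset.univ) => hall a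
        rw [x.2.2] at this
        linarith
      obtain ⟨a, ha⟩ := h3
      have h4 := Finset.sum_pos' (s := Finset.univ) (fun a _ => mul_nonneg (x.2.1 a) (hq a).le)
        ⟨a, Finset.mem_univ _, mul_pos ha (hq a)⟩
      linarith

end Guarantees

/-! ### Cooperative play -/

section Play

variable {m n k : ℕ} {U : Fin k → Fin m → Fin n → ℝ} {Φ : Fin k → CSPSpace m n}
  {y : ℕ → Mixed n} {z : Mixed n}

/-- The move of the optimizer that consists of the pure action `b`, perturbed so that the smaller
one of the first two probabilities is `v`. -/
def signal (hn : 2 ≤ n) (b : Fin n) (v : ℝ) (h0 : 0 ≤ v) (h1 : 2 * v ≤ 1) : Mixed n :=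
  ⟨fun c => (1 - 2 * v) * (if c = b then 1 else 0) + (v * (if c = ⟨0, by omega⟩ then 1 else 0) +
    v * (if c = ⟨1, by omega⟩ then 1 else 0)), by
    refine ⟨fun c => ?_, ?_⟩
    · have : 0 ≤ 1 - 2 * v := by linarith
      positivity
    · simp only [Finset.sum_add_distrib, ← Finset.mul_sum, Finset.sum_ite_eq', Finset.mem_univ,
        if_true]
      ring⟩

lemma signal_min (hn : 2 ≤ n) (b : Fin n) (v : ℝ) (h0 : 0 ≤ v) (h1 : 2 * v ≤ 1) :
    min ((signal hn b v h0 h1).1 ⟨0, by omega⟩) ((signal hn b v h0 h1).1 ⟨1, by omega⟩) = v := by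
  have e : ∀ c, (signal hn b v h0 h1).1 c = (1 - 2 * v) * (if c = b then 1 else 0) +
    (v * (if c = ⟨0, by omega⟩ then 1 else 0) + v * (if c = ⟨1, by omega⟩ then 1 else 0)) :=
    fun _ => rfl
  rw [e, e]
  by_cases hb : (⟨0, by omega⟩ : Fin n) = b
  · subst hb
    simp
    linarith
  · simp [hb]
    split_ifs <;> linarith

lemma signal_sum (hn : 2 ≤ n) (b : Fin n) (v : ℝ) (h0 : 0 ≤ v) (h1 : 2 * v ≤ 1) {u : Fin n → ℝ}
    (hu : ∀ c, |u c| ≤ 1) : |∑ c, (signal hn b v h0 h1).1 c * u c - u b| ≤ 4 * v := by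
  have e : ∑ c, (signal hn b v h0 h1).1 c * u c =
      (1 - 2 * v) * u b + (v * u ⟨0, by omega⟩ + v * u ⟨1, by omega⟩) := by
    simp only [signal, add_mul, mul_assoc, Finset.sum_add_distrib, ← Finset.mul_sum, ite_mul,
      one_mul, zero_mul, Finset.sum_ite_eq', Finset.mem_univ, if_true]
  rw [e]
  have hb := abs_le.1 (hu b)
  have hc := abs_le.1 (hu ⟨0, by omega⟩)
  have hd := abs_le.1 (hu ⟨1, by omega⟩)
  exact abs_le.2 ⟨by nlinarith, by nlinarith⟩

/-- The size of the perturbation that encodes action `a` of the learner in the move of round `t +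
1`. In the next round, number `t + 2`, it is multiplied by `4 m (t + 2) ^ 2` to recover `a`. -/
def signalSize (m t a : ℕ) : ℝ := a / (4 * m * (t + 2) ^ 2)

lemma signalSize_nonneg (m t a : ℕ) : 0 ≤ signalSize m t a := by
  rw [signalSize]; positivity

/-- The perturbations are dominated by a telescoping series. -/
lemma signalSize_le {m a : ℕ} (t : ℕ) (h : a < m) :
    4 * signalSize m t a ≤ 1 / (t + 1) - 1 / (t + 2) := by
  have hm : (0 : ℝ) < m := by exact_mod_cast (show 0 < m by omega)
  have ha : (a : ℝ) ≤ m := by exact_mod_cast h.le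
  have e : 4 * signalSize m t a = (a / m) * (1 / (t + 2) ^ 2) := by
    rw [signalSize]; field_simp
  have h1 : (a : ℝ) / m ≤ 1 := (div_le_one hm).2 ha
  have h2 : (1 : ℝ) / (t + 2) ^ 2 ≤ 1 / (t + 1) - 1 / (t + 2) := by
    rw [div_sub_div _ _ (by positivity) (by positivity), div_le_div_iff₀ (by positivity)
      (by positivity)]
    nlinarith
  rw [e]
  calc (a : ℝ) / m * (1 / (t + 2) ^ 2) ≤ 1 * (1 / (t + 2) ^ 2) :=
        mul_le_mul_of_nonneg_right h1 (by positivity)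
    _ ≤ _ := by linarith

lemma two_mul_signalSize_le {m a : ℕ} (t : ℕ) (h : a < m) : 2 * signalSize m t a ≤ 1 := by
  have h1 := signalSize_le t h
  have h2 := signalSize_nonneg m t a
  have h3 : (1 : ℝ) / (t + 1) ≤ 1 := by
    rw [div_le_one (by positivity)]
    linarith [Nat.cast_nonneg (α := ℝ) t]
  have h4 : (0 : ℝ) ≤ 1 / (t + 2) := by positivity
  linarith

/-- The moves by which the optimizer makes the pairs of actions `g 1, g 2, …` be played from the
second round on. -/
def requestMoves (hn : 2 ≤ n) (g : ℕ → Fin m × Fin n) (t : ℕ) : Mixed n :=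
  signal hn (g t).2 (signalSize m t (g (t + 1)).1) (signalSize_nonneg _ _ _)
    (two_mul_signalSize_le t (g (t + 1)).1.2)

lemma requested_response (hm : 0 < m) (hn : 2 ≤ n) (g : ℕ → Fin m × Fin n) {t : ℕ}
    (h : Cooperates U Φ (requestMoves hn g) (t + 1)) (a : Fin m) :
    response U Φ (requestMoves hn g) (t + 1) a = if a = (g (t + 1)).1 then 1 else 0 := by
  obtain ⟨act, h1, h2⟩ := h.exists_response hm
  have hm' : (0 : ℝ) < m := by exact_mod_cast hm
  have e0 := stateBefore_succ_move U Φ (requestMoves hn g) t ⟨0, by omega⟩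
  have e1 := stateBefore_succ_move U Φ (requestMoves hn g) t ⟨1, by omega⟩
  simp only at e0 e1
  rw [h1, h2 (g (t + 1)).1]
  rw [e0, e1, requestMoves, signal_min, signalSize]
  push_cast
  field_simp
  ring

/-- A bound on the difference between the play of `g t` and the actual play in round `t + 1`: in the
first round the action of the learner is not under control, and in the other rounds the move of the
optimizer is perturbed. -/
def playError (t : ℕ) : ℝ := (1 / (t + 1) - 1 / (t + 2)) + if t = 0 then 2 else 0

lemma sum_playError_le (T : ℕ) : ∑ t ∈ Finset.range T, playError t ≤ 3 := by
  have h1 : ∀ T : ℕ, ∑ t ∈ Finset.range T, ((1 : ℝ) / (t + 1) - 1 / (t + 2)) = 1 - 1 / (T + 1) := by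
    intro T
    induction T with
    | zero => simp
    | succ T ih =>
      rw [Finset.sum_range_succ, ih]
      push_cast
      ring
  have h2 : ∑ t ∈ Finset.range T, (if t = 0 then (2 : ℝ) else 0) ≤ 2 := by
    rw [Finset.sum_ite_eq']
    split_ifs <;> norm_num
  have h3 : (0 : ℝ) ≤ 1 / (T + 1) := by positivity
  simp only [playError]
  rw [Finset.sum_add_distrib, h1]
  linarith

lemma requested_payoff (hm : 0 < m) (hn : 2 ≤ n) (g : ℕ → Fin m × Fin n) {t : ℕ}
    (h : Cooperates U Φ (requestMoves hn g) t) {u : Fin m → Fin n → ℝ} (hu : ∀ a b, |u a b| ≤ 1) :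
    |∑ a, ∑ b, response U Φ (requestMoves hn g) t a * (requestMoves hn g t).1 b * u a b -
      u (g t).1 (g t).2| ≤ playError t := by
  have hpos : (0 : ℝ) ≤ 1 / (t + 1) - 1 / (t + 2) :=
    le_trans (by have := signalSize_nonneg m t 0; linarith) (signalSize_le t hm)
  cases t with
  | zero =>
    have h1 := abs_le.1 (mixedPayoff_abs_le hu (h.isMixedResponse hm) (requestMoves hn g 0))
    have h2 := abs_le.1 (hu (g 0).1 (g 0).2)
    have h3 : (2 : ℝ) ≤ playError 0 := by
      rw [playError, if_pos rfl]
      linarith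
    exact abs_le.2 ⟨by linarith, by linarith⟩
  | succ t =>
    have e : ∑ a, ∑ b, response U Φ (requestMoves hn g) (t + 1) a *
        (requestMoves hn g (t + 1)).1 b * u a b =
        ∑ b, (requestMoves hn g (t + 1)).1 b * u (g (t + 1)).1 b := by
      rw [Finset.sum_eq_single (g (t + 1)).1]
      · refine Finset.sum_congr rfl fun b _ => ?_
        rw [requested_response hm hn g h]
        simp
      · intro a _ ha
        simp [requested_response hm hn g h, ha]
      · simp
    rw [e, requestMoves]
    refine (signal_sum hn _ _ _ _ (hu _)).trans ((signalSize_le (t + 1) (g _).1.2).trans ?_)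
    simp [playError]

/-- If the requested play has small regrets, then the regrets stay below the threshold and the
learner always cooperates: `24 + 3 + 1 = 28` for the requested play, the errors, and the shift of
the computed regret. -/
lemma cooperates_requestMoves (hm : 0 < m) (hn : 2 ≤ n)
    (hU : ∀ i a b, |U i a b| ≤ 1) (hΦ : ∀ i, Φ i ∈ cspSimplex m n) {g : ℕ → Fin m × Fin n}
    (hg : ∀ τ i, ∑ t ∈ Finset.range τ, (U i (g t).1 (g t).2 - cspPayoff (U i) (Φ i)) ≤
      24 * Real.sqrt (logFactor k * τ)) (t : ℕ) :
    Cooperates U Φ (requestMoves hn g) t := by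
  suffices h : ∀ t, RegretsSmall (stateBefore U Φ (requestMoves hn g) t) from fun s _ => h s
  intro t
  induction t using Nat.strong_induction_on with
  | _ t ih =>
    rw [regretsSmall_iff]
    intro i
    by_cases hneg : ∑ s ∈ Finset.range t, roundRegret U Φ (requestMoves hn g) s i -
        cspPayoff (U i) (Φ i) ≤ 0
    · exact Or.inl hneg
    · right
      have h1 : ∑ s ∈ Finset.range t, roundRegret U Φ (requestMoves hn g) s i ≤
          ∑ s ∈ Finset.range t, (U i (g s).1 (g s).2 - cspPayoff (U i) (Φ i)) +
            ∑ s ∈ Finset.range t, playError s := by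
        rw [← Finset.sum_add_distrib]
        refine Finset.sum_le_sum fun s hs => ?_
        have hc : Cooperates U Φ (requestMoves hn g) s := fun r hr =>
          ih r (by have := Finset.mem_range.1 hs; omega)
        have := (abs_le.1 (requested_payoff hm hn g hc (hU i))).2
        rw [roundRegret]
        linarith
      have h2 := hg t i
      have h3 := sum_playError_le t
      have h4 := (abs_le.1 (abs_cspPayoff_le (hU i) (hΦ i))).1
      have h5 := one_le_sqrt_logFactor (k := k) t
      have h6 : Real.sqrt (logFactor k * t) ≤ Real.sqrt (logFactor k * (t + 1)) := by
        apply Real.sqrt_le_sqrt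
        gcongr
        linarith
      have h7 : ∑ s ∈ Finset.range t, roundRegret U Φ (requestMoves hn g) s i -
          cspPayoff (U i) (Φ i) ≤ 28 * Real.sqrt (logFactor k * (t + 1)) := by linarith
      push Not at hneg
      have h8 := pow_le_pow_left₀ hneg.le h7 2
      rw [mul_pow, Real.sq_sqrt (by positivity)] at h8
      linarith

lemma norm_le_of_abs_le {ι : Type*} [Fintype ι] {v : EuclideanSpace ℝ ι} {δ : ℝ}
    (h : ∀ p, |v p| ≤ δ) (hδ : 0 ≤ δ) : ‖v‖ ≤ Fintype.card ι * δ := by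
  rw [EuclideanSpace.norm_eq]
  apply Real.sqrt_le_iff.2
  refine ⟨by positivity, ?_⟩
  have h1 : ∑ p, ‖v p‖ ^ 2 ≤ ∑ _p : ι, δ ^ 2 :=
    Finset.sum_le_sum fun p _ => pow_le_pow_left₀ (norm_nonneg _) (h p) 2
  simp only [Finset.sum_const, Finset.card_univ, nsmul_eq_mul] at h1
  have h2 : (Fintype.card ι : ℝ) ≤ (Fintype.card ι : ℝ) ^ 2 := by
    exact_mod_cast Nat.le_self_pow (by norm_num) _
  rw [mul_pow]
  exact h1.trans (mul_le_mul_of_nonneg_right h2 (by positivity))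

lemma avgCSP_apply (T : ℕ) (x : ℕ → Mixed m) (y : ℕ → Mixed n) (p : Fin m × Fin n) :
    avgCSP T x y p = (T : ℝ)⁻¹ * ∑ t ∈ Finset.range T, (x t).1 p.1 * (y t).1 p.2 := by
  simp [avgCSP, outer, WithLp.ofLp_sum, Finset.sum_apply]

/-- Every point of the candidate menu is the limit of the average profiles of a play in which the
algorithm never aborts, at a rate that does not depend on the point. -/
theorem exists_play (hm : 0 < m) (hk : 0 < k) (hn : 2 ≤ n)
    (hU : ∀ i a b, |U i a b| ≤ 1) (hΦ : ∀ i, Φ i ∈ cspSimplex m n) (z : Mixed n) :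
    ∃ K : ℝ, ∀ φ ∈ candidateMenu U Φ, ∃ (x : ℕ → Mixed m) (y : ℕ → Mixed n),
      (∀ T, (blackwellAlg U Φ z).IsTranscript T x y) ∧
      ∀ T, 0 < T → dist (avgCSP T x y) φ ≤ K * (Real.sqrt (logFactor k * T) / T) := by
  classical
  have hL : 0 < logFactor k := by simp [logFactor]
  have hkL : k + 1 ≤ 2 ^ logFactor k := by
    have h1 : k ≤ 2 ^ Nat.clog 2 k := Nat.le_pow_clog (by norm_num) k
    have h2 : 2 ^ logFactor k = 2 * 2 ^ Nat.clog 2 k := by rw [logFactor, pow_add]; ring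
    have h3 : 0 < 2 ^ Nat.clog 2 k := by positivity
    omega
  set B : ℝ := 16 * Real.log ((k + 1) * (2 * (m * n))) + 8 with hB
  refine ⟨(m * n) * (B + 3), fun φ hφ => ?_⟩
  obtain ⟨g, hg1, hg2⟩ := exists_steering hk hL hkL hU hΦ hφ
  have hc := cooperates_requestMoves hm hn hU hΦ hg1
  refine ⟨fun t => ⟨response U Φ (requestMoves hn g) t, isMixedResponse hm hk hU hΦ _ t⟩,
    requestMoves hn g, fun T t _ => ?_, fun T hT => ?_⟩
  · rw [answer_eq_some_iff hm hk hU hΦ]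
    exact ⟨by rw [(hc t).status hm]; norm_num, rfl⟩
  · have hT' : (0 : ℝ) < T := by exact_mod_cast hT
    have hs1 : 1 ≤ Real.sqrt (logFactor k * T) := by
      obtain ⟨t, rfl⟩ : ∃ t, T = t + 1 := ⟨T - 1, by omega⟩
      have := one_le_sqrt_logFactor (k := k) t
      push_cast
      exact this
    have hB0 : 0 ≤ B := by
      have : (0 : ℝ) ≤ Real.log ((k + 1) * (2 * (m * n))) := by
        apply Real.log_nonneg
        have h1 : (1 : ℝ) ≤ m := by exact_mod_cast hm
        have h2 : (1 : ℝ) ≤ n := by exact_mod_cast (show 1 ≤ n by omega)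
        have h3 : (1 : ℝ) ≤ m * n := one_le_mul_of_one_le_of_one_le h1 h2
        nlinarith [Nat.cast_nonneg (α := ℝ) k]
      positivity
    rw [dist_eq_norm]
    have key := norm_le_of_abs_le (v := avgCSP T (fun t => ⟨response U Φ (requestMoves hn g) t,
      isMixedResponse hm hk hU hΦ _ t⟩) (requestMoves hn g) - φ)
      (δ := (B + 3) * (Real.sqrt (logFactor k * T) / T)) (fun p => ?_) (by positivity)
    · simp only [Fintype.card_prod, Fintype.card_fin] at key
      push_cast at key
      rwa [mul_assoc]
    · rw [PiLp.sub_apply, avgCSP_apply]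
      simp only
      have e : (T : ℝ)⁻¹ * ∑ t ∈ Finset.range T, response U Φ (requestMoves hn g) t p.1 *
          (requestMoves hn g t).1 p.2 - φ p = (∑ t ∈ Finset.range T,
            (response U Φ (requestMoves hn g) t p.1 * (requestMoves hn g t).1 p.2 -
              (if g t = p then 1 else 0)) +
            ∑ t ∈ Finset.range T, ((if g t = p then 1 else 0) - φ p)) / T := by
        rw [← Finset.sum_add_distrib]
        simp only [sub_add_sub_cancel, Finset.sum_sub_distrib, Finset.sum_const, Finset.card_range,
          nsmul_eq_mul]
        field_simp
      have h1 : |∑ t ∈ Finset.range T,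
            (response U Φ (requestMoves hn g) t p.1 * (requestMoves hn g t).1 p.2 -
              (if g t = p then 1 else 0))| ≤ 3 := by
        refine (Finset.abs_sum_le_sum_abs _ _).trans
          ((Finset.sum_le_sum fun t _ => ?_).trans (sum_playError_le T))
        have := requested_payoff hm hn g (hc t) (u := fun a b => if (a, b) = p then 1 else 0)
          (fun a b => by split_ifs <;> norm_num)
        have e2 : ∑ a, ∑ b, response U Φ (requestMoves hn g) t a * (requestMoves hn g t).1 b *
            (if (a, b) = p then 1 else 0) =
            response U Φ (requestMoves hn g) t p.1 * (requestMoves hn g t).1 p.2 := by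
          rw [Finset.sum_eq_single p.1]
          · rw [Finset.sum_eq_single p.2]
            · simp
            · intro b _ hb
              rw [if_neg (fun h => hb (by rw [← h])), mul_zero]
            · simp
          · intro a _ ha
            refine Finset.sum_eq_zero fun b _ => ?_
            rw [if_neg (fun h => ha (by rw [← h])), mul_zero]
          · simp
        rw [e2] at this
        exact this
      have h2 := hg2 T p
      rw [e, abs_div, abs_of_pos hT', div_le_iff₀ hT']
      calc _ ≤ _ := abs_add_le _ _
        _ ≤ 3 + B * Real.sqrt (logFactor k * T) := add_le_add h1 h2
        _ ≤ (B + 3) * Real.sqrt (logFactor k * T) := by nlinarith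
        _ = _ := by field_simp

end Play

/-! ### The menu -/

section Menu

variable {m n k : ℕ} {U : Fin k → Fin m → Fin n → ℝ} {Φ : Fin k → CSPSpace m n} {z : Mixed n}

lemma continuous_cspPayoff (u : Fin m → Fin n → ℝ) : Continuous (cspPayoff u) := by
  unfold cspPayoff
  fun_prop

lemma cspPayoff_add_smul (u : Fin m → Fin n → ℝ) (α β : ℝ) (φ ψ : CSPSpace m n) :
    cspPayoff u (α • φ + β • ψ) = α * cspPayoff u φ + β * cspPayoff u ψ := by
  simp only [cspPayoff_eq_sum, Finset.mul_sum, ← Finset.sum_add_distrib, PiLp.add_apply,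
    PiLp.smul_apply, smul_eq_mul]
  exact Finset.sum_congr rfl fun p _ => by ring

lemma isCompact_cspSimplex (m n : ℕ) : IsCompact (cspSimplex m n) := by
  have h := (isCompact_stdSimplex ℝ (Fin m × Fin n)).image (PiLp.continuous_toLp 2 _)
  convert h using 1
  ext φ
  constructor
  · intro hφ
    exact ⟨φ.ofLp, hφ, rfl⟩
  · rintro ⟨v, hv, rfl⟩
    exact hv

lemma isClosed_candidateMenu (U : Fin k → Fin m → Fin n → ℝ) (Φ : Fin k → CSPSpace m n) :
    IsClosed (candidateMenu U Φ) := by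
  have : candidateMenu U Φ = cspSimplex m n ∩
      ⋂ i, {φ | cspPayoff (U i) φ ≤ cspPayoff (U i) (Φ i)} := by
    ext φ
    simp [candidateMenu]
  rw [this]
  exact (isCompact_cspSimplex m n).isClosed.inter
    (isClosed_iInter fun i => isClosed_le (continuous_cspPayoff _) continuous_const)

/-- Profiles that violate the constraints of the candidate menu only slightly are close to the
candidate menu. -/
lemma exists_slack {ε : ℝ} (hε : 0 < ε) :
    ∃ δ > 0, ∀ φ ∈ cspSimplex m n, (∀ i, cspPayoff (U i) φ ≤ cspPayoff (U i) (Φ i) + δ) →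
      Metric.infDist φ (candidateMenu U Φ) < ε := by
  set f : CSPSpace m n → ℝ := fun φ => ∑ i, max 0 (cspPayoff (U i) φ - cspPayoff (U i) (Φ i))
    with hf
  have hfc : Continuous f := continuous_finsetSum _ fun i _ =>
    continuous_const.max ((continuous_cspPayoff _).sub continuous_const)
  have hK : IsCompact (cspSimplex m n ∩ {φ | ε ≤ Metric.infDist φ (candidateMenu U Φ)}) :=
    (isCompact_cspSimplex m n).inter_right
      (isClosed_le continuous_const (Metric.continuous_infDist_pt _))
  rcases Set.eq_empty_or_nonempty
    (cspSimplex m n ∩ {φ | ε ≤ Metric.infDist φ (candidateMenu U Φ)}) with h | h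
  · refine ⟨1, one_pos, fun φ hφ _ => ?_⟩
    by_contra hcon
    exact (Set.eq_empty_iff_forall_notMem.1 h φ) ⟨hφ, not_lt.1 hcon⟩
  · obtain ⟨φ₀, hφ₀, hmin⟩ := hK.exists_isMinOn h hfc.continuousOn
    have hpos : 0 < f φ₀ := by
      by_contra hcon
      have h0 : f φ₀ = 0 := le_antisymm (not_lt.1 hcon)
        (Finset.sum_nonneg fun i _ => le_max_left _ _)
      rw [hf, Finset.sum_eq_zero_iff_of_nonneg (fun i _ => le_max_left _ _)] at h0
      have hmem : φ₀ ∈ candidateMenu U Φ := ⟨hφ₀.1, fun i => by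
        have := h0 i (Finset.mem_univ i)
        have h1 := le_max_right 0 (cspPayoff (U i) φ₀ - cspPayoff (U i) (Φ i))
        linarith⟩
      have h1 : ε ≤ Metric.infDist φ₀ (candidateMenu U Φ) := hφ₀.2
      rw [Metric.infDist_zero_of_mem hmem] at h1
      linarith
    refine ⟨f φ₀ / (k + 1), by positivity, fun φ hφ hle => ?_⟩
    by_contra hcon
    have h1 : f φ₀ ≤ f φ := hmin ⟨hφ, not_lt.1 hcon⟩
    have h2 : f φ ≤ ∑ _i : Fin k, f φ₀ / (k + 1) := Finset.sum_le_sum fun i _ =>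
      max_le (by positivity) (by linarith [hle i])
    simp only [Finset.sum_const, Finset.card_univ, Fintype.card_fin, nsmul_eq_mul] at h2
    have h3 : (k : ℝ) * (f φ₀ / (k + 1)) < f φ₀ := by
      rw [← mul_div_assoc, div_lt_iff₀ (by positivity)]
      nlinarith
    linarith

lemma avgCSP_mem_cspSimplex {T : ℕ} (hT : 0 < T) (x : ℕ → Mixed m) (y : ℕ → Mixed n) :
    avgCSP T x y ∈ cspSimplex m n := by
  have hT' : (T : ℝ) ≠ 0 := by exact_mod_cast hT.ne'
  refine ⟨fun p => ?_, ?_⟩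
  · rw [avgCSP_apply]
    exact mul_nonneg (by positivity)
      (Finset.sum_nonneg fun t _ => mul_nonneg ((x t).2.1 _) ((y t).2.1 _))
  · simp only [avgCSP_apply, ← Finset.mul_sum]
    rw [Finset.sum_comm]
    have : ∀ t, ∑ p : Fin m × Fin n, (x t).1 p.1 * (y t).1 p.2 = 1 := fun t => by
      rw [Fintype.sum_prod_type]
      simp only [← Finset.mul_sum]
      rw [(y t).2.2]
      simp only [mul_one]
      exact (x t).2.2
    simp only [this, Finset.sum_const, Finset.card_range, nsmul_eq_mul, mul_one]
    exact inv_mul_cancel₀ hT'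

lemma cspPayoff_avgCSP (u : Fin m → Fin n → ℝ) (T : ℕ) (x : ℕ → Mixed m) (y : ℕ → Mixed n) :
    cspPayoff u (avgCSP T x y) = (T : ℝ)⁻¹ * ∑ t ∈ Finset.range T, mixedPayoff u (x t) (y t) := by
  simp only [cspPayoff, avgCSP_apply, mixedPayoff, mul_assoc, ← Finset.mul_sum, Finset.sum_mul]
  congr 1
  rw [Finset.sum_comm (s := Finset.range T)]
  refine Finset.sum_congr rfl fun a _ => ?_
  rw [Finset.sum_comm]
  exact Finset.sum_congr rfl fun t _ => by rw [Finset.mul_sum]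

/-- By the regret bound, the menus of finite horizon violate the constraints of the candidate menu
by a vanishing amount. -/
lemma finiteMenu_subset (hm : 0 < m) (hk : 0 < k) (hU : ∀ i a b, |U i a b| ≤ 1)
    (hΦ : ∀ i, Φ i ∈ cspSimplex m n) {T : ℕ} (hT : 0 < T) :
    (blackwellAlg U Φ z).finiteMenu T ⊆ {φ | φ ∈ cspSimplex m n ∧ ∀ i,
      cspPayoff (U i) φ ≤ cspPayoff (U i) (Φ i) + 55 * (Real.sqrt (logFactor k * T) / T)} := by
  have hT' : (0 : ℝ) < T := by exact_mod_cast hT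
  refine convexHull_min ?_ ?_
  · rintro φ ⟨x, y, h, rfl⟩
    refine ⟨avgCSP_mem_cspSimplex hT x y, fun i => ?_⟩
    have h1 := regret_le hU hΦ hm hk h i
    rw [Finset.sum_sub_distrib, Finset.sum_const, Finset.card_range, nsmul_eq_mul] at h1
    rw [cspPayoff_avgCSP, inv_mul_le_iff₀ hT']
    have : (T : ℝ) * (cspPayoff (U i) (Φ i) + 55 * (Real.sqrt (logFactor k * T) / T)) =
        T * cspPayoff (U i) (Φ i) + 55 * Real.sqrt (logFactor k * T) := by
      field_simp
    rw [this]
    linarith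
  · rintro φ ⟨hφ, hφ'⟩ ψ ⟨hψ, hψ'⟩ α β hα hβ hαβ
    refine ⟨⟨fun p => ?_, ?_⟩, fun i => ?_⟩
    · simp only [PiLp.add_apply, PiLp.smul_apply, smul_eq_mul]
      exact add_nonneg (mul_nonneg hα (hφ.1 p)) (mul_nonneg hβ (hψ.1 p))
    · simp only [PiLp.add_apply, PiLp.smul_apply, smul_eq_mul, Finset.sum_add_distrib,
        ← Finset.mul_sum, hφ.2, hψ.2]
      linarith
    · rw [cspPayoff_add_smul]
      calc _ ≤ α * _ + β * _ := add_le_add (mul_le_mul_of_nonneg_left (hφ' i) hα)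
            (mul_le_mul_of_nonneg_left (hψ' i) hβ)
        _ = _ := by rw [← add_mul, hαβ, one_mul]

lemma tendsto_sqrt_div (c : ℝ) :
    Filter.Tendsto (fun T : ℕ => Real.sqrt (c * T) / T) Filter.atTop (nhds 0) := by
  rcases le_total c 0 with hc | hc
  · refine tendsto_const_nhds.congr fun T => ?_
    rw [Real.sqrt_eq_zero_of_nonpos (mul_nonpos_of_nonpos_of_nonneg hc (Nat.cast_nonneg T)),
      zero_div]
  · have h : Filter.Tendsto (fun T : ℕ => Real.sqrt c * (Real.sqrt T)⁻¹) Filter.atTop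
        (nhds (Real.sqrt c * 0)) :=
      (Filter.Tendsto.inv_tendsto_atTop
        (Real.tendsto_sqrt_atTop.comp tendsto_natCast_atTop_atTop)).const_mul _
    rw [mul_zero] at h
    refine h.congr fun T => ?_
    rw [Real.sqrt_mul hc, mul_div_assoc, Real.sqrt_div_self', one_div]

/-- The menu of the algorithm is the whole candidate menu. -/
theorem isMenu_candidateMenu (hm : 0 < m) (hk : 0 < k) (hn : 2 ≤ n)
    (hU : ∀ i a b, |U i a b| ≤ 1) (hΦ : IncentiveCompatible U Φ) :
    (blackwellAlg U Φ z).IsMenu (candidateMenu U Φ) := by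
  refine ⟨isClosed_candidateMenu U Φ, ?_⟩
  have hne : (candidateMenu U Φ).Nonempty :=
    ⟨Φ ⟨0, hk⟩, hΦ.1 _, fun i => hΦ.2 i _⟩
  obtain ⟨K, hK⟩ := exists_play hm hk hn hU hΦ.1 z
  rw [ENNReal.tendsto_nhds_zero]
  intro ε' hε'
  obtain ⟨ε, hε, hεε'⟩ : ∃ ε : ℝ, 0 < ε ∧ ENNReal.ofReal ε ≤ ε' := by
    obtain ⟨r, hr, hr'⟩ := ENNReal.lt_iff_exists_nnreal_btwn.1 hε'
    exact ⟨r, by exact_mod_cast hr, by rw [ENNReal.ofReal_coe_nnreal]; exact hr'.le⟩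
  obtain ⟨δ, hδ, hslack⟩ := exists_slack hε
  have t1 := (tendsto_sqrt_div (logFactor k)).const_mul 55
  have t2 := (tendsto_sqrt_div (logFactor k)).const_mul K
  rw [mul_zero] at t1 t2
  filter_upwards [t1.eventually (ge_mem_nhds hδ), t2.eventually (ge_mem_nhds hε),
    Filter.eventually_gt_atTop 0] with T h1 h2 hT
  refine (Metric.hausdorffEDist_le_of_infEDist (fun φ hφ => ?_) (fun φ hφ => ?_)).trans hεε'
  · obtain ⟨hs, hle⟩ := finiteMenu_subset hm hk hU hΦ.1 hT hφ
    have := hslack φ hs fun i => (hle i).trans (add_le_add le_rfl h1)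
    rw [← ENNReal.ofReal_toReal (Metric.infEDist_ne_top hne)]
    exact ENNReal.ofReal_le_ofReal this.le
  · obtain ⟨x, y, hxy, hd⟩ := hK φ hφ
    have hmem : avgCSP T x y ∈ (blackwellAlg U Φ z).finiteMenu T :=
      subset_convexHull ℝ _ ⟨x, y, hxy T, rfl⟩
    refine (Metric.infEDist_le_edist_of_mem hmem).trans ?_
    rw [edist_comm, edist_dist]
    exact ENNReal.ofReal_le_ofReal ((hd T hT).trans h2)

lemma exists_play_tendsto (hm : 0 < m) (hk : 0 < k) (hn : 2 ≤ n)
    (hU : ∀ i a b, |U i a b| ≤ 1) (hΦ : ∀ i, Φ i ∈ cspSimplex m n) (z : Mixed n)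
    {φ : CSPSpace m n} (hφ : φ ∈ candidateMenu U Φ) :
    ∃ (x : ℕ → Mixed m) (y : ℕ → Mixed n), (∀ T, (blackwellAlg U Φ z).IsTranscript T x y) ∧
      Filter.Tendsto (fun T => avgCSP T x y) Filter.atTop (nhds φ) := by
  obtain ⟨K, hK⟩ := exists_play hm hk hn hU hΦ z
  obtain ⟨x, y, hxy, hd⟩ := hK φ hφ
  refine ⟨x, y, hxy, ?_⟩
  rw [tendsto_iff_dist_tendsto_zero]
  have t2 := (tendsto_sqrt_div (logFactor k)).const_mul K
  rw [mul_zero] at t2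
  refine squeeze_zero' (Filter.Eventually.of_forall fun _ => dist_nonneg) ?_ t2
  filter_upwards [Filter.eventually_gt_atTop 0] with T hT using hd T hT

end Menu

end

end MenuGame

theorem theorem4p16 :
    ∃ (BlackwellAbort : Prog) (C : ℝ) (d : ℕ),
      ∀ (m n k : ℕ), 2 ≤ n → 1 ≤ k →
      ∀ (U : Fin k → Fin m → Fin n → ℝ), (∀ i a b, |U i a b| ≤ 1) →
      ∀ (Φ : Fin k → CSPSpace m n), IncentiveCompatible U Φ →
      ∃ A : AbortableAlg m n,
        Implements BlackwellAbort U Φ A (fun t => d * (m + n + k + t) ^ d) ∧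
        (∀ (τ : ℕ) (x : ℕ → Mixed m) (y : ℕ → Mixed n), A.IsTranscript τ x y →
          ∀ i, ∑ t ∈ Finset.range τ, (mixedPayoff (U i) (x t) (y t) - cspPayoff (U i) (Φ i))
            ≤ C * Real.sqrt (τ * Real.log (max k 2))) ∧
        (A.MayAbort → ¬ ResponseSatisfiable outer (candidateMenu U Φ)) ∧
        ∃ M : Set (CSPSpace m n), A.IsMenu M ∧ M ⊆ candidateMenu U Φ ∧
          ∀ i, Φ i ∈ M ∧
            ∃ (x : ℕ → Mixed m) (y : ℕ → Mixed n), (∀ T, A.IsTranscript T x y) ∧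
              Filter.Tendsto (fun T => avgCSP T x y) Filter.atTop (nhds (Φ i)) := by
  refine ⟨blackwellAbort, 165, costDegree, fun m n k hn hk U hU Φ hΦ => ?_⟩
  -- there are no profiles, and hence no assignments, without actions of the learner
  have hm : 0 < m := by
    rcases Nat.eq_zero_or_pos m with rfl | h
    · have := (hΦ.1 ⟨0, hk⟩).2
      simp at this
    · exact h
  have z : Mixed n := stdSimplex.vertex (S := ℝ) (⟨0, by omega⟩ : Fin n)
  have hmem : ∀ i, Φ i ∈ candidateMenu U Φ := fun i => ⟨hΦ.1 i, fun j => hΦ.2 j i⟩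
  refine ⟨blackwellAlg U Φ z, implements_blackwellAlg hm hk hU hΦ.1, fun τ x y h i => ?_,
    not_responseSatisfiable hU hΦ.1 hm hk, candidateMenu U Φ,
    isMenu_candidateMenu hm hk hn hU hΦ, subset_rfl, fun i =>
    ⟨hmem i, exists_play_tendsto hm hk hn hU hΦ.1 z (hmem i)⟩⟩
  -- `55 * 3 = 165`, as `L ≤ 5 log (max k 2) ≤ 9 log (max k 2)`
  have h1 := regret_le hU hΦ.1 hm hk h i
  have h2 : Real.sqrt (logFactor k * τ) ≤ 3 * Real.sqrt (τ * Real.log (max k 2)) := by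
    rw [show (3 : ℝ) = Real.sqrt 9 by
      rw [show (9 : ℝ) = 3 ^ 2 by norm_num]; simp, ← Real.sqrt_mul (by norm_num)]
    apply Real.sqrt_le_sqrt
    have h3 := mul_le_mul_of_nonneg_right (logFactor_le_log hk) (Nat.cast_nonneg (α := ℝ) τ)
    have h4 : 0 ≤ Real.log (max (k : ℝ) 2) := Real.log_nonneg (le_max_of_le_right (by norm_num))
    nlinarith [mul_nonneg h4 (Nat.cast_nonneg (α := ℝ) τ)]
  linarith
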